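/- Let $F$ be a totally real number field, $\xi=[F:\mathbb Q]$, $\mathcal O$ its ring of integers, $d_F=|\mathrm{disc}(F)|$, $\mathbb A_{F,f}$ the finite adeles, $\hat{\mathcal O}\subset\mathbb A_{F,f}$ the integral finite adeles, $\mathbb I_F$ the ideles, $F_{\mathbb R}^\times=(\mathbb R^\times)^{\xi}$, $\|t\|_f=\prod_{v\nmid\infty}|t_v|_v$. Let $G=\mathrm{Res}_{F/\mathbb Q}GL_2$, with upper triangular subgroup $B$, diagonal torus $T$ and centre $Z$; $V(\mathbb A_f)=\mathbb A_{F,f}^2$, $e^1=(1,0)^t$; $\pi_0(G(\mathbb R))=\{\pm1\}^\xi$ via the determinant, $\pi_0(B(\mathbb R))=\pi_0(T(\mathbb R))=\{\pm1\}^\xi\times\{\pm1\}^\xi$. Let $m\ge 0$ be an integer. *Measures and Fourier transform.* Let $dx$ and $d^\times t$ be the Haar measures on $\mathbb A_{F,f}$ and $\mathbb A_{F,f}^\times=Z(\mathbb A_f)$ with $dx(\hat{\mathcal O})=d^\times t(\hat{\mathcal O}^\times)=d_F^{-1/2}$, and $dv=dx\,dx$ on $V(\mathbb A_f)$. Let $\psi_0=\exp(2\pi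 i\lambda)$ on $\mathbb A_{\mathbb Q,f}$, where $\lambda=\sum_p\lambda_p$, $\lambda_p:\mathbb Q_p\to\mathbb Q_p/\mathbb Z_p\subset\mathbb Q/\mathbb Z$, and $\hat\varphi(x)=\int_{V(\mathbb A_f)}\varphi(v)\,\overline{\psi_0(\mathrm{Tr}_{F/\mathbb Q}\det(x,v))}\,dv$. *Source.* Let $\mathcal S$ be the space of functions $f(v,x)$ of $v\in V(\mathbb A_f)$, $x\in G(\mathbb A_f)\times\pi_0(G(\mathbb R))$, with values in $\mathbb C$, such that $f(\cdot,x)$ is locally constant with compact support for all $x$, $f(v,kx)=f(v,x)$ for all $k$ in some compact open subgroup of $G(\mathbb A_f)$, and $f(v,x\gamma)=f(v,x)$ for all $\gamma\in G(\mathbb Q)=GL_2(F)$. *Target.* Let $\gamma_{m,1}(t_1,t_2)=N(t_2)^{-(m+2)}$ on $T(\mathbb R)$. A Hecke character of type $\gamma_{m,1}$ is a continuous homomorphism $\phi:T(\mathbb A)/T(\mathbb Q)\to\mathbb C^\times$ which equals $\gamma_{m,1}^{-1}$ on $T(\mathbb R)^0$. Put $\mathrm{sgn}(\phi)=\phi|_{T(\mathbb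 R)}\gamma_{m,1}$, a character of $\pi_0(T(\mathbb R))$, and $\tilde\phi_f=\phi|_{T(\mathbb A_f)}\cdot\mathrm{sgn}(\phi)$, regarded as a character of $B(\mathbb A_f)\times\pi_0(B(\mathbb R))$. Let $X_m$ be the set of those $\phi$ of type $\gamma_{m,1}$ with $\tilde\phi_f|_{Z(\mathbb R)}=1$, and let $$I_m=\mathrm{Ind}_{B(\mathbb A_f)\times\pi_0(B(\mathbb R))}^{G(\mathbb A_f)\times\pi_0(G(\mathbb R))}\bigoplus_{\phi\in X_m}\mathbb C\cdot\tilde\phi_f,$$ where $\mathrm{Ind}\,\mathbb C\tilde\phi_f$ consists of the functions $\psi$ on $G(\mathbb A_f)\times\pi_0(G(\mathbb R))$ that are left invariant under a compact open subgroup of $G(\mathbb A_f)$ and satisfy $\psi(xb)=\psi(x)\tilde\phi_f(b)$. *The map.* For a compact open subgroup $K\subset G(\mathbb A_f)$ with $\det K=K\cap Z(\mathbb A_f)$ let $Cl_F^K=\mathbb I_F/(\det K\cdot\mathbb R_{>0}^\xi\cdot F^\times)$, and let $\widehat{Cl_F^K}(m)$ be the set of its characters $\chi$ with $\chi(t)=\mathrm{sgn}(N(t))^m$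 for $t\in F_{\mathbb R}^\times$. Call $f\in\mathcal S$ $K$-invariant if $f(kv,x)=f(v,x)=f(v,kx)$ for all $k\in K$. The horospherical map is $$\rho_m(f)(g)=\sum_{\chi\in\widehat{Cl_F^K}(m)}\frac{\Gamma(m+2)^\xi}{(-2\pi i)^{\xi(m+2)}}\int_{Z(\mathbb A_f)}\hat f(tg_fe^1,g)\,\chi(\det(g_f)t)\,\|\det(g_f)t\|_f^{m+2}\,d^\times t$$ if $f$ is $K$-invariant, $\hat f$ being the Fourier transform in the first variable. **Proposition.** (1) Every $f\in\mathcal S$ is $K$-invariant for some such $K$; for each such $K$ the sum is finite, the integrands are integrable, and $\rho_m(f)$ does not depend on $K$. It defines a map $\rho_m:\mathcal S\to I_m$. (2) $\rho_m:\mathcal S\to I_m$ is surjective. (3) Explicitly, let $\phi\in X_m$ and $\psi\in\mathrm{Ind}\,\mathbb C\tilde\phi_f$, and write $\phi(t_1,t_2)=\eta(t_1t_2)\chi'(t_2)\|t_2\|^{m+2}$. There are integers $N\ge1$ such that $\phi$ is trivial on $U_N\times U_N$, $U_N=\ker(\hat{\mathcal O}^\times\to(\mathcal O/N\mathcal O)^\times)$,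 and $\psi(kx)=\psi(x)$ for $k\in K_N=\ker(GL_2(\hat{\mathcal O})\to GL_2(\mathcal O/N\mathcal O))$. For each such $N$ the group $Cl_F^{(N)}=\mathbb I_F/(U_N\mathbb R_{>0}^\xi F^\times)$ is finite, and the Euler product $$L=\prod_{v\nmid N\infty}\frac1{1-\chi'(\pi_v)\,N(\mathfrak p_v)^{-(m+2)}}$$ converges to a non-zero number. Put $\overline\psi(x)=\eta(\det x)\psi(\det(x)^{-1}x)$ and let $s\overline\psi$ be the function on $V(\mathbb A_f)$ with value $\overline\psi(x)$ on $xe^1+NV(\hat{\mathcal O})$ for $x\in GL_2(\hat{\mathcal O})$, and $0$ elsewhere. For every full set $R$ of representatives of $Cl_F^{(N)}$ there is $f\in\mathcal S$ with $$\hat f(v,g)=\sum_{u\in R}\chi'_f(u)\,\|u\|_f^{m+2}\,\eta(\det g)\,s\overline\psi(uv),$$ and $$\rho_m(f)=\frac{|Cl_F^{(N)}|\,\Gamma(m+2)^\xi}{(-2\pi i)^{\xi(m+2)}}\cdot\frac1{\sqrt{d_F}}\cdot L\cdot\psi .$$ -/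

import Mathlib

open IsDedekindDomain HeightOneSpectrum NumberField MeasureTheory Valued

noncomputable section

namespace Horospherical

variable (F : Type*) [Field F] [NumberField F]

/-- The ring `𝔸_{F,f}` of finite adeles of `F`. -/
abbrev Af := FiniteAdeleRing (𝓞 F) F

/-- The group `𝕀_F` of ideles of `F` (with infinite and finite component). -/
abbrev Ideles := (AdeleRing (𝓞 F) F)ˣ

theorem finite_residueField (v : HeightOneSpectrum (𝓞 F)) :
    Finite (IsLocalRing.ResidueField (v.adicCompletionIntegers F)) := by
  have hq : Finite (𝓞 F ⧸ v.asIdeal) := v.asIdeal.finiteQuotientOfFreeOfNeBot v.ne_bot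
  let f : 𝓞 F →+* IsLocalRing.ResidueField (v.adicCompletionIntegers F) :=
    (IsLocalRing.residue _).comp (algebraMap (𝓞 F) (v.adicCompletionIntegers F))
  have hval : ∀ a : 𝓞 F, Valued.v ((algebraMap (𝓞 F) (v.adicCompletionIntegers F) a : v.adicCompletionIntegers F) : v.adicCompletion F) = v.valuation F (algebraMap (𝓞 F) F a) := by
    intro a
    exact v.valuedAdicCompletion_eq_valuation' (algebraMap (𝓞 F) F a)
  have hres : ∀ x : v.adicCompletionIntegers F, IsLocalRing.residue _ x = 0 ↔ Valued.v (x : v.adicCompletion F) < 1 := by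
    intro x
    rw [IsLocalRing.residue_eq_zero_iff, IsLocalRing.mem_maximalIdeal, mem_nonunits_iff, adicCompletionIntegers.isUnit_iff_valued_eq_one]
    exact ⟨fun h => lt_of_le_of_ne x.2 h, fun h => h.ne⟩
  have hf : ∀ a ∈ v.asIdeal, f a = 0 := by
    intro a ha
    refine (hres _).2 ?_
    rw [hval, valuation_of_algebraMap]
    exact (v.intValuation_lt_one_iff_mem a).2 ha
  refine Finite.of_surjective (Ideal.Quotient.lift v.asIdeal f hf) ?_
  refine Ideal.Quotient.lift_surjective_of_surjective _ _ ?_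
  intro y
  obtain ⟨x, rfl⟩ := IsLocalRing.residue_surjective y
  have hopen : IsOpen {z : v.adicCompletion F | Valued.v (z - x) < 1} := by
    have : IsOpen {z : v.adicCompletion F | Valued.v z < 1} := by simpa using Valued.isOpen_ball (v.adicCompletion F) 1
    exact this.preimage (continuous_sub_right (x : v.adicCompletion F))
  obtain ⟨k, hk⟩ := (denseRange_algebraMap F v).exists_mem_open hopen ⟨x, by simp⟩
  have hk1 : v.valuation F k ≤ 1 := by
    rw [← v.valuedAdicCompletion_eq_valuation' k]
    have h1 : (algebraMap F (v.adicCompletion F) k) = (algebraMap F (v.adicCompletion F) k - x) + x := by ring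
    have h2 : Valued.v (algebraMap F (v.adicCompletion F) k) ≤ 1 := by
      rw [h1]
      exact (Valued.v.map_add _ _).trans (max_le hk.le x.2)
    exact h2
  obtain ⟨a, ha⟩ := exists_valuation_sub_lt_of_integer v hk1 1
  refine ⟨a, ?_⟩
  change IsLocalRing.residue _ _ = _
  rw [← sub_eq_zero, ← map_sub, hres]
  have h3 : ((algebraMap (𝓞 F) (v.adicCompletionIntegers F) a - x : v.adicCompletionIntegers F) : v.adicCompletion F) = algebraMap F (v.adicCompletion F) (algebraMap (𝓞 F) F a - k) + (algebraMap F (v.adicCompletion F) k - x) := by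
    rw [map_sub]
    push_cast
    have : ((algebraMap (𝓞 F) (v.adicCompletionIntegers F) a : v.adicCompletionIntegers F) : v.adicCompletion F) = algebraMap F (v.adicCompletion F) (algebraMap (𝓞 F) F a) := rfl
    rw [this]; ring
  have h4 : Valued.v (algebraMap F (v.adicCompletion F) (algebraMap (𝓞 F) F a - k)) < 1 := by
    have := v.valuedAdicCompletion_eq_valuation' (algebraMap (𝓞 F) F a - k)
    rw [show algebraMap F (v.adicCompletion F) (algebraMap (𝓞 F) F a - k) = ((algebraMap (𝓞 F) F a - k : F) : v.adicCompletion F) from rfl, this]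
    simpa using ha
  rw [h3]
  exact lt_of_le_of_lt (Valued.v.map_add _ _) (max_lt h4 hk)

theorem compactSpace_adicIntegers (v : HeightOneSpectrum (𝓞 F)) :
    CompactSpace (v.adicCompletionIntegers F) := by
  have := finite_residueField F v
  have h := (Valued.integer.compactSpace_iff_completeSpace_and_isDiscreteValuationRing_and_finite_residueField (K := v.adicCompletion F) (Γ₀ := WithZero (Multiplicative ℤ))).2
  have hc : IsClosed ((v.adicCompletionIntegers F : Set (v.adicCompletion F))) := Valued.isClosed_valuationSubring _
  exact h ⟨hc.completeSpace_coe, inferInstanceAs (IsDiscreteValuationRing (v.adicCompletionIntegers F)), this⟩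

/-- The subring `Ô` of integral finite adeles. -/
def integralAdeles : Subring (Af F) where
  carrier := {x | ∀ v, x v ∈ v.adicCompletionIntegers F}
  mul_mem' hx hy v := mul_mem (hx v) (hy v)
  one_mem' v := one_mem (v.adicCompletionIntegers F)
  add_mem' hx hy v := add_mem (hx v) (hy v)
  zero_mem' v := zero_mem (v.adicCompletionIntegers F)
  neg_mem' hx v := neg_mem (hx v)

theorem isOpen_integralAdeles : IsOpen (integralAdeles F : Set (Af F)) :=
  RestrictedProduct.isOpen_forall_mem
    (A := fun v : HeightOneSpectrum (𝓞 F) =>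
      (v.adicCompletionIntegers F : Set (v.adicCompletion F)))
    fun _ => Valued.isOpen_valuationSubring _

theorem isCompact_integralAdeles : IsCompact (integralAdeles F : Set (Af F)) := by
  have := compactSpace_adicIntegers F
  have h := isCompact_range (RestrictedProduct.isEmbedding_structureMap
    (R := fun v : HeightOneSpectrum (𝓞 F) => v.adicCompletion F)
    (A := fun v => (v.adicCompletionIntegers F : Set (v.adicCompletion F)))
    (𝓕 := Filter.cofinite)).continuous
  rw [RestrictedProduct.range_structureMap] at h
  exact h

instance : T2Space (Af F) :=
  inferInstanceAs (T2Space (RestrictedProduct (fun v : HeightOneSpectrum (𝓞 F) =>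
    v.adicCompletion F) (fun v => (v.adicCompletionIntegers F : Set (v.adicCompletion F)))
    Filter.cofinite))

/-- The group `Ô^×` inside the finite ideles. -/
def integralUnits : Subgroup (Af F)ˣ := (integralAdeles F).toSubmonoid.units

theorem isOpen_integralUnits : IsOpen (integralUnits F : Set (Af F)ˣ) :=
  Submonoid.isOpen_units (isOpen_integralAdeles F)

theorem isCompact_integralUnits : IsCompact (integralUnits F : Set (Af F)ˣ) := by
  have h : IsCompact ((integralAdeles F : Set (Af F)) ×ˢ
      (MulOpposite.unop ⁻¹' (integralAdeles F : Set (Af F)))) :=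
    (isCompact_integralAdeles F).prod
      (MulOpposite.opHomeomorph.symm.isCompact_preimage.2 (isCompact_integralAdeles F))
  have h2 := (Units.isClosedEmbedding_embedProduct (α := Af F)).isCompact_preimage h
  exact h2

instance : MeasurableSpace (Af F) := borel _
instance : BorelSpace (Af F) := ⟨rfl⟩
instance : MeasurableSpace (Af F)ˣ := borel _
instance : BorelSpace (Af F)ˣ := ⟨rfl⟩

/-- The normalized absolute value `‖t‖_f = ∏_v |t_v|_v` of a finite idele. -/
def finNorm (t : (Af F)ˣ) : ℝ := ∏ᶠ v : HeightOneSpectrum (𝓞 F), ‖(t : Af F) v‖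

/-- The Haar measure `dx` on `𝔸_{F,f}` with `dx(Ô) = d_F^{-1/2}`, where `d_F = |disc F|`.
(This is the product of the local measures with `dx_v(O_v) = N(𝔡_v)^{-1/2}`.) -/
def addMeasure : Measure (Af F) :=
  ENNReal.ofReal (1 / √|(discr F : ℝ)|) • Measure.addHaarMeasure
    ⟨⟨integralAdeles F, isCompact_integralAdeles F⟩,
      ⟨0, (isOpen_integralAdeles F).interior_eq.symm ▸ (integralAdeles F).zero_mem⟩⟩

/-- The Haar measure `d^×t` on `𝔸_{F,f}^×` with `d^×t(Ô^×) = d_F^{-1/2}`. (This is the product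
of the local measures `q_v / (q_v - 1) · dx_v / |x_v|`.) -/
def mulMeasure : Measure (Af F)ˣ :=
  ENNReal.ofReal (1 / √|(discr F : ℝ)|) • Measure.haarMeasure
    ⟨⟨integralUnits F, isCompact_integralUnits F⟩,
      ⟨1, (isOpen_integralUnits F).interior_eq.symm ▸ (integralUnits F).one_mem⟩⟩

open Classical in
/-- The character `x ↦ ψ₀(Tr x)` of `𝔸_{F,f}`, where `ψ₀ = exp(2πi λ)` and `λ = ∑_p λ_p` with
`λ_p : ℚ_p → ℚ_p / ℤ_p ⊂ ℚ / ℤ`. Every finite adele `x` is the sum of some `a ∈ F` and an integral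
adele; the integral adele has trace in `∏_p ℤ_p`, so the value at `x` is `exp(2πi Tr a)`, and it
does not depend on the choice of `a`. (The second branch is never used.) -/
def adelicChar (x : Af F) : ℂ :=
  if h : ∃ a : F, x - algebraMap F (Af F) a ∈ integralAdeles F then
    Complex.exp (2 * Real.pi * Complex.I * ((Algebra.trace ℚ F h.choose : ℚ) : ℂ))
  else 1

/-- The Fourier transform `φ̂(x) = ∫ φ(v) \overline{ψ₀(Tr det(x, v))} dv` on `𝔸_{F,f}²`,
where `dv = dx × dx`. -/
def finFourier (φ : (Fin 2 → Af F) → ℂ) (x : Fin 2 → Af F) : ℂ :=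
  ∫ a, ∫ b, φ ![a, b] * starRingEnd ℂ (adelicChar F (x 0 * b - x 1 * a))
    ∂addMeasure F ∂addMeasure F

/-! ### Ideles and characters -/

/-- Families of signs, one for each infinite place. For totally real `F` this is both `π₀(G(ℝ))`
(via the determinant) and `π₀(F_ℝ^×)`. -/
abbrev Signs := InfinitePlace F → ℤˣ

/-- The finite idele `t` as an idele with infinite component `1`. -/
def finIdele : (Af F)ˣ →* Ideles F :=
  (MulEquiv.prodUnits (M := InfiniteAdeleRing F) (N := Af F)).symm.toMonoidHom.comp
    (MonoidHom.inr _ _)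

/-- The finite component of an idele. -/
def finPart : Ideles F →* (Af F)ˣ :=
  (MonoidHom.snd _ _).comp
    (MulEquiv.prodUnits (M := InfiniteAdeleRing F) (N := Af F)).toMonoidHom

/-- The principal ideles. -/
def principal : Fˣ →* Ideles F := Units.map (algebraMap F (AdeleRing (𝓞 F) F)).toMonoidHom

/-- The sign of a non-zero real number. -/
def realSign (x : ℝ) : ℤˣ := if 0 < x then 1 else -1

/-- A sign as a real number `±1`, at each infinite place. -/
def signReal : Signs F →* (InfinitePlace F → ℝˣ) :=
  MonoidHom.compLeft (Units.map (Int.castRingHom ℝ).toMonoidHom) (InfinitePlace F)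

/-- The norm `N(x) = ∏_v x_v` of `x ∈ F_ℝ^×`, as a complex number. -/
def realNorm (x : InfinitePlace F → ℝˣ) : ℂˣ :=
  Units.map Complex.ofRealHom.toMonoidHom (∏ v, x v)

/-- The character `γ_{m,n}(x, y) = N(y)^{-(m+n+1)} N(x)^{-(n-1)}` of the real points of the torus
of diagonal matrices `diag(x, y)`. -/
def gammaChar (m : ℕ) (n : ℤ) (x y : InfinitePlace F → ℝˣ) : ℂˣ :=
  realNorm F y ^ (-((m : ℤ) + n + 1)) * realNorm F x ^ (-(n - 1))

/-- An element of `F_ℝ^× = ∏_{v | ∞} ℝ^×` as an idele with finite component `1`. -/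
def realIdele [IsTotallyReal F] : (InfinitePlace F → ℝˣ) →* Ideles F :=
  (MulEquiv.prodUnits (M := InfiniteAdeleRing F) (N := Af F)).symm.toMonoidHom.comp
    ((MonoidHom.inl _ _).comp
      ((MulEquiv.piUnits (M := fun v : InfinitePlace F => v.Completion)).symm.toMonoidHom.comp
        (MonoidHom.piMap fun v => Units.map
          (InfinitePlace.Completion.ringEquivRealOfIsReal
            (IsTotallyReal.isReal v)).symm.toRingHom.toMonoidHom)))

/-- `φ : T(𝔸) / T(ℚ) → ℂ^×` is an algebraic Hecke character of type `γ_{m,n}`: continuous,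
trivial on principal ideles, equal to `γ_{m,n}^{-1}` on `T(ℝ)⁰`. The pair `(t₁, t₂)` of ideles is
the diagonal matrix `diag(t₁, t₂)`. -/
structure IsHeckeOfType [IsTotallyReal F] (m : ℕ) (n : ℤ) (φ : Ideles F × Ideles F →* ℂˣ) : Prop where
  continuous : Continuous φ
  map_principal : ∀ a b : Fˣ, φ (principal F a, principal F b) = 1
  map_pos : ∀ x y : InfinitePlace F → ℝˣ, (∀ v, 0 < (x v : ℝ)) → (∀ v, 0 < (y v : ℝ)) →
    φ (realIdele F x, realIdele F y) = (gammaChar F m n x y)⁻¹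

/-- The character `sgn(φ) = φ|_{T(ℝ)} · γ_{m,n}` of `π₀(T(ℝ))`. -/
def heckeSign [IsTotallyReal F] (m : ℕ) (n : ℤ) (φ : Ideles F × Ideles F →* ℂˣ)
    (ε₁ ε₂ : Signs F) : ℂˣ :=
  φ (realIdele F (signReal F ε₁), realIdele F (signReal F ε₂)) *
    gammaChar F m n (signReal F ε₁) (signReal F ε₂)

/-! ### The groups `G(𝔸_f) × π₀(G(ℝ))` and `B(𝔸_f) × π₀(B(ℝ))` -/

/-- `G(𝔸_f) × π₀(G(ℝ))`. -/
abbrev Gpi := GL (Fin 2) (Af F) × Signs F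

/-- The ring of `2 × 2` matrices with entries in `Ô`. -/
def integralMatrices : Subring (Matrix (Fin 2) (Fin 2) (Af F)) := (integralAdeles F).matrix

/-- The subgroup `GL₂(Ô)` of `GL₂(𝔸_{F,f})`. -/
def levelOne : Subgroup (GL (Fin 2) (Af F)) := (integralMatrices F).toSubmonoid.units

theorem coe_integralMatrices : (integralMatrices F : Set (Matrix (Fin 2) (Fin 2) (Af F))) =
    Set.univ.pi fun _ => Set.univ.pi fun _ => (integralAdeles F : Set (Af F)) := by
  ext M
  exact ⟨fun h i _ j _ => h i j, fun h i j => h i trivial j trivial⟩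

theorem isOpen_levelOne : IsOpen (levelOne F : Set (GL (Fin 2) (Af F))) := by
  refine Submonoid.isOpen_units (U := (integralMatrices F).toSubmonoid) ?_
  change IsOpen (integralMatrices F : Set (Matrix (Fin 2) (Fin 2) (Af F)))
  rw [coe_integralMatrices]
  exact isOpen_set_pi Set.finite_univ fun _ _ =>
    isOpen_set_pi Set.finite_univ fun _ _ => isOpen_integralAdeles F

theorem isCompact_levelOne : IsCompact (levelOne F : Set (GL (Fin 2) (Af F))) := by
  have h0 : IsCompact (integralMatrices F : Set (Matrix (Fin 2) (Fin 2) (Af F))) := by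
    rw [coe_integralMatrices]
    exact isCompact_univ_pi fun _ => isCompact_univ_pi fun _ => isCompact_integralAdeles F
  have h : IsCompact ((integralMatrices F : Set (Matrix (Fin 2) (Fin 2) (Af F))) ×ˢ
      (MulOpposite.unop ⁻¹' (integralMatrices F : Set (Matrix (Fin 2) (Fin 2) (Af F))))) :=
    h0.prod (MulOpposite.opHomeomorph.symm.isCompact_preimage.2 h0)
  have h2 := (Units.isClosedEmbedding_embedProduct
    (α := Matrix (Fin 2) (Fin 2) (Af F))).isCompact_preimage h
  exact h2

/-- The embedding of `G(ℚ) = GL₂(F)` in `G(𝔸_f) × π₀(G(ℝ))`. -/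
def rational [IsTotallyReal F] (γ : GL (Fin 2) F) : Gpi F :=
  (Matrix.GeneralLinearGroup.map (algebraMap F (Af F)) γ, fun v =>
    realSign (InfinitePlace.embedding_of_isReal (IsTotallyReal.isReal v)
      ((Matrix.GeneralLinearGroup.det γ : Fˣ) : F)))

/-- The elements of `B(𝔸_f) × π₀(B(ℝ))`: upper triangular matrices `(t₁, t₁ u; 0, t₂)` together
with the signs of the two diagonal entries at each infinite place. -/
structure BorelPi where
  t₁ : (Af F)ˣ
  t₂ : (Af F)ˣ
  u : Af F
  ε₁ : Signs F
  ε₂ : Signs F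

variable {F} in
/-- The homomorphism `B(𝔸_f) × π₀(B(ℝ)) → G(𝔸_f) × π₀(G(ℝ))`. -/
def BorelPi.toGpi (b : BorelPi F) : Gpi F :=
  (Matrix.GeneralLinearGroup.mk'' !![(b.t₁ : Af F), b.t₁ * b.u; 0, (b.t₂ : Af F)]
    (by rw [Matrix.det_fin_two_of, mul_zero, sub_zero]; exact b.t₁.isUnit.mul b.t₂.isUnit),
    b.ε₁ * b.ε₂)

/-- The character `φ̃_f = φ_f · sgn(φ)` of `B(𝔸_f) × π₀(B(ℝ))`. -/
def heckeTilde [IsTotallyReal F] (m : ℕ) (n : ℤ) (φ : Ideles F × Ideles F →* ℂˣ)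
    (b : BorelPi F) : ℂ :=
  (φ (finIdele F b.t₁, finIdele F b.t₂) * heckeSign F m n φ b.ε₁ b.ε₂ : ℂˣ)

/-- The index set of the target: the algebraic Hecke characters `φ` of type `γ_{m,1}` such that
`φ̃_f` is trivial on the real points of the centre. -/
def heckeChars [IsTotallyReal F] (m : ℕ) : Set (Ideles F × Ideles F →* ℂˣ) :=
  {φ | IsHeckeOfType F m 1 φ ∧ ∀ ε : Signs F, heckeSign F m 1 φ ε ε = 1}

/-- Left invariance of a function on `G(𝔸_f) × π₀(G(ℝ))` under some compact open subgroup of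
`G(𝔸_f)`. -/
def IsSmooth {X : Type*} (ψ : Gpi F → X) : Prop :=
  ∃ K : Subgroup (GL (Fin 2) (Af F)), IsOpen (K : Set (GL (Fin 2) (Af F))) ∧
    IsCompact (K : Set (GL (Fin 2) (Af F))) ∧ ∀ k ∈ K, ∀ x, ψ ((k, 1) * x) = ψ x

variable {F} in
theorem IsSmooth.add {X : Type*} [Add X] {ψ₁ ψ₂ : Gpi F → X} (h₁ : IsSmooth F ψ₁)
    (h₂ : IsSmooth F ψ₂) : IsSmooth F (ψ₁ + ψ₂) := by
  obtain ⟨K, hK, hK', h⟩ := h₁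
  obtain ⟨L, hL, -, h'⟩ := h₂
  refine ⟨K ⊓ L, hK.inter hL, hK'.inter_right (L.isClosed_of_isOpen hL), fun k hk x => ?_⟩
  simp only [Pi.add_apply]
  rw [h k hk.1, h' k hk.2]

/-- The induced module `Ind_{B(𝔸_f) × π₀(B(ℝ))}^{G(𝔸_f) × π₀(G(ℝ))} W`, where `W` is the span of
a set `S` of functions (in our case: characters) on `B(𝔸_f) × π₀(B(ℝ))`. An element is a
`W`-valued equivariant smooth function on `G(𝔸_f) × π₀(G(ℝ))`; such a function `Ψ` is the same
thing as the scalar function `ψ(x) = Ψ(x)(1)`, with `Ψ(x)(b) = ψ(x b)`. If `S = {c}` for a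
character `c`, the condition says `ψ(x b) = ψ(x) c(b)`. -/
def induced (S : Set (BorelPi F → ℂ)) : Submodule ℂ (Gpi F → ℂ) where
  carrier := {ψ | IsSmooth F ψ ∧
    ∀ x, (fun b : BorelPi F => ψ (x * b.toGpi)) ∈ Submodule.span ℂ S}
  add_mem' h₁ h₂ := ⟨h₁.1.add h₂.1, fun x => Submodule.add_mem _ (h₁.2 x) (h₂.2 x)⟩
  zero_mem' := ⟨⟨_, isOpen_levelOne F, isCompact_levelOne F, fun _ _ _ => rfl⟩,
    fun _ => Submodule.zero_mem _⟩
  smul_mem' c ψ h := ⟨by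
    obtain ⟨K, hK, hK', h⟩ := h.1
    exact ⟨K, hK, hK', fun k hk x => congrArg (c * ·) (h k hk x)⟩,
    fun x => Submodule.smul_mem _ c (h.2 x)⟩

/-! ### The horospherical map -/

/-- The space `𝒮(V(𝔸_f), μ^{⊗0} ⊗ ℂ)` of functions `f` on `V(𝔸_f) × G(𝔸_f) × π₀(G(ℝ))` such that
every `f(·, x)` is a Schwartz-Bruhat function, `x ↦ f(·, x)` is left invariant under some compact
open subgroup of `G(𝔸_f)`, and `f(v, x γ) = f(v, x)` for `γ ∈ G(ℚ)`. -/
def schwartz [IsTotallyReal F] : Submodule ℂ ((Fin 2 → Af F) → Gpi F → ℂ) where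
  carrier := {f | (∀ x, IsLocallyConstant (fun v => f v x) ∧ HasCompactSupport (fun v => f v x)) ∧
    IsSmooth F (fun x v => f v x) ∧ ∀ v x γ, f v (x * rational F γ) = f v x}
  add_mem' h₁ h₂ := ⟨fun x => ⟨(h₁.1 x).1.add (h₂.1 x).1, (h₁.1 x).2.add (h₂.1 x).2⟩,
    h₁.2.1.add h₂.2.1, fun v x γ => congrArg₂ (· + ·) (h₁.2.2 v x γ) (h₂.2.2 v x γ)⟩
  zero_mem' := ⟨fun _ => ⟨IsLocallyConstant.const 0, HasCompactSupport.zero⟩,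
    ⟨_, isOpen_levelOne F, isCompact_levelOne F, fun _ _ _ => rfl⟩, fun _ _ _ => rfl⟩
  smul_mem' c f h := ⟨fun x => ⟨(h.1 x).1.comp (c * ·), (h.1 x).2.smul_left (f := fun _ => c)⟩, by
    obtain ⟨K, hK, hK', h⟩ := h.2.1
    exact ⟨K, hK, hK', fun k hk x => congrArg (c • ·) (h k hk x)⟩,
    fun v x γ => congrArg (c * ·) (h.2.2 v x γ)⟩

/-- The image of `K` under the determinant, in the finite ideles. -/
def detGroup (K : Subgroup (GL (Fin 2) (Af F))) : Subgroup (Af F)ˣ :=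
  K.map Matrix.GeneralLinearGroup.det

/-- The subgroup `det(K) · ∏_{v | ∞} ℝ_{>0} · F^×` of the idele group; the quotient of the idele
group by it is `Cl_F^K`. -/
def clSubgroup [IsTotallyReal F] (K : Subgroup (GL (Fin 2) (Af F))) : Subgroup (Ideles F) :=
  (detGroup F K).map (finIdele F) ⊔
    (Subgroup.pi Set.univ fun _ : InfinitePlace F => Units.posSubgroup ℝ).map (realIdele F) ⊔
    (principal F).range

/-- The set `\widehat{Cl_F^K}(m)` of characters `χ` of `Cl_F^K` with `χ(x) = sgn(N(x))^m` for
`x ∈ F_ℝ^×`. -/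
def classChars [IsTotallyReal F] (K : Subgroup (GL (Fin 2) (Af F))) (m : ℕ) :
    Set (Ideles F →* ℂˣ) :=
  {χ | clSubgroup F K ≤ χ.ker ∧ ∀ x : InfinitePlace F → ℝˣ,
    ((χ (realIdele F x) : ℂˣ) : ℂ) = ((realSign (∏ v, (x v : ℝ)) : ℤˣ) : ℤ) ^ m}

variable {F} in
/-- `f` is `K`-invariant, for a compact open subgroup `K` of `G(𝔸_f)` with
`det(K) = K ∩ Z(𝔸_f)`. -/
structure IsLevel (f : (Fin 2 → Af F) → Gpi F → ℂ) (K : Subgroup (GL (Fin 2) (Af F))) : Prop where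
  isOpen : IsOpen (K : Set (GL (Fin 2) (Af F)))
  isCompact : IsCompact (K : Set (GL (Fin 2) (Af F)))
  det_eq : detGroup F K = K.comap (Matrix.GeneralLinearGroup.scalar (Fin 2))
  left : ∀ k ∈ K, ∀ v x, f ((k : Matrix (Fin 2) (Fin 2) (Af F)).mulVec v) x = f v x
  right : ∀ k ∈ K, ∀ v x, f v ((k, 1) * x) = f v x

/-- The integrand `\hat f(t g_f e¹, g) χ(det(g_f) t) ‖det(g_f) t‖_f^{m+2}`, `t ∈ Z(𝔸_f)`, where
the Fourier transform is taken in the first variable and `e¹ = (1, 0)`. -/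
def rhoIntegrand (m : ℕ) (f : (Fin 2 → Af F) → Gpi F → ℂ) (χ : Ideles F →* ℂˣ) (g : Gpi F)
    (t : (Af F)ˣ) : ℂ :=
  finFourier F (fun v => f v g)
      ((t : Af F) • (g.1 : Matrix (Fin 2) (Fin 2) (Af F)).mulVec ![1, 0]) *
    (χ (finIdele F (Matrix.GeneralLinearGroup.det g.1 * t)) : ℂˣ) *
    (finNorm F (Matrix.GeneralLinearGroup.det g.1 * t) : ℂ) ^ (m + 2)

/-- The constant `Γ(m+2)^ξ / (-2πi)^{ξ(m+2)}`, `ξ = [F : ℚ]`. -/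
def gammaFactor (m : ℕ) : ℂ :=
  Complex.Gamma (m + 2) ^ Module.finrank ℚ F /
    (-2 * Real.pi * Complex.I) ^ (Module.finrank ℚ F * (m + 2))

/-- The value of the horospherical map, computed at level `K`; the sum is over a finite set. -/
def rhoAt [IsTotallyReal F] (m : ℕ) (K : Subgroup (GL (Fin 2) (Af F)))
    (f : (Fin 2 → Af F) → Gpi F → ℂ) (g : Gpi F) : ℂ :=
  ∑ᶠ χ ∈ classChars F K m, gammaFactor F m * ∫ t, rhoIntegrand F m f χ g t ∂mulMeasure F

open Classical in
/-- The horospherical map `ρ_m`: the expression above for any `K` such that `f` is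
`K`-invariant. -/
def rho [IsTotallyReal F] (m : ℕ) (f : (Fin 2 → Af F) → Gpi F → ℂ) : Gpi F → ℂ :=
  if h : ∃ K, IsLevel f K then rhoAt F m h.choose f else 0

/-! ### The explicit preimage -/

/-- The subgroup `U_N = ker(Ô^× → (O / N O)^×)` of the finite ideles. -/
def unitLevel (N : ℕ) : Subgroup (Af F)ˣ :=
  (Units.map (Ideal.Quotient.mk (Ideal.span {(N : integralAdeles F)})).toMonoidHom).ker.map
    (Units.map (integralAdeles F).subtype.toMonoidHom)

/-- The principal congruence subgroup `K_N = ker(GL₂(Ô) → GL₂(O / N O))` of `G(𝔸_f)`. -/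
def levelGroup (N : ℕ) : Subgroup (GL (Fin 2) (Af F)) :=
  (Matrix.GeneralLinearGroup.map (n := Fin 2)
    (Ideal.Quotient.mk (Ideal.span {(N : integralAdeles F)}))).ker.map
    (Matrix.GeneralLinearGroup.map (integralAdeles F).subtype)

/-- `Cl_F^{(N)}` is the quotient of the idele group by this subgroup
`U_N · ∏_{v | ∞} ℝ_{>0} · F^×`. -/
def rayClSubgroup [IsTotallyReal F] (N : ℕ) : Subgroup (Ideles F) :=
  (unitLevel F N).map (finIdele F) ⊔
    (Subgroup.pi Set.univ fun _ : InfinitePlace F => Units.posSubgroup ℝ).map (realIdele F) ⊔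
    (principal F).range

/-- `N` is a level for `φ` and `ψ`: `φ` is trivial on `U_N × U_N`, `ψ` is `K_N`-invariant. -/
def IsAdapted (N : ℕ) (φ : Ideles F × Ideles F →* ℂˣ) (ψ : Gpi F → ℂ) : Prop :=
  (∀ a ∈ unitLevel F N, ∀ b ∈ unitLevel F N, φ (finIdele F a, finIdele F b) = 1) ∧
    ∀ k ∈ levelGroup F N, ∀ x, ψ ((k, 1) * x) = ψ x

variable {F}

/-- The character `η` with `φ(t₁, t₂) = η(t₁ t₂) χ'(t₂) ‖t₂‖^{m+2}`. -/
def heckeEta (φ : Ideles F × Ideles F →* ℂˣ) (t : Ideles F) : ℂ := (φ (t, 1) : ℂˣ)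

/-- The finite part `χ'_f` of the character `χ'` with `φ(t₁, t₂) = η(t₁ t₂) χ'(t₂) ‖t₂‖^{m+2}`. -/
def heckeChi (m : ℕ) (φ : Ideles F × Ideles F →* ℂˣ) (t : (Af F)ˣ) : ℂ :=
  (φ (1, finIdele F t) * (φ (finIdele F t, 1))⁻¹ : ℂˣ) * ((finNorm F t : ℂ) ^ (m + 2))⁻¹

/-- The function `\bar ψ(x) = η(det x) ψ(det(x)⁻¹ x)` on `G(𝔸_f)`. -/
def barPsi (φ : Ideles F × Ideles F →* ℂˣ) (ψ : Gpi F → ℂ) (x : GL (Fin 2) (Af F)) : ℂ :=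
  heckeEta φ (finIdele F (Matrix.GeneralLinearGroup.det x)) *
    ψ ((Matrix.GeneralLinearGroup.scalar (Fin 2) (Matrix.GeneralLinearGroup.det x))⁻¹ * x, 1)

open Classical in
/-- The Schwartz-Bruhat function `s\bar ψ` on `V(𝔸_f)`: its value is `\bar ψ(x)` on the set
`x e¹ + N V(Ô)`, for every `x ∈ GL₂(Ô)`, and `0` outside of the union of these sets. -/
def sBarPsi (N : ℕ) (φ : Ideles F × Ideles F →* ℂˣ) (ψ : Gpi F → ℂ) (v : Fin 2 → Af F) : ℂ :=
  if h : ∃ x ∈ levelOne F, ∃ w : Fin 2 → Af F, (∀ i, w i ∈ integralAdeles F) ∧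
      v = (x : Matrix (Fin 2) (Fin 2) (Af F)).mulVec ![1, 0] + (N : Af F) • w then
    barPsi φ ψ h.choose
  else 0

/-- `R` is a full set of representatives of `Cl_F^{(N)}`. -/
def IsRepSystem [IsTotallyReal F] (N : ℕ) (R : Finset (Ideles F)) : Prop :=
  ∀ t : Ideles F, ∃! u, u ∈ R ∧ u⁻¹ * t ∈ rayClSubgroup F N

/-- The determinant of an element of `G(𝔸_f) × π₀(G(ℝ))`, as an idele. -/
def detIdele [IsTotallyReal F] (g : Gpi F) : Ideles F :=
  finIdele F (Matrix.GeneralLinearGroup.det g.1) * realIdele F (signReal F g.2)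

/-- The function `∑_u χ'_f(u) ‖u‖_f^{m+2} η(det g) s\bar ψ(u v)` of `v ∈ V(𝔸_f)` and
`g ∈ G(𝔸_f) × π₀(G(ℝ))`, where `u` runs through `R`. -/
def preimageFourier [IsTotallyReal F] (m N : ℕ) (φ : Ideles F × Ideles F →* ℂˣ) (ψ : Gpi F → ℂ)
    (R : Finset (Ideles F)) (v : Fin 2 → Af F) (g : Gpi F) : ℂ :=
  ∑ u ∈ R, heckeChi m φ (finPart F u) * (finNorm F (finPart F u) : ℂ) ^ (m + 2) *
    heckeEta φ (detIdele g) * sBarPsi N φ ψ ((finPart F u : Af F) • v)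

open Classical in
/-- The finite idele with component `π` at `v` and `1` elsewhere. -/
def localIdele (v : HeightOneSpectrum (𝓞 F)) (π : (v.adicCompletion F)ˣ) : (Af F)ˣ where
  val := RestrictedProduct.mulSingle
    (fun w : HeightOneSpectrum (𝓞 F) => w.adicCompletionIntegers F) v (π : v.adicCompletion F)
  inv := RestrictedProduct.mulSingle
    (fun w : HeightOneSpectrum (𝓞 F) => w.adicCompletionIntegers F) v
    ((π⁻¹ : (v.adicCompletion F)ˣ) : v.adicCompletion F)
  val_inv := (RestrictedProduct.mulSingle_mul _ v _ _).symm.trans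
    ((congrArg _ π.mul_inv).trans (RestrictedProduct.mulSingle_one _ v))
  inv_val := (RestrictedProduct.mulSingle_mul _ v _ _).symm.trans
    ((congrArg _ π.inv_mul).trans (RestrictedProduct.mulSingle_one _ v))

/-- A uniformizer `π_v` at `v`, as a finite idele which is `1` at all other places. -/
def uniformizer (v : HeightOneSpectrum (𝓞 F)) : (Af F)ˣ :=
  localIdele v (Units.map (algebraMap F (v.adicCompletion F)).toMonoidHom
    (Units.mk0 _ (v.valuation_uniformizer_ne_zero F)))

/-- The factor `(1 - χ'(π_v) N(𝔭_v)^{-(m+2)})⁻¹` of the Euler product. -/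
def eulerFactor (m : ℕ) (φ : Ideles F × Ideles F →* ℂˣ) (v : HeightOneSpectrum (𝓞 F)) : ℂ :=
  (1 - heckeChi m φ (uniformizer v) * ((v.asIdeal.absNorm : ℂ) ^ (m + 2))⁻¹)⁻¹

end Horospherical

end

open Horospherical NumberField

open IsDedekindDomain HeightOneSpectrum NumberField MeasureTheory Valued
open Filter Topology

set_option linter.unusedSectionVars false
set_option linter.unusedVariables false

noncomputable section

namespace Horospherical

/-! ### Local norms and approximation in the finite adeles. -/

section

variable {F : Type*} [Field F] [NumberField F]

/-! ### Local absolute values -/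

section Local

variable (v : HeightOneSpectrum (𝓞 F))

/-! The value `ρ_m(f)(g)` is a finite sum of Tate integrals of `\hat f` along the line spanned by `g
e¹`, and everything comes from translating the variable `t` of these integrals.

Well-definedness. By strong approximation for `SL₂`, `f(·, g)` depends on `g` only through the class
of `det g` in a finite idele class group (`exists_eq_mul_rational`, `apply_eq_of_mem_clSubgroup`).
Hence finitely many Schwartz-Bruhat functions are involved and a common congruence subgroup serves
as a level (`exists_isLevel`). The integrand is bounded by a multiple of `‖t‖_f^{m+2}` and supported
in a lattice, so its integral is controlled by the sum of `N(I)^{-(m+2)}` over ideals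
(`integrableOn_finNorm_pow`). When the level shrinks, new characters `χ` appear; each of them is
non-trivial on some `z` in `K ∩ Z = det K`, and the substitution `t ↦ z t` multiplies the integral
by `χ(z)`, so the integral is zero (`rhoAt_eq_of_le`).

Target. Replace `g` by `g b` and `t` by `t₁⁻¹ t`, where `t₁, t₂` is the diagonal of `b`. The
integral acquires the factor `χ(t₂)‖t₂‖_f^{m+2}` and otherwise depends on `b` only through the class
of `det b`. Expanding this function on a finite group into characters `η` yields exactly the Hecke
characters `η(t₁t₂)χ(t₂)‖t₂‖^{m+2}` (`rho_mem_induced`), and all of `X_m` has this form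
(`heckeOf_etaHom_chiHom`, `chiHom_mem_classChars`).

Surjectivity. Linear independence of characters and the finiteness of `K_N \ G / B` split an element
of the induced module into finitely many components, one for each character
(`exists_decomposition`). For a single `φ`, Fourier inversion
(`IsSchwartzBruhat.finFourier_finFourier`) allows `\hat f` to be prescribed. It is a sum over `R` of
scaled copies of `s\bar ψ`. For `χ ≠ χ'` the integral vanishes, either because `χ` and `χ'` differ
on `Ô^×` or by orthogonality on `Cl_F^{(N)}`; for `χ = χ'` every representative contributes the same
integral (`rho_preimage`). By the Iwasawa decomposition that integral need only be found for `g` in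
`GL₂(Ô)`. There `t g e¹` meets the support of `s\bar ψ` exactly when `t` is integral and a unit at
the places dividing `N`, and the integral over this set is `d_F^{-1/2} L ψ(g)`
(`exists_eulerProduct`, `exists_integral_sectionIntegrand`). -/

theorem norm_le_norm_iff (x y : v.adicCompletion F) :
    ‖x‖ ≤ ‖y‖ ↔ Valued.v x ≤ Valued.v y := by
  rw [FinitePlace.norm_def, FinitePlace.norm_def, NNReal.coe_le_coe]
  exact (WithZeroMulInt.toNNReal_strictMono (NumberField.HeightOneSpectrum.one_lt_absNorm_nnreal v)).le_iff_le

theorem norm_le_one_iff (x : v.adicCompletion F) :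
    ‖x‖ ≤ 1 ↔ x ∈ v.adicCompletionIntegers F := by
  rw [mem_adicCompletionIntegers, ← norm_one (α := v.adicCompletion F), norm_le_norm_iff, map_one]

theorem norm_eq_one_iff (x : v.adicCompletion F) : ‖x‖ = 1 ↔ Valued.v x = 1 := by
  rw [← norm_one (α := v.adicCompletion F), ← map_one (Valued.v (R := v.adicCompletion F)),
    le_antisymm_iff, le_antisymm_iff, norm_le_norm_iff, norm_le_norm_iff]

theorem norm_add_le_max (x y : v.adicCompletion F) : ‖x + y‖ ≤ max ‖x‖ ‖y‖ := by
  rcases le_total ‖x‖ ‖y‖ with h | h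
  · rw [max_eq_right h, norm_le_norm_iff]
    exact (Valued.v.map_add x y).trans (max_le ((norm_le_norm_iff v x y).1 h) le_rfl)
  · rw [max_eq_left h, norm_le_norm_iff]
    exact (Valued.v.map_add x y).trans (max_le le_rfl ((norm_le_norm_iff v y x).1 h))

instance : IsUltrametricDist (v.adicCompletion F) :=
  IsUltrametricDist.isUltrametricDist_of_forall_norm_add_le_max_norm (norm_add_le_max v)

theorem norm_coe_integer_le (x : 𝓞 F) : ‖(algebraMap F (v.adicCompletion F)) x‖ ≤ 1 :=
  FinitePlace.norm_le_one F v x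

theorem norm_natCast_le_one (n : ℕ) : ‖(n : v.adicCompletion F)‖ ≤ 1 := by
  simpa using norm_coe_integer_le v (n : 𝓞 F)

theorem norm_natCast_eq_one_iff (n : ℕ) :
    ‖(n : v.adicCompletion F)‖ = 1 ↔ (n : 𝓞 F) ∉ v.asIdeal := by
  have := FinitePlace.norm_eq_one_iff_notMem F v (n : 𝓞 F)
  rw [← this, FinitePlace.embedding]
  simp

theorem norm_natCast_lt_one_iff (n : ℕ) :
    ‖(n : v.adicCompletion F)‖ < 1 ↔ (n : 𝓞 F) ∈ v.asIdeal := by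
  rw [← not_iff_not, ← norm_natCast_eq_one_iff, not_lt]
  exact ⟨fun h => le_antisymm (norm_natCast_le_one v n) h, fun h => h.ge⟩

instance : CharZero (v.adicCompletion F) :=
  charZero_of_injective_algebraMap (algebraMap F (v.adicCompletion F)).injective

theorem norm_natCast_pos {n : ℕ} (hn : n ≠ 0) : 0 < ‖(n : v.adicCompletion F)‖ :=
  norm_pos_iff.2 (Nat.cast_ne_zero.2 hn)

theorem norm_absNorm_lt_one : ‖(v.asIdeal.absNorm : v.adicCompletion F)‖ < 1 :=
  (norm_natCast_lt_one_iff v _).2 (Ideal.absNorm_mem _)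

theorem absNorm_pos : 0 < v.asIdeal.absNorm :=
  Nat.pos_of_ne_zero fun h => v.ne_bot (Ideal.absNorm_eq_zero_iff.1 h)

/-- Every local integer is approximated by a global one. -/
theorem exists_integer_norm_sub_le (x : v.adicCompletion F) (hx : ‖x‖ ≤ 1) (c : v.adicCompletion F)
    (hc : c ≠ 0) : ∃ a : 𝓞 F, ‖x - algebraMap F (v.adicCompletion F) a‖ ≤ ‖c‖ := by
  -- For `‖c‖ ≥ 1` the norm of the prime can take the place of `c`: it is non-zero and lies in the
  -- prime. Smallness of `c` forces the approximating field element to be integral.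
  wlog hc1 : ‖c‖ < 1
  · obtain ⟨a, ha⟩ := this v x hx (v.asIdeal.absNorm : v.adicCompletion F)
      (norm_pos_iff.1 (norm_natCast_pos v (absNorm_pos v).ne')) (norm_absNorm_lt_one v)
    exact ⟨a, ha.trans ((norm_absNorm_lt_one v).le.trans (not_lt.1 hc1))⟩
  obtain ⟨k, hk⟩ := (denseRange_algebraMap F v).exists_mem_open
    (Metric.isOpen_ball (x := x) (ε := ‖c‖)) ⟨x, Metric.mem_ball_self (norm_pos_iff.2 hc)⟩
  rw [Metric.mem_ball, dist_eq_norm] at hk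
  have hk1 : v.valuation F k ≤ 1 := by
    rw [← v.valuedAdicCompletion_eq_valuation' k, ← mem_adicCompletionIntegers, ← norm_le_one_iff]
    have : ((k : F) : v.adicCompletion F) = (algebraMap F (v.adicCompletion F) k - x) + x := by
      rw [sub_add_cancel]; rfl
    rw [this]
    exact (norm_add_le_max v _ _).trans (max_le (hk.le.trans hc1.le) hx)
  have hvc : Valued.v c ≠ 0 := (Valuation.ne_zero_iff _).2 hc
  obtain ⟨a, ha⟩ := exists_valuation_sub_lt_of_integer v hk1 (Units.mk0 _ hvc)
  refine ⟨a, ?_⟩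
  have h1 : x - algebraMap F (v.adicCompletion F) a =
      (x - algebraMap F (v.adicCompletion F) k) +
        algebraMap F (v.adicCompletion F) (k - algebraMap (𝓞 F) F a) := by
    rw [map_sub]; ring
  rw [h1]
  refine (norm_add_le_max v _ _).trans (max_le ((norm_sub_rev _ _).trans_le hk.le) ?_)
  rw [norm_le_norm_iff]
  have h2 := v.valuedAdicCompletion_eq_valuation' (k - algebraMap (𝓞 F) F a)
  rw [show algebraMap F (v.adicCompletion F) (k - algebraMap (𝓞 F) F a) =
    ((k - algebraMap (𝓞 F) F a : F) : v.adicCompletion F) from rfl, h2, Valuation.map_sub_swap]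
  simpa using ha.le

end Local

/-! ### Finite adeles -/

namespace Af

@[simp] theorem add_apply (x y : Af F) (v) : (x + y) v = x v + y v := rfl
@[simp] theorem mul_apply (x y : Af F) (v) : (x * y) v = x v * y v := rfl
@[simp] theorem sub_apply (x y : Af F) (v) : (x - y) v = x v - y v := rfl
@[simp] theorem neg_apply (x : Af F) (v) : (-x) v = -x v := rfl
@[simp] theorem zero_apply (v : HeightOneSpectrum (𝓞 F)) : (0 : Af F) v = 0 := rfl
@[simp] theorem one_apply (v : HeightOneSpectrum (𝓞 F)) : (1 : Af F) v = 1 := rfl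

/-- Evaluation at a finite place. -/
def eval (v : HeightOneSpectrum (𝓞 F)) : Af F →+* v.adicCompletion F where
  toFun x := x v
  map_one' := rfl
  map_mul' _ _ := rfl
  map_zero' := rfl
  map_add' _ _ := rfl

@[simp] theorem natCast_apply (n : ℕ) (v : HeightOneSpectrum (𝓞 F)) : (n : Af F) v = n :=
  map_natCast (eval v) n

@[simp] theorem pow_apply (x : Af F) (n : ℕ) (v) : (x ^ n) v = x v ^ n :=
  map_pow (eval v) x n

@[simp] theorem algebraMap_apply (a : F) (v : HeightOneSpectrum (𝓞 F)) :
    algebraMap F (Af F) a v = algebraMap F (v.adicCompletion F) a := rfl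

theorem continuous_apply (v : HeightOneSpectrum (𝓞 F)) : Continuous fun x : Af F => x v :=
  RestrictedProduct.continuous_eval (R := fun v : HeightOneSpectrum (𝓞 F) => v.adicCompletion F) v

theorem eventually_norm_le_one (x : Af F) : ∀ᶠ v in cofinite, ‖x v‖ ≤ 1 := by
  filter_upwards [x.2] with v hv
  exact (norm_le_one_iff v _).2 hv

/-- The finite adele with given components. -/
def mk (x : ∀ v : HeightOneSpectrum (𝓞 F), v.adicCompletion F)
    (hx : ∀ᶠ v in cofinite, ‖x v‖ ≤ 1) : Af F :=
  ⟨x, hx.mono fun v h => (norm_le_one_iff v _).1 h⟩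

@[simp] theorem mk_apply (x : ∀ v : HeightOneSpectrum (𝓞 F), v.adicCompletion F)
    (hx : ∀ᶠ v in cofinite, ‖x v‖ ≤ 1) (v) : mk x hx v = x v := rfl

theorem isUnit_iff_norm {x : Af F} :
    IsUnit x ↔ (∀ v, x v ≠ 0) ∧ ∀ᶠ v in cofinite, ‖x v‖ = 1 := by
  rw [FiniteAdeleRing.isUnit_iff]
  simp only [norm_eq_one_iff]

theorem unit_ne_zero (t : (Af F)ˣ) (v) : (t : Af F) v ≠ 0 := (isUnit_iff_norm.1 t.isUnit).1 v

theorem unit_norm_pos (t : (Af F)ˣ) (v) : 0 < ‖(t : Af F) v‖ := norm_pos_iff.2 (unit_ne_zero t v)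

theorem unit_eventually (t : (Af F)ˣ) : ∀ᶠ v in cofinite, ‖(t : Af F) v‖ = 1 :=
  (isUnit_iff_norm.1 t.isUnit).2

theorem inv_apply (t : (Af F)ˣ) (v) : ((t⁻¹ : (Af F)ˣ) : Af F) v = ((t : Af F) v)⁻¹ := by
  have h : (t : Af F) v * ((t⁻¹ : (Af F)ˣ) : Af F) v = 1 := by
    rw [← mul_apply, ← Units.val_mul, mul_inv_cancel]; rfl
  exact eq_inv_of_mul_eq_one_right h

/-- The finite idele with given components. -/
def mkUnit (x : ∀ v : HeightOneSpectrum (𝓞 F), v.adicCompletion F) (h0 : ∀ v, x v ≠ 0)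
    (hx : ∀ᶠ v in cofinite, ‖x v‖ = 1) : (Af F)ˣ where
  val := mk x (hx.mono fun _ h => h.le)
  inv := mk (fun v => (x v)⁻¹) (hx.mono fun v h => by rw [norm_inv, h, inv_one])
  val_inv := FiniteAdeleRing.ext F fun v => mul_inv_cancel₀ (h0 v)
  inv_val := FiniteAdeleRing.ext F fun v => inv_mul_cancel₀ (h0 v)

@[simp] theorem mkUnit_apply (x : ∀ v : HeightOneSpectrum (𝓞 F), v.adicCompletion F) (h0 hx v) :
    (mkUnit x h0 hx : Af F) v = x v := rfl

/-- A non-zero natural number as a finite idele. -/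
def natUnit (n : ℕ) (hn : n ≠ 0) : (Af F)ˣ :=
  Units.map (algebraMap F (Af F)).toMonoidHom (Units.mk0 (n : F) (Nat.cast_ne_zero.2 hn))

@[simp] theorem coe_natUnit (n : ℕ) (hn : n ≠ 0) : ((natUnit n hn : (Af F)ˣ) : Af F) = n := by
  simp [natUnit]

end Af

theorem mem_integralAdeles {x : Af F} : x ∈ integralAdeles F ↔ ∀ v, ‖x v‖ ≤ 1 :=
  forall_congr' fun v => (norm_le_one_iff v _).symm

theorem algebraMap_mem_integralAdeles (a : 𝓞 F) : algebraMap F (Af F) a ∈ integralAdeles F :=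
  mem_integralAdeles.2 fun v => norm_coe_integer_le v a

theorem mem_integralUnits {t : (Af F)ˣ} : t ∈ integralUnits F ↔ ∀ v, ‖(t : Af F) v‖ = 1 := by
  have h : t ∈ integralUnits F ↔ (t : Af F) ∈ integralAdeles F ∧
    ((t⁻¹ : (Af F)ˣ) : Af F) ∈ integralAdeles F := Iff.rfl
  rw [h, mem_integralAdeles, mem_integralAdeles, ← forall_and]
  refine forall_congr' fun v => ?_
  rw [Af.inv_apply, norm_inv, inv_le_one₀ (Af.unit_norm_pos t v)]
  exact ⟨fun h => le_antisymm h.1 h.2, fun h => ⟨h.le, h.ge⟩⟩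

theorem mem_integers_of_algebraMap_mem {a : F} (h : algebraMap F (Af F) a ∈ integralAdeles F) :
    ∃ b : 𝓞 F, (b : F) = a := by
  refine mem_integers_of_valuation_le_one F a fun v => ?_
  rw [← v.valuedAdicCompletion_eq_valuation' a]
  exact h v

/-! ### Approximation -/

/-- The absolute norm of a prime is a non-zero rational integer contained in it, so a product of
powers of such norms is as small as required. Working with rational integers lets all levels be
indexed by `ℕ`. -/
theorem exists_nat_norm_le (S : Finset (HeightOneSpectrum (𝓞 F)))
    (ε : HeightOneSpectrum (𝓞 F) → ℝ) (hε : ∀ v ∈ S, 0 < ε v) :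
    ∃ N : ℕ, N ≠ 0 ∧ ∀ v ∈ S, ‖(N : v.adicCompletion F)‖ ≤ ε v := by
  classical
  have h : ∀ v ∈ S, ∃ n : ℕ, ‖(v.asIdeal.absNorm : v.adicCompletion F)‖ ^ n ≤ ε v := fun v hv =>
    (exists_pow_lt_of_lt_one (hε v hv) (norm_absNorm_lt_one v)).imp fun n h => h.le
  choose! n hn using h
  refine ⟨∏ v ∈ S, v.asIdeal.absNorm ^ n v,
    Finset.prod_ne_zero_iff.2 fun v _ => pow_ne_zero _ (absNorm_pos v).ne', fun v hv => ?_⟩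
  rw [← Finset.mul_prod_erase S _ hv, Nat.cast_mul, norm_mul, Nat.cast_pow, norm_pow]
  exact (mul_le_of_le_one_right (by positivity) (norm_natCast_le_one v _)).trans (hn v hv)

theorem exists_nat_mul_mem (x : Af F) : ∃ N : ℕ, N ≠ 0 ∧ (N : Af F) * x ∈ integralAdeles F := by
  have hfin := x.eventually_norm_le_one
  rw [eventually_cofinite] at hfin
  obtain ⟨N, hN, h⟩ := exists_nat_norm_le hfin.toFinset (fun v => ‖x v‖⁻¹) fun v hv => by
    rw [Set.Finite.mem_toFinset, Set.mem_ofPred_eq, not_le] at hv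
    exact inv_pos.2 (one_pos.trans hv)
  refine ⟨N, hN, mem_integralAdeles.2 fun v => ?_⟩
  rw [Af.mul_apply, norm_mul, Af.natCast_apply]
  by_cases hv : ‖x v‖ ≤ 1
  · exact mul_le_one₀ (norm_natCast_le_one v N) (norm_nonneg _) hv
  · have h1 : 0 < ‖x v‖ := one_pos.trans (not_le.1 hv)
    have := mul_le_mul_of_nonneg_right (h v (by simpa using hv)) h1.le
    rwa [inv_mul_cancel₀ h1.ne'] at this

theorem exists_nat_norm_le_unit (t : (Af F)ˣ) :
    ∃ N : ℕ, N ≠ 0 ∧ ∀ v, ‖(N : v.adicCompletion F)‖ ≤ ‖(t : Af F) v‖ := by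
  obtain ⟨N, hN, h⟩ := exists_nat_mul_mem ((t⁻¹ : (Af F)ˣ) : Af F)
  refine ⟨N, hN, fun v => ?_⟩
  have := mem_integralAdeles.1 h v
  rwa [Af.mul_apply, norm_mul, Af.inv_apply, norm_inv, Af.natCast_apply, ← div_eq_mul_inv,
    div_le_one (Af.unit_norm_pos t v)] at this

/-- Chinese remainder theorem: only the finitely many primes containing `m` impose a condition,
since elsewhere `m` is a unit and integrality suffices. -/
theorem exists_integer_sub_le_of_mem {x : Af F} (hx : x ∈ integralAdeles F) (m : 𝓞 F)
    (hm : m ≠ 0) : ∃ a : 𝓞 F, ∀ v, ‖x v - algebraMap F (v.adicCompletion F) a‖ ≤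
      ‖algebraMap F (v.adicCompletion F) m‖ := by
  classical
  rw [mem_integralAdeles] at hx
  have hm0 : ∀ v : HeightOneSpectrum (𝓞 F), algebraMap F (v.adicCompletion F) m ≠ 0 := fun v =>
    (map_ne_zero _).2 (RingOfIntegers.coe_ne_zero_iff.2 hm)
  choose a ha using fun v : HeightOneSpectrum (𝓞 F) =>
    exists_integer_norm_sub_le v (x v) (hx v) _ (hm0 v)
  have hfin : {v : HeightOneSpectrum (𝓞 F) | m ∈ v.asIdeal}.Finite := by
    have := Ideal.finite_factors (I := Ideal.span {m}) (by simpa using hm)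
    simpa [Ideal.dvd_span_singleton] using this
  have hexp : ∀ v : HeightOneSpectrum (𝓞 F), ∃ e : ℕ, ∀ z ∈ v.asIdeal ^ e,
      ‖algebraMap F (v.adicCompletion F) z‖ ≤ ‖algebraMap F (v.adicCompletion F) m‖ := by
    intro v
    -- The exponent is the multiplicity of `v` in the ideal `(m)`.
    refine ⟨(Associates.mk v.asIdeal).count (Associates.mk (Ideal.span {m})).factors,
      fun z hz => ?_⟩
    rw [norm_le_norm_iff]
    change Valued.v ((z : F) : v.adicCompletion F) ≤ Valued.v ((m : F) : v.adicCompletion F)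
    rw [v.valuedAdicCompletion_eq_valuation' (z : F), v.valuedAdicCompletion_eq_valuation' (m : F),
      valuation_of_algebraMap, valuation_of_algebraMap]
    rw [v.intValuation_if_neg hm]
    exact (v.intValuation_le_pow_iff_mem z _).2 hz
  choose e he using hexp
  obtain ⟨y, hy⟩ := IsDedekindDomain.exists_forall_sub_mem_ideal (s := hfin.toFinset)
    (fun v => v.asIdeal) e (fun v _ => v.prime)
    (fun v _ w _ hvw h => hvw (HeightOneSpectrum.ext h)) (fun v => a v)
  refine ⟨y, fun v => ?_⟩
  by_cases hv : m ∈ v.asIdeal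
  · have h1 := he v _ (hy v (by simpa using hv))
    have h2 : x v - algebraMap F (v.adicCompletion F) y =
        (x v - algebraMap F (v.adicCompletion F) (a v)) -
          algebraMap F (v.adicCompletion F) ((y - a v : 𝓞 F) : F) := by
      push_cast [map_sub]; ring
    rw [h2, sub_eq_add_neg]
    refine (norm_add_le_max v _ _).trans (max_le (ha v) ?_)
    rwa [norm_neg]
  · have h1 : ‖algebraMap F (v.adicCompletion F) m‖ = 1 :=
      (FinitePlace.norm_eq_one_iff_notMem F v m).2 hv
    rw [h1, sub_eq_add_neg]
    refine (norm_add_le_max v _ _).trans (max_le (hx v) ?_)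
    rw [norm_neg]
    exact norm_coe_integer_le v y

/-- Strong approximation for the additive group: `𝔸_{F,f} = F + t Ô`. -/
theorem exists_field_sub_le (x : Af F) (t : (Af F)ˣ) :
    ∃ a : F, ∀ v, ‖x v - algebraMap F (v.adicCompletion F) a‖ ≤ ‖(t : Af F) v‖ := by
  obtain ⟨d, hd, hdx⟩ := exists_nat_mul_mem x
  obtain ⟨n, hn, hnt⟩ := exists_nat_norm_le_unit t
  -- Here `d` clears the denominators of `x`. Approximating `d x` modulo `d n` makes `a / d` an
  -- approximation of `x` modulo `n`, and `n` is at most `t` in norm everywhere.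
  obtain ⟨a, ha⟩ := exists_integer_sub_le_of_mem hdx ((d * n : ℕ) : 𝓞 F) (by positivity)
  refine ⟨a / d, fun v => ?_⟩
  have h := ha v
  have hd' : (d : v.adicCompletion F) ≠ 0 := Nat.cast_ne_zero.2 hd
  have h1 : x v - algebraMap F (v.adicCompletion F) (a / d) =
      (d : v.adicCompletion F)⁻¹ * (((d : Af F) * x) v - algebraMap F (v.adicCompletion F) a) := by
    rw [map_div₀, map_natCast, Af.mul_apply, Af.natCast_apply, mul_sub, inv_mul_cancel_left₀ hd',
      div_eq_inv_mul]
  rw [h1, norm_mul, norm_inv]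
  refine (mul_le_mul_of_nonneg_left h (by positivity)).trans ?_
  have h2 : ‖algebraMap F (v.adicCompletion F) (((d * n : ℕ) : 𝓞 F) : F)‖ =
      ‖(d : v.adicCompletion F)‖ * ‖(n : v.adicCompletion F)‖ := by
    simp
  rw [h2, inv_mul_cancel_left₀ (norm_pos_iff.2 hd').ne']
  exact hnt v

end

/-! ### Compact open subgroups of the finite adeles, the finite ideles and `GL₂`. -/

section

variable {F : Type*} [Field F] [NumberField F]

/-! ### The norm of finite ideles -/

theorem finite_mulSupport_norm (t : (Af F)ˣ) :
    (Function.mulSupport fun v : HeightOneSpectrum (𝓞 F) => ‖(t : Af F) v‖).Finite :=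
  Af.unit_eventually t

theorem finNorm_mul (s t : (Af F)ˣ) : finNorm F (s * t) = finNorm F s * finNorm F t := by
  rw [finNorm, finNorm, finNorm, ← finprod_mul_distrib (finite_mulSupport_norm s)
    (finite_mulSupport_norm t)]
  exact finprod_congr fun v => by rw [Units.val_mul, Af.mul_apply, norm_mul]

@[simp] theorem finNorm_one : finNorm F 1 = 1 := by
  refine (finprod_congr fun v => ?_).trans finprod_one
  rw [Units.val_one, Af.one_apply, norm_one]

theorem finNorm_pos (t : (Af F)ˣ) : 0 < finNorm F t :=
  finprod_induction (fun x : ℝ => 0 < x) one_pos (fun _ _ => mul_pos) (Af.unit_norm_pos t)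

theorem finNorm_inv (t : (Af F)ˣ) : finNorm F t⁻¹ = (finNorm F t)⁻¹ := by
  refine eq_inv_of_mul_eq_one_left ?_
  rw [← finNorm_mul, inv_mul_cancel, finNorm_one]

theorem finNorm_eq_one {t : (Af F)ˣ} (ht : t ∈ integralUnits F) : finNorm F t = 1 := by
  have h := mem_integralUnits.1 ht
  simp only [finNorm, h, finprod_one]

theorem isLocallyConstant_finNorm : IsLocallyConstant (finNorm F) := by
  rw [IsLocallyConstant.iff_exists_open]
  intro t
  refine ⟨(fun s => s * t⁻¹) ⁻¹' (integralUnits F : Set (Af F)ˣ),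
    (isOpen_integralUnits F).preimage (continuous_mul_const t⁻¹), ?_, fun s hs => ?_⟩
  · rw [Set.mem_preimage, mul_inv_cancel]; exact one_mem _
  · have := finNorm_eq_one hs
    rwa [finNorm_mul, finNorm_inv, mul_inv_eq_one₀ (finNorm_pos t).ne'] at this

theorem continuous_finNorm : Continuous (finNorm F) := isLocallyConstant_finNorm.continuous

/-! ### Lattices in the finite adeles -/

/-- The lattice `t Ô` in `𝔸_{F,f}`. -/
def lattice (t : (Af F)ˣ) : AddSubgroup (Af F) where
  carrier := {x | ∀ v, ‖x v‖ ≤ ‖(t : Af F) v‖}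
  add_mem' hx hy v := (norm_add_le_max v _ _).trans (max_le (hx v) (hy v))
  zero_mem' v := by simp
  neg_mem' hx v := by simpa using hx v

theorem mem_lattice {t : (Af F)ˣ} {x : Af F} :
    x ∈ lattice t ↔ ∀ v, ‖x v‖ ≤ ‖(t : Af F) v‖ := Iff.rfl

theorem inv_mul_mem_iff {t : (Af F)ˣ} {x : Af F} :
    ((t⁻¹ : (Af F)ˣ) : Af F) * x ∈ integralAdeles F ↔ x ∈ lattice t := by
  rw [mem_integralAdeles, mem_lattice]
  refine forall_congr' fun v => ?_
  rw [Af.mul_apply, norm_mul, Af.inv_apply, norm_inv, inv_mul_le_one₀ (Af.unit_norm_pos t v)]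

theorem mul_mem_lattice {t : (Af F)ˣ} {x y : Af F} (hx : x ∈ integralAdeles F)
    (hy : y ∈ lattice t) : x * y ∈ lattice t := fun v => by
  rw [Af.mul_apply, norm_mul]
  exact (mul_le_of_le_one_left (norm_nonneg _) (mem_integralAdeles.1 hx v)).trans (hy v)

theorem lattice_one : ((lattice 1 : AddSubgroup (Af F)) : Set (Af F)) = integralAdeles F := by
  ext x
  rw [SetLike.mem_coe, mem_lattice, SetLike.mem_coe, mem_integralAdeles]
  simp

theorem isOpen_lattice (t : (Af F)ˣ) : IsOpen (lattice t : Set (Af F)) := by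
  have : (lattice t : Set (Af F)) = (fun x => ((t⁻¹ : (Af F)ˣ) : Af F) * x) ⁻¹'
      (integralAdeles F) := by
    ext x; exact inv_mul_mem_iff.symm
  rw [this]
  exact (isOpen_integralAdeles F).preimage (by fun_prop)

theorem isCompact_lattice (t : (Af F)ˣ) : IsCompact (lattice t : Set (Af F)) := by
  have : (lattice t : Set (Af F)) = (fun x => (t : Af F) * x) '' (integralAdeles F) := by
    ext x
    rw [SetLike.mem_coe, ← inv_mul_mem_iff]
    refine ⟨fun h => ⟨_, h, by simp⟩, ?_⟩
    rintro ⟨y, hy, rfl⟩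
    simpa using hy
  rw [this]
  exact (isCompact_integralAdeles F).image (by fun_prop)

/-- Lattices `N Ô` with `N` a positive integer. -/
abbrev natLattice (N : ℕ) (hN : N ≠ 0) : AddSubgroup (Af F) := lattice (Af.natUnit N hN)

theorem mem_natLattice {N : ℕ} {hN : N ≠ 0} {x : Af F} :
    x ∈ natLattice N hN ↔ ∀ v, ‖x v‖ ≤ ‖(N : v.adicCompletion F)‖ := by
  rw [mem_lattice]; simp

theorem mem_natLattice_iff_exists {N : ℕ} {hN : N ≠ 0} {x : Af F} :
    x ∈ natLattice N hN ↔ ∃ y ∈ integralAdeles F, x = N * y := by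
  rw [← inv_mul_mem_iff]
  refine ⟨fun h => ⟨_, h, ?_⟩, ?_⟩
  · rw [← Af.coe_natUnit N hN, Units.mul_inv_cancel_left]
  · rintro ⟨y, hy, rfl⟩
    rwa [← Af.coe_natUnit N hN, Units.inv_mul_cancel_left]

theorem norm_natCast_le_of_dvd (v : HeightOneSpectrum (𝓞 F)) {M N : ℕ} (h : M ∣ N) :
    ‖(N : v.adicCompletion F)‖ ≤ ‖(M : v.adicCompletion F)‖ := by
  obtain ⟨k, rfl⟩ := h
  rw [Nat.cast_mul, norm_mul]
  exact mul_le_of_le_one_right (norm_nonneg _) (norm_natCast_le_one v k)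

theorem natLattice_le_of_dvd {M N : ℕ} (hM : M ≠ 0) (hN : N ≠ 0) (h : M ∣ N) :
    (natLattice N hN : AddSubgroup (Af F)) ≤ natLattice M hM := fun x hx => by
  rw [mem_natLattice] at hx ⊢
  exact fun v => (hx v).trans (norm_natCast_le_of_dvd v h)

theorem natLattice_le_integralAdeles {N : ℕ} (hN : N ≠ 0) {x : Af F} (hx : x ∈ natLattice N hN) :
    x ∈ integralAdeles F :=
  mem_integralAdeles.2 fun v => (mem_natLattice.1 hx v).trans (norm_natCast_le_one v N)

theorem eq_zero_of_norm_le_natCast {v : HeightOneSpectrum (𝓞 F)} {x : v.adicCompletion F}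
    (h : ∀ N : ℕ, N ≠ 0 → ‖x‖ ≤ ‖(N : v.adicCompletion F)‖) : x = 0 := by
  by_contra hx
  obtain ⟨n, hn⟩ := exists_pow_lt_of_lt_one (norm_pos_iff.2 hx) (norm_absNorm_lt_one v)
  have := h (v.asIdeal.absNorm ^ n) (pow_ne_zero _ (absNorm_pos v).ne')
  rw [Nat.cast_pow, norm_pow] at this
  exact absurd hn (not_lt.2 this)

/-- A decreasing family of compact open subgroups indexed by the positive integers with trivial
intersection is a neighbourhood basis. -/
theorem exists_subset_of_iInter_subset {X : Type*} [TopologicalSpace X] [T2Space X] (V : ℕ → Set X)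
    (hV : ∀ N, N ≠ 0 → IsCompact (V N)) (hmono : ∀ M N, M ≠ 0 → N ≠ 0 → M ∣ N → V N ⊆ V M)
    {U : Set X} (hU : IsOpen U) (h : ∀ x, (∀ N, N ≠ 0 → x ∈ V N) → x ∈ U) :
    ∃ N, N ≠ 0 ∧ V N ⊆ U := by
  obtain ⟨N, hN⟩ := exists_subset_nhds_of_isCompact (V := fun N : ℕ+ => V N)
    (fun M N => ⟨M * N, hmono _ _ M.ne_zero (M * N).ne_zero (by simp),
      hmono _ _ N.ne_zero (M * N).ne_zero (by simp)⟩) (fun N => hV N N.ne_zero)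
    (U := U) fun x hx => hU.mem_nhds (h x fun N hN =>
      Set.mem_iInter.1 hx ⟨N, Nat.pos_of_ne_zero hN⟩)
  exact ⟨N, N.ne_zero, hN⟩

theorem exists_natLattice_subset {U : Set (Af F)} (hU : IsOpen U) (h0 : (0 : Af F) ∈ U) :
    ∃ (N : ℕ) (hN : N ≠ 0), ((natLattice N hN : AddSubgroup (Af F)) : Set (Af F)) ⊆ U := by
  obtain ⟨N, hN, h⟩ := exists_subset_of_iInter_subset
    (fun N => {x : Af F | ∀ v, ‖x v‖ ≤ ‖(N : v.adicCompletion F)‖})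
    (fun N hN => by
      convert isCompact_lattice (Af.natUnit (F := F) N hN) using 1
      ext x; exact mem_natLattice.symm)
    (fun M N _ _ h x hx v => (hx v).trans (norm_natCast_le_of_dvd v h)) hU (fun x hx => by
      convert h0
      exact FiniteAdeleRing.ext F fun v => eq_zero_of_norm_le_natCast fun N hN => hx N hN v)
  exact ⟨N, hN, fun x hx => h (mem_natLattice.1 hx)⟩

/-- Compact sets of finite adeles have a common denominator. -/
theorem exists_nat_mul_mem_of_isCompact {C : Set (Af F)} (hC : IsCompact C) :
    ∃ N : ℕ, N ≠ 0 ∧ ∀ x ∈ C, (N : Af F) * x ∈ integralAdeles F := by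
  obtain ⟨N, hN⟩ := hC.elim_directed_cover
    (fun N : ℕ+ => (fun x : Af F => (N : Af F) * x) ⁻¹' (integralAdeles F))
    (fun N => (isOpen_integralAdeles F).preimage (by fun_prop))
    (fun x _ => by
      obtain ⟨N, hN, h⟩ := exists_nat_mul_mem x
      exact Set.mem_iUnion.2 ⟨⟨N, Nat.pos_of_ne_zero hN⟩, h⟩)
    (fun M N => ⟨M * N, fun x hx => by
        change (((M * N : ℕ+) : ℕ) : Af F) * x ∈ integralAdeles F
        rw [PNat.mul_coe, Nat.cast_mul, mul_comm (M : Af F), mul_assoc]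
        exact mul_mem (natCast_mem _ _) hx, fun x hx => by
        change (((M * N : ℕ+) : ℕ) : Af F) * x ∈ integralAdeles F
        rw [PNat.mul_coe, Nat.cast_mul, mul_assoc]
        exact mul_mem (natCast_mem _ _) hx⟩)
  exact ⟨N, N.ne_zero, fun x hx => hN hx⟩

/-! ### Congruence subgroups of the finite ideles -/

theorem mem_span_natCast_iff {N : ℕ} (hN : N ≠ 0) {x : integralAdeles F} :
    x ∈ Ideal.span {(N : integralAdeles F)} ↔ (x : Af F) ∈ natLattice N hN := by
  rw [Ideal.mem_span_singleton', mem_natLattice_iff_exists]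
  constructor
  · rintro ⟨a, rfl⟩
    exact ⟨a, a.2, by push_cast; ring⟩
  · rintro ⟨y, hy, h⟩
    exact ⟨⟨y, hy⟩, Subtype.ext (by push_cast; rw [h]; ring)⟩

/-- Replaces the quotient ring in the definition by congruences between adeles, which are checked
place by place. `mem_levelGroup` does the same for matrices. -/
theorem mem_unitLevel {N : ℕ} (hN : N ≠ 0) {t : (Af F)ˣ} :
    t ∈ unitLevel F N ↔ t ∈ integralUnits F ∧ (t : Af F) - 1 ∈ natLattice N hN := by
  constructor
  · rintro ⟨s, hs, rfl⟩
    refine ⟨⟨(s : integralAdeles F).2, ((s⁻¹ : (integralAdeles F)ˣ) : integralAdeles F).2⟩, ?_⟩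
    have h : Ideal.Quotient.mk (Ideal.span {(N : integralAdeles F)}) (s : integralAdeles F) = 1 :=
      congrArg Units.val (MonoidHom.mem_ker.1 hs)
    rw [← map_one (Ideal.Quotient.mk _), Ideal.Quotient.eq, mem_span_natCast_iff hN] at h
    simpa using h
  · rintro ⟨ht, h⟩
    refine ⟨⟨⟨t, ht.1⟩, ⟨((t⁻¹ : (Af F)ˣ) : Af F), ht.2⟩, Subtype.ext (by simp),
      Subtype.ext (by simp)⟩, ?_, Units.ext rfl⟩
    refine MonoidHom.mem_ker.2 (Units.ext ?_)
    change Ideal.Quotient.mk (Ideal.span {(N : integralAdeles F)}) ⟨t, ht.1⟩ = 1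
    rw [← map_one (Ideal.Quotient.mk _), Ideal.Quotient.eq, mem_span_natCast_iff hN]
    simpa using h

theorem unitLevel_le_integralUnits {N : ℕ} (hN : N ≠ 0) : unitLevel F N ≤ integralUnits F :=
  fun _ h => ((mem_unitLevel hN).1 h).1

theorem isOpen_unitLevel {N : ℕ} (hN : N ≠ 0) : IsOpen (unitLevel F N : Set (Af F)ˣ) := by
  have : (unitLevel F N : Set (Af F)ˣ) = (integralUnits F : Set (Af F)ˣ) ∩
      (fun t : (Af F)ˣ => (t : Af F) - 1) ⁻¹' (natLattice N hN : AddSubgroup (Af F)) := by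
    ext t; exact mem_unitLevel hN
  rw [this]
  exact (isOpen_integralUnits F).inter ((isOpen_lattice _).preimage (by fun_prop))

theorem isCompact_unitLevel {N : ℕ} (hN : N ≠ 0) : IsCompact (unitLevel F N : Set (Af F)ˣ) :=
  (isCompact_integralUnits F).of_isClosed_subset
    ((unitLevel F N).isClosed_of_isOpen (isOpen_unitLevel hN)) (unitLevel_le_integralUnits hN)

theorem unitLevel_mono {M N : ℕ} (hM : M ≠ 0) (hN : N ≠ 0) (h : M ∣ N) :
    unitLevel F N ≤ unitLevel F M := fun t ht => by
  rw [mem_unitLevel hN] at ht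
  exact (mem_unitLevel hM).2 ⟨ht.1, natLattice_le_of_dvd hM hN h ht.2⟩

instance : T2Space (Af F)ˣ := by
  refine T2Space.of_injective_continuous (f := fun t : (Af F)ˣ => (t : Af F)) Units.val_injective
    Units.continuous_val

theorem exists_unitLevel_subset {U : Set (Af F)ˣ} (hU : IsOpen U) (h1 : (1 : (Af F)ˣ) ∈ U) :
    ∃ N, N ≠ 0 ∧ (unitLevel F N : Set (Af F)ˣ) ⊆ U := by
  refine exists_subset_of_iInter_subset (fun N => (unitLevel F N : Set (Af F)ˣ))
    (fun N hN => isCompact_unitLevel hN) (fun M N hM hN h => unitLevel_mono hM hN h) hU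
    fun t ht => ?_
  convert h1
  refine Units.ext (FiniteAdeleRing.ext F fun v => sub_eq_zero.1 ?_)
  exact eq_zero_of_norm_le_natCast fun N hN => mem_natLattice.1 ((mem_unitLevel hN).1 (ht N hN)).2 v

/-! ### Congruence subgroups of `GL₂` -/

theorem mem_levelOne {k : GL (Fin 2) (Af F)} : k ∈ levelOne F ↔
    (∀ i j, (k : Matrix (Fin 2) (Fin 2) (Af F)) i j ∈ integralAdeles F) ∧
    ∀ i j, ((k⁻¹ : GL (Fin 2) (Af F)) : Matrix (Fin 2) (Fin 2) (Af F)) i j ∈ integralAdeles F :=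
  Iff.rfl

theorem det_mem_integralUnits {k : GL (Fin 2) (Af F)} (hk : k ∈ levelOne F) :
    Matrix.GeneralLinearGroup.det k ∈ integralUnits F := by
  have h : ∀ k ∈ levelOne F, (Matrix.GeneralLinearGroup.det k : Af F) ∈ integralAdeles F := by
    intro k hk
    rw [Matrix.GeneralLinearGroup.val_det_apply, Matrix.det_fin_two]
    exact sub_mem (mul_mem (hk.1 _ _) (hk.1 _ _)) (mul_mem (hk.1 _ _) (hk.1 _ _))
  refine ⟨h k hk, ?_⟩
  have := h _ (inv_mem hk)
  rwa [map_inv] at this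

/-- The inverse matrix is the adjugate divided by the determinant. -/
theorem mem_levelOne_of_det {k : GL (Fin 2) (Af F)}
    (h : ∀ i j, (k : Matrix (Fin 2) (Fin 2) (Af F)) i j ∈ integralAdeles F)
    (hd : Matrix.GeneralLinearGroup.det k ∈ integralUnits F) : k ∈ levelOne F := by
  refine ⟨h, fun i j => ?_⟩
  have h2 : ((k⁻¹ : GL (Fin 2) (Af F)) : Matrix (Fin 2) (Fin 2) (Af F)) =
      (((Matrix.GeneralLinearGroup.det k)⁻¹ : (Af F)ˣ) : Af F) •
        (k : Matrix (Fin 2) (Fin 2) (Af F)).adjugate := by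
    rw [Matrix.coe_units_inv, Matrix.inv_def]
    congr 1
    exact Ring.inverse_unit (Matrix.GeneralLinearGroup.det k)
  change ((k⁻¹ : GL (Fin 2) (Af F)) : Matrix (Fin 2) (Fin 2) (Af F)) i j ∈ _
  rw [h2, Matrix.smul_apply, smul_eq_mul]
  refine (integralAdeles F).mul_mem hd.2 ?_
  rw [Matrix.adjugate_fin_two]
  fin_cases i <;> fin_cases j
  · exact h 1 1
  · exact (integralAdeles F).neg_mem (h 0 1)
  · exact (integralAdeles F).neg_mem (h 1 0)
  · exact h 0 0

theorem mem_levelGroup {N : ℕ} (hN : N ≠ 0) {k : GL (Fin 2) (Af F)} :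
    k ∈ levelGroup F N ↔ k ∈ levelOne F ∧
      ∀ i j, (k : Matrix (Fin 2) (Fin 2) (Af F)) i j - (1 : Matrix (Fin 2) (Fin 2) (Af F)) i j ∈
        natLattice N hN := by
  have hone : ∀ i j : Fin 2, (1 : Matrix (Fin 2) (Fin 2) (Af F)) i j =
      ((1 : Matrix (Fin 2) (Fin 2) (integralAdeles F)) i j : integralAdeles F) := by
    intro i j; rw [Matrix.one_apply, Matrix.one_apply]; split_ifs <;> rfl
  have hq : ∀ i j : Fin 2, (1 : Matrix (Fin 2) (Fin 2) (integralAdeles F ⧸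
      Ideal.span {(N : integralAdeles F)})) i j = Ideal.Quotient.mk _
        ((1 : Matrix (Fin 2) (Fin 2) (integralAdeles F)) i j) := by
    intro i j; rw [Matrix.one_apply, Matrix.one_apply]; split_ifs <;> simp
  constructor
  · rintro ⟨s, hs, rfl⟩
    refine ⟨⟨fun i j => ((s : Matrix (Fin 2) (Fin 2) (integralAdeles F)) i j).2, fun i j => 
      (((s⁻¹ : GL (Fin 2) (integralAdeles F)) : Matrix (Fin 2) (Fin 2) (integralAdeles F)) i j).2⟩,
      fun i j => ?_⟩
    have h := congrArg (fun u : GL (Fin 2) (integralAdeles F ⧸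
      Ideal.span {(N : integralAdeles F)}) => Units.val u i j)
      (MonoidHom.mem_ker.1 hs)
    change Ideal.Quotient.mk _ ((s : Matrix (Fin 2) (Fin 2) (integralAdeles F)) i j) =
      (1 : Matrix (Fin 2) (Fin 2) (integralAdeles F ⧸ _)) i j at h
    rw [hq, Ideal.Quotient.eq, mem_span_natCast_iff hN] at h
    rw [hone]
    exact h
  · rintro ⟨hk, h⟩
    let s : GL (Fin 2) (integralAdeles F) :=
      ⟨Matrix.of fun i j => ⟨_, hk.1 i j⟩, Matrix.of fun i j => ⟨_, hk.2 i j⟩, by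
        refine Matrix.ext fun i j => Subtype.ext ?_
        have := congrArg (fun u : Matrix (Fin 2) (Fin 2) (Af F) => u i j) k.val_inv
        rw [Matrix.mul_apply, Fin.sum_univ_two, hone] at this
        rw [Matrix.mul_apply, Fin.sum_univ_two]
        exact this, by
        refine Matrix.ext fun i j => Subtype.ext ?_
        have := congrArg (fun u : Matrix (Fin 2) (Fin 2) (Af F) => u i j) k.inv_val
        rw [Matrix.mul_apply, Fin.sum_univ_two, hone] at this
        rw [Matrix.mul_apply, Fin.sum_univ_two]
        exact this⟩
    refine ⟨s, MonoidHom.mem_ker.2 (Units.ext (Matrix.ext fun i j => ?_)), Units.ext rfl⟩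
    change Ideal.Quotient.mk _ ((s : Matrix (Fin 2) (Fin 2) (integralAdeles F)) i j) =
      (1 : Matrix (Fin 2) (Fin 2) (integralAdeles F ⧸ _)) i j
    rw [hq, Ideal.Quotient.eq, mem_span_natCast_iff hN]
    have := h i j
    rw [hone] at this
    exact this

theorem levelGroup_le_levelOne {N : ℕ} (hN : N ≠ 0) : levelGroup F N ≤ levelOne F :=
  fun _ h => ((mem_levelGroup hN).1 h).1

theorem isOpen_levelGroup {N : ℕ} (hN : N ≠ 0) :
    IsOpen (levelGroup F N : Set (GL (Fin 2) (Af F))) := by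
  have : (levelGroup F N : Set (GL (Fin 2) (Af F))) = (levelOne F : Set (GL (Fin 2) (Af F))) ∩
      ⋂ i, ⋂ j, (fun k : GL (Fin 2) (Af F) => (k : Matrix (Fin 2) (Fin 2) (Af F)) i j -
        (1 : Matrix (Fin 2) (Fin 2) (Af F)) i j) ⁻¹' (natLattice N hN : AddSubgroup (Af F)) := by
    ext t
    rw [SetLike.mem_coe, mem_levelGroup hN]
    simp
  rw [this]
  refine (isOpen_levelOne F).inter (isOpen_iInter_of_finite fun i => isOpen_iInter_of_finite
    fun j => (isOpen_lattice _).preimage ?_)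
  exact ((continuous_id.matrix_elem i j).comp Units.continuous_val).sub continuous_const

theorem isCompact_levelGroup {N : ℕ} (hN : N ≠ 0) :
    IsCompact (levelGroup F N : Set (GL (Fin 2) (Af F))) :=
  (isCompact_levelOne F).of_isClosed_subset
    ((levelGroup F N).isClosed_of_isOpen (isOpen_levelGroup hN)) (levelGroup_le_levelOne hN)

theorem levelGroup_mono {M N : ℕ} (hM : M ≠ 0) (hN : N ≠ 0) (h : M ∣ N) :
    levelGroup F N ≤ levelGroup F M := fun t ht => by
  rw [mem_levelGroup hN] at ht
  exact (mem_levelGroup hM).2 ⟨ht.1, fun i j => natLattice_le_of_dvd hM hN h (ht.2 i j)⟩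

instance : T2Space (GL (Fin 2) (Af F)) := by
  refine T2Space.of_injective_continuous
    (f := fun t : GL (Fin 2) (Af F) => (t : Matrix (Fin 2) (Fin 2) (Af F))) Units.val_injective
    Units.continuous_val

theorem exists_levelGroup_subset {U : Set (GL (Fin 2) (Af F))} (hU : IsOpen U)
    (h1 : (1 : GL (Fin 2) (Af F)) ∈ U) :
    ∃ N, N ≠ 0 ∧ (levelGroup F N : Set (GL (Fin 2) (Af F))) ⊆ U := by
  refine exists_subset_of_iInter_subset (fun N => (levelGroup F N : Set (GL (Fin 2) (Af F))))
    (fun N hN => isCompact_levelGroup hN) (fun M N hM hN h => levelGroup_mono hM hN h) hU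
    fun t ht => ?_
  convert h1
  refine Units.ext (Matrix.ext fun i j => FiniteAdeleRing.ext F fun v => sub_eq_zero.1 ?_)
  exact eq_zero_of_norm_le_natCast fun N hN =>
    mem_natLattice.1 (((mem_levelGroup hN).1 (ht N hN)).2 i j) v

/-- `K_N` is normal in `GL₂(Ô)`. -/
theorem conj_mem_levelGroup {N : ℕ} (hN : N ≠ 0) {k x : GL (Fin 2) (Af F)}
    (hk : k ∈ levelGroup F N) (hx : x ∈ levelOne F) : x * k * x⁻¹ ∈ levelGroup F N := by
  rw [mem_levelGroup hN] at hk ⊢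
  refine ⟨mul_mem (mul_mem hx hk.1) (inv_mem hx), fun i j => ?_⟩
  have h : ((x * k * x⁻¹ : GL (Fin 2) (Af F)) : Matrix (Fin 2) (Fin 2) (Af F)) - 1 =
      (x : Matrix (Fin 2) (Fin 2) (Af F)) * ((k : Matrix (Fin 2) (Fin 2) (Af F)) - 1) *
        ((x⁻¹ : GL (Fin 2) (Af F)) : Matrix (Fin 2) (Fin 2) (Af F)) := by
    rw [mul_sub, sub_mul, mul_one, Units.val_mul, Units.val_mul, Units.mul_inv]
  rw [← Matrix.sub_apply, h, Matrix.mul_apply]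
  refine sum_mem fun l _ => ?_
  rw [mul_comm]
  refine mul_mem_lattice (hx.2 _ _) ?_
  rw [Matrix.mul_apply]
  exact sum_mem fun l' _ => mul_mem_lattice (hx.1 _ _) (hk.2 _ _)

theorem scalar_mem_levelGroup_iff {N : ℕ} (hN : N ≠ 0) {t : (Af F)ˣ} :
    Matrix.GeneralLinearGroup.scalar (Fin 2) t ∈ levelGroup F N ↔ t ∈ unitLevel F N := by
  rw [mem_levelGroup hN, mem_unitLevel hN, mem_levelOne, ← map_inv]
  have hz : (0 : Af F) ∈ integralAdeles F := zero_mem _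
  have hz' : (0 : Af F) ∈ natLattice N hN := zero_mem _
  have hu : t ∈ integralUnits F ↔ (t : Af F) ∈ integralAdeles F ∧
    ((t⁻¹ : (Af F)ˣ) : Af F) ∈ integralAdeles F := Iff.rfl
  have hc : ∀ s : (Af F)ˣ, ((Matrix.GeneralLinearGroup.scalar (Fin 2) s : GL (Fin 2) (Af F)) :
    Matrix (Fin 2) (Fin 2) (Af F)) = !![(s : Af F), 0; 0, (s : Af F)] := fun s => by
    ext i j : 2; fin_cases i <;> fin_cases j <;> rfl
  rw [hc, hc]
  simp only [Fin.forall_fin_two, hz, hz', hu, Matrix.of_apply, Matrix.cons_val', Matrix.cons_val_zero,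
    Matrix.cons_val_one, Matrix.cons_val_fin_one, Matrix.one_apply_eq, Matrix.one_apply_ne, ne_eq,
    zero_ne_one, one_ne_zero, not_false_eq_true, sub_zero]
  tauto

theorem det_mem_unitLevel {N : ℕ} (hN : N ≠ 0) {k : GL (Fin 2) (Af F)} (hk : k ∈ levelGroup F N) :
    Matrix.GeneralLinearGroup.det k ∈ unitLevel F N := by
  have h := (mem_levelGroup hN).1 hk
  refine (mem_unitLevel hN).2 ⟨det_mem_integralUnits h.1, ?_⟩
  rw [Matrix.GeneralLinearGroup.val_det_apply, Matrix.det_fin_two]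
  set A := (k : Matrix (Fin 2) (Fin 2) (Af F))
  have h00 := h.2 0 0
  have h11 := h.2 1 1
  have h01 := h.2 0 1
  simp only [Matrix.one_apply_eq, Matrix.one_apply_ne zero_ne_one, sub_zero] at h00 h11 h01
  have e : A 0 0 * A 1 1 - A 0 1 * A 1 0 - 1 =
      A 1 1 * (A 0 0 - 1) + (A 1 1 - 1) - A 1 0 * A 0 1 := by ring
  rw [e]
  exact sub_mem (add_mem (mul_mem_lattice (h.1.1 _ _) h00) h11) (mul_mem_lattice (h.1.1 _ _) h01)

/-- The diagonal matrix `diag(a, b)` in `GL₂`. -/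
def diag (a b : (Af F)ˣ) : GL (Fin 2) (Af F) :=
  Matrix.GeneralLinearGroup.mk'' !![(a : Af F), 0; 0, (b : Af F)]
    (by rw [Matrix.det_fin_two_of, mul_zero, sub_zero]; exact a.isUnit.mul b.isUnit)

theorem coe_diag (a b : (Af F)ˣ) :
    (diag a b : Matrix (Fin 2) (Fin 2) (Af F)) = !![(a : Af F), 0; 0, (b : Af F)] := rfl

theorem det_diag (a b : (Af F)ˣ) : Matrix.GeneralLinearGroup.det (diag a b) = a * b :=
  Units.ext (by simp [Matrix.GeneralLinearGroup.val_det_apply, coe_diag, Matrix.det_fin_two_of])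

theorem diag_mem_levelGroup {N : ℕ} (hN : N ≠ 0) {t : (Af F)ˣ} (ht : t ∈ unitLevel F N) :
    diag t 1 ∈ levelGroup F N := by
  have h := (mem_unitLevel hN).1 ht
  have hz : (0 : Af F) ∈ integralAdeles F := zero_mem _
  have ho : (1 : Af F) ∈ integralAdeles F := one_mem _
  have hz' : (0 : Af F) ∈ natLattice N hN := zero_mem _
  refine (mem_levelGroup hN).2 ⟨mem_levelOne_of_det ?_ ?_, ?_⟩
  · have ht' : (t : Af F) ∈ integralAdeles F := h.1.1
    simp [Fin.forall_fin_two, coe_diag, hz, ho, ht']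
  · rw [det_diag, mul_one]; exact h.1
  · simpa [Fin.forall_fin_two, coe_diag, hz'] using h.2

/-- The matrices `diag(t, 1)` realize every determinant. With `comap_scalar_levelGroup` this gives
`det K_N = U_N = K_N ∩ Z`, so that `K_N` satisfies the condition imposed on levels. -/
theorem detGroup_levelGroup {N : ℕ} (hN : N ≠ 0) : detGroup F (levelGroup F N) = unitLevel F N := by
  ext t
  constructor
  · rintro ⟨k, hk, rfl⟩
    exact det_mem_unitLevel hN hk
  · exact fun ht => ⟨_, diag_mem_levelGroup hN ht, by rw [det_diag, mul_one]⟩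

theorem comap_scalar_levelGroup {N : ℕ} (hN : N ≠ 0) :
    (levelGroup F N).comap (Matrix.GeneralLinearGroup.scalar (Fin 2)) = unitLevel F N := by
  ext t
  exact scalar_mem_levelGroup_iff hN

end

/-! ### Signs, infinite components and the product formula. -/

section

variable {F : Type*} [Field F] [NumberField F]

/-! ### Signs -/

theorem realSign_of_pos {x : ℝ} (hx : 0 < x) : realSign x = 1 := if_pos hx

theorem realSign_of_neg {x : ℝ} (hx : x < 0) : realSign x = -1 := if_neg hx.not_gt

theorem realSign_mul {x y : ℝ} (hx : x ≠ 0) (hy : y ≠ 0) :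
    realSign (x * y) = realSign x * realSign y := by
  rcases hx.lt_or_gt with hx | hx <;> rcases hy.lt_or_gt with hy | hy
  · rw [realSign_of_pos (mul_pos_of_neg_of_neg hx hy), realSign_of_neg hx, realSign_of_neg hy]; rfl
  · rw [realSign_of_neg (mul_neg_of_neg_of_pos hx hy), realSign_of_neg hx, realSign_of_pos hy]; rfl
  · rw [realSign_of_neg (mul_neg_of_pos_of_neg hx hy), realSign_of_pos hx, realSign_of_neg hy]; rfl
  · rw [realSign_of_pos (mul_pos hx hy), realSign_of_pos hx, realSign_of_pos hy]; rfl

theorem realSign_intUnits (ε : ℤˣ) : realSign ((ε : ℤ) : ℝ) = ε := by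
  rcases Int.units_eq_one_or ε with rfl | rfl
  · exact realSign_of_pos (by norm_num)
  · exact realSign_of_neg (by norm_num)

theorem realSign_mul_self_pos {x : ℝ} (hx : x ≠ 0) : 0 < x * ((realSign x : ℤ) : ℝ) := by
  rcases hx.lt_or_gt with hx | hx
  · rw [realSign_of_neg hx]; simpa using hx
  · rw [realSign_of_pos hx]; simpa using hx

theorem realSign_eq_one_iff {x : ℝ} : realSign x = 1 ↔ 0 < x := by
  refine ⟨fun h => ?_, realSign_of_pos⟩
  by_contra hx
  rw [realSign, if_neg hx] at h
  exact absurd h (by decide)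

/-- The signs of the components of an element of `F_ℝ^×`. -/
def signHom : (InfinitePlace F → ℝˣ) →* Signs F where
  toFun x v := realSign (x v : ℝ)
  map_one' := funext fun _ => realSign_of_pos one_pos
  map_mul' x y := funext fun v => realSign_mul (x v).ne_zero (y v).ne_zero

theorem signHom_apply (x : InfinitePlace F → ℝˣ) (v) : signHom x v = realSign (x v : ℝ) := rfl

@[simp] theorem coe_signReal_apply (ε : Signs F) (v) :
    ((signReal F ε v : ℝˣ) : ℝ) = ((ε v : ℤ) : ℝ) := rfl

@[simp] theorem signHom_signReal (ε : Signs F) : signHom (signReal F ε) = ε :=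
  funext fun v => realSign_intUnits (ε v)

theorem signHom_eq_one_iff {x : InfinitePlace F → ℝˣ} : signHom x = 1 ↔ ∀ v, 0 < (x v : ℝ) := by
  rw [funext_iff]
  exact forall_congr' fun v => realSign_eq_one_iff

theorem signs_mul_self (ε : Signs F) : ε * ε = 1 := funext fun v => Int.units_mul_self (ε v)

theorem mul_signReal_pos (x : InfinitePlace F → ℝˣ) (v) :
    0 < ((x * signReal F (signHom x)) v : ℝ) := realSign_mul_self_pos (x v).ne_zero

/-! ### Ideles -/

theorem finPart_eq : finPart F = Units.map (RingHom.snd (InfiniteAdeleRing F) (Af F)).toMonoidHom :=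
  rfl

@[simp] theorem finPart_finIdele (t : (Af F)ˣ) : finPart F (finIdele F t) = t := rfl

/-- Principal finite ideles. -/
def finPrincipal : Fˣ →* (Af F)ˣ := Units.map (algebraMap F (Af F)).toMonoidHom

@[simp] theorem finPart_principal (a : Fˣ) :
    finPart F (principal F a) = finPrincipal a := rfl

theorem continuous_finPart : Continuous (finPart F) := by
  rw [finPart_eq]
  exact Continuous.units_map _ continuous_snd

theorem continuous_finIdele : Continuous (finIdele F) := by
  refine Units.continuous_iff.2 ⟨?_, ?_⟩
  · exact Continuous.prodMk continuous_const Units.continuous_val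
  · exact Continuous.prodMk continuous_const (Units.continuous_val.comp continuous_inv)

theorem finNorm_finPrincipal (a : Fˣ) :
    finNorm F (finPrincipal a) = ∏ᶠ w : FinitePlace F, w (a : F) := by
  rw [finNorm, ← finprod_comp_equiv FinitePlace.equivHeightOneSpectrum.symm]
  exact finprod_congr fun v => (FinitePlace.equivHeightOneSpectrum_symm_apply v (a : F)).symm

section TotallyReal

variable [IsTotallyReal F]

/-- The completion of a totally real field at an infinite place is `ℝ`. -/
abbrev completionEquiv (v : InfinitePlace F) : v.Completion ≃+* ℝ :=
  InfinitePlace.Completion.ringEquivRealOfIsReal (IsTotallyReal.isReal v)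

/-- The infinite component of an idele. -/
def realPart : Ideles F →* (InfinitePlace F → ℝˣ) where
  toFun t v := Units.map ((completionEquiv v).toRingHom.comp ((Pi.evalRingHom
    (fun v : InfinitePlace F => v.Completion) v).comp
      (RingHom.fst (InfiniteAdeleRing F) (Af F)))).toMonoidHom t
  map_one' := funext fun v => map_one _
  map_mul' s t := funext fun v => map_mul _ s t

@[simp] theorem realPart_realIdele (x : InfinitePlace F → ℝˣ) : realPart (realIdele F x) = x :=
  funext fun v => Units.ext ((completionEquiv v).apply_symm_apply (x v : ℝ))

@[simp] theorem realPart_finIdele (t : (Af F)ˣ) : realPart (finIdele F t) = 1 :=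
  funext fun v => Units.ext (map_one (completionEquiv v))

@[simp] theorem finPart_realIdele (x : InfinitePlace F → ℝˣ) : finPart F (realIdele F x) = 1 := rfl

theorem ideles_ext {s t : Ideles F} (h1 : realPart s = realPart t) (h2 : finPart F s = finPart F t) :
    s = t := by
  refine Units.ext (Prod.ext (funext fun v => ?_) (congrArg Units.val h2))
  exact (completionEquiv v).injective (congrArg (fun x : InfinitePlace F → ℝˣ => (x v : ℝ)) h1)

theorem idele_eq (t : Ideles F) : t = finIdele F (finPart F t) * realIdele F (realPart t) :=
  ideles_ext (by simp) (by simp)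

theorem coe_realPart_principal (a : Fˣ) (v) : (realPart (principal F a) v : ℝ) =
    InfinitePlace.embedding_of_isReal (IsTotallyReal.isReal v) (a : F) :=
  InfinitePlace.Completion.extensionEmbeddingOfIsReal_coe _ _

theorem continuous_realPart : Continuous (realPart (F := F)) := by
  refine continuous_pi fun v => ?_
  refine Continuous.units_map _ ?_
  exact (InfinitePlace.Completion.isometry_extensionEmbeddingOfIsReal _).continuous.comp
    ((continuous_apply v).comp continuous_fst)

theorem signHom_realPart_principal (γ : GL (Fin 2) F) :
    signHom (realPart (principal F (Matrix.GeneralLinearGroup.det γ))) = (rational F γ).2 := by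
  funext v
  rw [signHom_apply, coe_realPart_principal]
  rfl

/-! ### The idele norm -/

/-- The idele norm. -/
def ideleNorm (t : Ideles F) : ℝ := (∏ v, |(realPart t v : ℝ)|) * finNorm F (finPart F t)

theorem ideleNorm_mul (s t : Ideles F) : ideleNorm (s * t) = ideleNorm s * ideleNorm t := by
  simp only [ideleNorm, map_mul, Pi.mul_apply, Units.val_mul, abs_mul, Finset.prod_mul_distrib,
    finNorm_mul]
  ring

@[simp] theorem ideleNorm_finIdele (t : (Af F)ˣ) : ideleNorm (finIdele F t) = finNorm F t := by
  simp [ideleNorm]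

theorem ideleNorm_realIdele (x : InfinitePlace F → ℝˣ) :
    ideleNorm (realIdele F x) = ∏ v, |(x v : ℝ)| := by
  simp [ideleNorm]

theorem ideleNorm_pos (t : Ideles F) : 0 < ideleNorm t :=
  mul_pos (Finset.prod_pos fun v _ => abs_pos.2 (Units.ne_zero _)) (finNorm_pos _)

theorem continuous_ideleNorm : Continuous (ideleNorm (F := F)) := by
  refine Continuous.mul (continuous_finsetProd _ fun v _ => ?_)
    (continuous_finNorm.comp continuous_finPart)
  exact (Units.continuous_val.comp ((continuous_apply v).comp continuous_realPart)).abs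

-- This is the product formula. Since all infinite places are real, every archimedean multiplicity
-- is `1`.
@[simp] theorem ideleNorm_principal (a : Fˣ) : ideleNorm (principal F a) = 1 := by
  rw [ideleNorm, finPart_principal, finNorm_finPrincipal, ← prod_abs_eq_one a.ne_zero]
  congr 1
  refine Finset.prod_congr rfl fun v _ => ?_
  have hv := IsTotallyReal.isReal v
  rw [coe_realPart_principal, ← InfinitePlace.norm_embedding_of_isReal hv, Real.norm_eq_abs,
    InfinitePlace.mult, if_pos hv, pow_one]

end TotallyReal

end

/-! ### Ideals attached to ideles, finiteness of class groups, sums over ideals. -/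

section

variable {F : Type*} [Field F] [NumberField F]

/-! ### The ideal attached to an integral idele -/

/-- The order of an integral idele at `v`. -/
def ordNat (t : (Af F)ˣ) (v : HeightOneSpectrum (𝓞 F)) : ℕ :=
  (-(WithZero.log (Valued.v ((t : Af F) v)))).toNat

theorem valued_eq_exp {t : (Af F)ˣ} (ht : (t : Af F) ∈ integralAdeles F) (v) :
    Valued.v ((t : Af F) v) = WithZero.exp (-(ordNat t v : ℤ)) := by
  have h0 : Valued.v ((t : Af F) v) ≠ 0 := (Valuation.ne_zero_iff _).2 (Af.unit_ne_zero t v)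
  have h1 : Valued.v ((t : Af F) v) ≤ 1 := ht v
  have h2 : WithZero.log (Valued.v ((t : Af F) v)) ≤ 0 := by
    rw [← WithZero.log_one]
    exact (WithZero.log_le_log h0 one_ne_zero).2 h1
  rw [ordNat, Int.toNat_of_nonneg (by omega), neg_neg, WithZero.exp_log h0]

theorem norm_eq_absNorm_pow {t : (Af F)ˣ} (ht : (t : Af F) ∈ integralAdeles F) (v) :
    ‖(t : Af F) v‖ = ((v.asIdeal.absNorm : ℝ) ^ ordNat t v)⁻¹ := by
  rw [FinitePlace.norm_def, valued_eq_exp ht, WithZeroMulInt.toNNReal_neg_apply _ (by simp)]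
  have : Multiplicative.toAdd (WithZero.unzero (WithZero.exp_ne_zero (a := -(ordNat t v : ℤ)))) =
    -(ordNat t v : ℤ) := rfl
  rw [this]
  simp

theorem ordNat_eq_zero_iff {t : (Af F)ˣ} (ht : (t : Af F) ∈ integralAdeles F) (v) :
    ordNat t v = 0 ↔ ‖(t : Af F) v‖ = 1 := by
  rw [norm_eq_one_iff, valued_eq_exp ht, ← WithZero.exp_zero, WithZero.exp_inj]
  omega

theorem eventually_ordNat {t : (Af F)ˣ} (ht : (t : Af F) ∈ integralAdeles F) :
    ∀ᶠ v in cofinite, ordNat t v = 0 :=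
  (Af.unit_eventually t).mono fun v hv => (ordNat_eq_zero_iff ht v).2 hv

theorem ordNat_mul {s t : (Af F)ˣ} (hs : (s : Af F) ∈ integralAdeles F)
    (ht : (t : Af F) ∈ integralAdeles F) (v) : ordNat (s * t) v = ordNat s v + ordNat t v := by
  have hst : ((s * t : (Af F)ˣ) : Af F) ∈ integralAdeles F := mul_mem hs ht
  have h := valued_eq_exp hst v
  rw [Units.val_mul, Af.mul_apply, map_mul, valued_eq_exp hs, valued_eq_exp ht, ← WithZero.exp_add,
    WithZero.exp_inj] at h
  omega

/-- The ideal attached to an integral idele. -/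
def idealOf (t : (Af F)ˣ) : Ideal (𝓞 F) :=
  ∏ᶠ v : HeightOneSpectrum (𝓞 F), v.asIdeal ^ ordNat t v

theorem finite_mulSupport_idealOf {t : (Af F)ˣ} (ht : (t : Af F) ∈ integralAdeles F) :
    Function.HasFiniteMulSupport fun v : HeightOneSpectrum (𝓞 F) => v.asIdeal ^ ordNat t v := by
  refine (show ({v | ¬ ordNat t v = 0} : Set (HeightOneSpectrum (𝓞 F))).Finite from
    eventually_ordNat ht).subset fun v hv h => hv ?_
  simp only [h, pow_zero]

theorem idealOf_mul {s t : (Af F)ˣ} (hs : (s : Af F) ∈ integralAdeles F)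
    (ht : (t : Af F) ∈ integralAdeles F) : idealOf (s * t) = idealOf s * idealOf t := by
  rw [idealOf, idealOf, idealOf, ← finprod_mul_distrib (finite_mulSupport_idealOf hs)
    (finite_mulSupport_idealOf ht)]
  exact finprod_congr fun v => by rw [ordNat_mul hs ht, pow_add]

theorem absNorm_idealOf {t : (Af F)ˣ} (ht : (t : Af F) ∈ integralAdeles F) :
    ((idealOf t).absNorm : ℝ) = (finNorm F t)⁻¹ := by
  have h := MonoidHom.map_finprod (((Nat.castRingHom ℝ).toMonoidHom).comp
    (Ideal.absNorm (S := 𝓞 F)).toMonoidHom) (finite_mulSupport_idealOf ht)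
  refine h.trans ?_
  rw [finNorm, ← finprod_inv_distrib]
  refine finprod_congr fun v => ?_
  rw [norm_eq_absNorm_pow ht, inv_inv]
  simp

theorem idealOf_ne_zero {t : (Af F)ˣ} (ht : (t : Af F) ∈ integralAdeles F) : idealOf t ≠ 0 := by
  intro h
  have h1 := absNorm_idealOf ht
  rw [h] at h1
  have := inv_pos.2 (finNorm_pos t)
  rw [← h1] at this
  simp at this

/-- Unique factorization of ideals: the local orders are recovered as the multiplicities of the
primes, read off in the group of fractional ideals. -/
theorem ordNat_eq_of_idealOf_eq {s t : (Af F)ˣ} (hs : (s : Af F) ∈ integralAdeles F)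
    (ht : (t : Af F) ∈ integralAdeles F) (h : idealOf s = idealOf t) (v) :
    ordNat s v = ordNat t v := by
  have key : ∀ t : (Af F)ˣ, (t : Af F) ∈ integralAdeles F →
      FractionalIdeal.count F v (idealOf t : FractionalIdeal (nonZeroDivisors (𝓞 F)) F) =
        ordNat t v := by
    intro t ht
    rw [idealOf, FractionalIdeal.coeIdeal_finprod _ _ le_rfl,
      ← FractionalIdeal.count_finprod F v (fun v => (ordNat t v : ℤ))
        ((eventually_ordNat ht).mono fun v hv => by simp [hv])]
    congr 1
    exact finprod_congr fun w => by rw [FractionalIdeal.coeIdeal_pow, zpow_natCast]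
  have h1 := key s hs
  rw [h, key t ht] at h1
  exact_mod_cast h1.symm

/-- The fibres of `idealOf` on integral ideles therefore lie in single cosets of `Ô^×`. Both the
finiteness of the class groups and the convergence of the integrals rest on this. -/
theorem mul_inv_mem_integralUnits {s t : (Af F)ˣ} (hs : (s : Af F) ∈ integralAdeles F)
    (ht : (t : Af F) ∈ integralAdeles F) (h : idealOf s = idealOf t) :
    s⁻¹ * t ∈ integralUnits F := by
  refine mem_integralUnits.2 fun v => ?_
  rw [Units.val_mul, Af.mul_apply, norm_mul, Af.inv_apply, norm_inv, norm_eq_absNorm_pow hs,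
    norm_eq_absNorm_pow ht, ordNat_eq_of_idealOf_eq hs ht h, inv_inv]
  refine mul_inv_cancel₀ (pow_ne_zero _ ?_)
  exact_mod_cast (absNorm_pos v).ne'

/-- The finite idele attached to a non-zero integer of `F`. -/
def intUnit (a : 𝓞 F) (ha : a ≠ 0) : Fˣ := Units.mk0 (a : F) (RingOfIntegers.coe_ne_zero_iff.2 ha)

theorem intUnit_mem (a : 𝓞 F) (ha : a ≠ 0) :
    ((finPrincipal (intUnit a ha) : (Af F)ˣ) : Af F) ∈ integralAdeles F :=
  algebraMap_mem_integralAdeles a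

theorem idealOf_intUnit (a : 𝓞 F) (ha : a ≠ 0) :
    idealOf (finPrincipal (intUnit a ha)) = Ideal.span {a} := by
  rw [← Ideal.finprod_heightOneSpectrum_factorization (I := Ideal.span {a}) (by simpa using ha)]
  refine finprod_congr fun v => ?_
  rw [maxPowDividing]
  congr 1
  have h1 := valued_eq_exp (intUnit_mem a ha) v
  have h2 : Valued.v (((finPrincipal (intUnit a ha) : (Af F)ˣ) : Af F) v) =
      v.intValuation a := by
    rw [← v.valuation_of_algebraMap (K := F), ← v.valuedAdicCompletion_eq_valuation' (a : F)]
    rfl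
  rw [h2, v.intValuation_if_neg ha, WithZero.exp_inj] at h1
  omega

/-! ### Finiteness of the idele class groups -/

theorem unit_mul_mem {s t : (Af F)ˣ} (hs : (s : Af F) ∈ integralAdeles F)
    (ht : (t : Af F) ∈ integralAdeles F) : ((s * t : (Af F)ˣ) : Af F) ∈ integralAdeles F :=
  mul_mem hs ht

theorem inv_mul_eq_of_comm {G : Type*} [CommGroup G] (a b c d : G) :
    a⁻¹ * b = c * d⁻¹ * ((c * a)⁻¹ * (d * b)) := by
  rw [mul_inv, show c * d⁻¹ * (c⁻¹ * a⁻¹ * (d * b)) = (c * c⁻¹) * (d⁻¹ * d) * (a⁻¹ * b) by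
    simp only [mul_comm, mul_assoc, mul_left_comm]]
  simp

/-- Multiplication by a positive integer, which is principal, makes any representative integral.
Sending it to its ideal class embeds the quotient in the finite class group of `𝓞 F`. -/
theorem finiteIndex_principal_sup_integralUnits :
    ((finPrincipal (F := F)).range ⊔ integralUnits F).FiniteIndex := by
  have hrep : ∀ q : (Af F)ˣ ⧸ ((finPrincipal (F := F)).range ⊔ integralUnits F),
      ∃ t : (Af F)ˣ, (t : Af F) ∈ integralAdeles F ∧ (t : (Af F)ˣ ⧸ _) = q := by
    intro q
    obtain ⟨t, rfl⟩ := QuotientGroup.mk_surjective q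
    obtain ⟨N, hN, h⟩ := exists_nat_mul_mem (t : Af F)
    refine ⟨t * Af.natUnit N hN, ?_, ?_⟩
    · rwa [mul_comm, Units.val_mul, Af.coe_natUnit]
    · refine (QuotientGroup.mk_mul_of_mem t ?_)
      exact Subgroup.mem_sup_left ⟨_, rfl⟩
  choose r hr hr' using hrep
  rw [Subgroup.finiteIndex_iff_finite_quotient]
  refine Finite.of_injective (fun q => ClassGroup.mk0 (R := 𝓞 F)
    ⟨idealOf (r q), mem_nonZeroDivisors_of_ne_zero (idealOf_ne_zero (hr q))⟩) fun p q h => ?_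
  -- Equal ideal classes give non-zero integers `x`, `y` such that the ideles `x r(p)` and `y r(q)`
  -- have the same ideal; they differ by an element of `Ô^×`, and `x`, `y` are principal.
  obtain ⟨x, y, hx, hy, hxy⟩ := ClassGroup.mk0_eq_mk0_iff.1 h
  simp only at hxy
  rw [← idealOf_intUnit x hx, ← idealOf_intUnit y hy, ← idealOf_mul (intUnit_mem x hx) (hr p),
    ← idealOf_mul (intUnit_mem y hy) (hr q)] at hxy
  have h1 := mul_inv_mem_integralUnits (unit_mul_mem (intUnit_mem x hx) (hr p))
    (unit_mul_mem (intUnit_mem y hy) (hr q)) hxy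
  rw [← hr' p, ← hr' q, QuotientGroup.eq,
    inv_mul_eq_of_comm _ _ (finPrincipal (intUnit x hx)) (finPrincipal (intUnit y hy))]
  refine mul_mem (Subgroup.mem_sup_left ⟨intUnit x hx * (intUnit y hy)⁻¹, ?_⟩)
    (Subgroup.mem_sup_right h1)
  rw [map_mul, map_inv]

theorem relIndex_ne_zero_of_isOpen {G : Type*} [Group G] [TopologicalSpace G] [IsTopologicalGroup G]
    {H K : Subgroup G} (hH : IsOpen (H : Set G)) (hK : IsCompact (K : Set G)) :
    H.relIndex K ≠ 0 := by
  have : CompactSpace K := isCompact_iff_compactSpace.1 hK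
  have hop : IsOpen ((H.subgroupOf K : Subgroup K) : Set K) := hH.preimage continuous_subtype_val
  have : Finite (K ⧸ H.subgroupOf K) := (H.subgroupOf K).quotient_finite_of_isOpen hop
  exact (Subgroup.finiteIndex_of_finite_quotient (H := H.subgroupOf K)).index_ne_zero

/-- An open subgroup has finite relative index in the compact group `Ô^×`, which reduces the claim
to the ordinary class group. Relative indices are used because `U` need not be contained in `Ô^×`.
-/
theorem finiteIndex_principal_sup {U : Subgroup (Af F)ˣ} (hU : IsOpen (U : Set (Af F)ˣ)) :
    ((finPrincipal (F := F)).range ⊔ U).FiniteIndex := by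
  set R := (finPrincipal (F := F)).range
  have h1 : (R ⊔ U).relIndex (integralUnits F) ≠ 0 := fun h =>
    relIndex_ne_zero_of_isOpen hU (isCompact_integralUnits F)
      (Nat.eq_zero_of_zero_dvd (h ▸ Subgroup.relIndex_dvd_of_le_left _ le_sup_right))
  have h2 : (R ⊔ U).relIndex (integralUnits F ⊔ (R ⊔ U)) ≠ 0 := by
    rwa [Subgroup.relIndex_sup_right]
  have h3 : (integralUnits F ⊔ (R ⊔ U)).FiniteIndex := by
    have := finiteIndex_principal_sup_integralUnits (F := F)
    exact Subgroup.finiteIndex_of_le (H := R ⊔ integralUnits F)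
      (sup_le (le_sup_left.trans le_sup_right) le_sup_left)
  refine ⟨?_⟩
  rw [← Subgroup.relIndex_mul_index (show R ⊔ U ≤ integralUnits F ⊔ (R ⊔ U) from le_sup_right)]
  exact mul_ne_zero h2 h3.index_ne_zero

section TotallyReal

variable [IsTotallyReal F]

/-- The subgroup `U · F_{ℝ,>0}^× · F^×` of the idele group. -/
def idealClassSubgroup (U : Subgroup (Af F)ˣ) : Subgroup (Ideles F) :=
  U.map (finIdele F) ⊔
    (Subgroup.pi Set.univ fun _ : InfinitePlace F => Units.posSubgroup ℝ).map (realIdele F) ⊔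
    (principal F).range

theorem clSubgroup_eq (K : Subgroup (GL (Fin 2) (Af F))) :
    clSubgroup F K = idealClassSubgroup (detGroup F K) := rfl

theorem rayClSubgroup_eq (N : ℕ) : rayClSubgroup F N = idealClassSubgroup (unitLevel F N) := rfl

/-- The positive real factor absorbs everything at infinity except the signs. What remains is a
condition on the finite part and one on the signs, linked by the same `a`. -/
theorem mem_idealClassSubgroup {U : Subgroup (Af F)ˣ} {t : Ideles F} :
    t ∈ idealClassSubgroup U ↔ ∃ u ∈ U, ∃ a : Fˣ, finPart F t = u * finPrincipal a ∧
      signHom (realPart t) = signHom (realPart (principal F a)) := by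
  constructor
  · intro h
    obtain ⟨x, hx, y, ⟨a, rfl⟩, rfl⟩ := Subgroup.mem_sup.1 h
    obtain ⟨_, ⟨u, hu, rfl⟩, _, ⟨r, hr, rfl⟩, rfl⟩ := Subgroup.mem_sup.1 hx
    refine ⟨u, hu, a, by simp, ?_⟩
    have hr' : signHom r = 1 := signHom_eq_one_iff.2 fun v => hr v trivial
    simp [hr']
  · rintro ⟨u, hu, a, h1, h2⟩
    have : t = finIdele F u * realIdele F (realPart t * (realPart (principal F a))⁻¹) *
        principal F a := ideles_ext (by simp) (by simp [h1])
    rw [this]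
    refine Subgroup.mul_mem_sup (Subgroup.mul_mem_sup ⟨u, hu, rfl⟩ ⟨_, ?_, rfl⟩) ⟨a, rfl⟩
    have h3 : signHom (realPart t * (realPart (principal F a))⁻¹) = 1 := by
      rw [map_mul, map_inv, h2, mul_inv_cancel]
    exact fun v _ => signHom_eq_one_iff.1 h3 v

/-- Together with the real ideles the subgroup contains the preimage of a finite index subgroup of
the finite ideles. The real ideles add only finitely many cosets, because those with all signs `1`
already belong to it. -/
theorem finiteIndex_idealClassSubgroup {U : Subgroup (Af F)ˣ} (hU : IsOpen (U : Set (Af F)ˣ)) :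
    (idealClassSubgroup U).FiniteIndex := by
  have h1 := finiteIndex_principal_sup hU
  have h2 : (((finPrincipal (F := F)).range ⊔ U).comap (finPart F)).FiniteIndex := by
    refine ⟨fun h => h1.index_ne_zero (Nat.eq_zero_of_zero_dvd ?_)⟩
    rw [Subgroup.index_comap] at h
    exact h ▸ Subgroup.relIndex_dvd_index_of_normal _ _
  have h4 : (idealClassSubgroup U).relIndex ((realIdele F).range) ≠ 0 := by
    have hker : (signHom (F := F)).ker.FiniteIndex := Subgroup.finiteIndex_ker _
    have h5 : ((signHom (F := F)).ker.map (realIdele F)).relIndex ((⊤ : Subgroup _).map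
        (realIdele F)) ≠ 0 := by
      rw [Subgroup.relIndex_map_map, top_sup_eq, Subgroup.relIndex_top_right]
      exact (Subgroup.finiteIndex_of_le (H := signHom.ker) le_sup_left).index_ne_zero
    intro h
    rw [MonoidHom.range_eq_map] at h
    refine h5 (Nat.eq_zero_of_zero_dvd (h ▸ Subgroup.relIndex_dvd_of_le_left _ ?_))
    rintro _ ⟨r, hr, rfl⟩
    exact mem_idealClassSubgroup.2 ⟨1, one_mem _, 1, by simp, by simpa using hr⟩
  have h6 : (idealClassSubgroup U).relIndex ((realIdele F).range ⊔ idealClassSubgroup U) ≠ 0 := by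
    rwa [Subgroup.relIndex_sup_right]
  have h7 : ((realIdele F).range ⊔ idealClassSubgroup U).FiniteIndex := by
    refine Subgroup.finiteIndex_of_le
      (H := ((finPrincipal (F := F)).range ⊔ U).comap (finPart F)) fun t ht => ?_
    obtain ⟨_, ⟨a, rfl⟩, u, hu, h⟩ := Subgroup.mem_sup.1 (Subgroup.mem_comap.1 ht)
    have : t = realIdele F (realPart t * (realPart (principal F a))⁻¹) *
        (finIdele F u * principal F a) := ideles_ext (by simp) (by simp [← h, mul_comm])
    rw [this]
    refine Subgroup.mul_mem_sup ⟨_, rfl⟩ ?_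
    exact mem_idealClassSubgroup.2 ⟨u, hu, a, by simp, by simp⟩
  refine ⟨?_⟩
  rw [← Subgroup.relIndex_mul_index (show idealClassSubgroup U ≤
    (realIdele F).range ⊔ idealClassSubgroup U from le_sup_right)]
  exact mul_ne_zero h6 h7.index_ne_zero

theorem isOpen_idealClassSubgroup {U : Subgroup (Af F)ˣ} (hU : IsOpen (U : Set (Af F)ˣ)) :
    IsOpen (idealClassSubgroup U : Set (Ideles F)) := by
  refine Subgroup.isOpen_of_mem_nhds (g := 1) _ ?_
  have h1 : finPart F ⁻¹' U ∈ 𝓝 (1 : Ideles F) :=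
    (hU.preimage continuous_finPart).mem_nhds (by simp [one_mem])
  have h2 : {t : Ideles F | ∀ v, 0 < (realPart t v : ℝ)} ∈ 𝓝 (1 : Ideles F) := by
    refine IsOpen.mem_nhds ?_ (by simp)
    simp only [Set.ofPred_forall]
    exact isOpen_iInter_of_finite fun v => isOpen_lt continuous_const
      (Units.continuous_val.comp ((continuous_apply v).comp continuous_realPart))
  filter_upwards [h1, h2] with t ht1 ht2
  exact mem_idealClassSubgroup.2 ⟨finPart F t, ht1, 1, by simp,
    by simpa using signHom_eq_one_iff.2 ht2⟩

theorem idealClassSubgroup_mono {U V : Subgroup (Af F)ˣ} (h : U ≤ V) :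
    idealClassSubgroup U ≤ idealClassSubgroup V := fun t ht => by
  rw [mem_idealClassSubgroup] at ht ⊢
  obtain ⟨u, hu, h'⟩ := ht
  exact ⟨u, h hu, h'⟩

end TotallyReal

/-! ### Convergence of the zeta function -/

/-- The number of ideals of norm at most `n` is `O(n)`, so the Dirichlet series of the ideal counts
converges to the right of `1`. -/
theorem summable_absNorm_pow {k : ℕ} (hk : 2 ≤ k) :
    Summable fun I : Ideal (𝓞 F) => ((I.absNorm : ℝ) ^ k)⁻¹ := by
  let c : ℕ → ℝ := fun n => Nat.card {I : Ideal (𝓞 F) // I.absNorm = n}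
  have hO : (fun n => ∑ j ∈ Finset.Icc 1 n, c j) =O[atTop] fun n : ℕ => (n : ℝ) ^ (1 : ℝ) := by
    have h := (NumberField.Ideal.tendsto_norm_le_div_atTop₀ F).comp tendsto_natCast_atTop_atTop
    have h1 := h.isBigO_one ℝ
    have h2 := h1.mul (Asymptotics.isBigO_refl (fun n : ℕ => (n : ℝ)) atTop)
    refine (Asymptotics.isBigO_congr ?_ ?_).1 h2
    · filter_upwards [eventually_ne_atTop 0] with n hn
      have hn' : (n : ℝ) ≠ 0 := Nat.cast_ne_zero.2 hn
      simp only [Function.comp_apply, Nat.cast_le]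
      rw [div_mul_cancel₀ _ hn']
      simp only [c]
      rw [← Nat.cast_sum]
      congr 1
      -- The asymptotic formula counts non-zero ideals. Adding the zero ideal on both sides makes it
      -- a count of all ideals, sorted by their norm.
      rw [← add_left_inj 1, ← Ideal.card_norm_le_eq_card_norm_le_add_one,
        show Finset.Icc 1 n = Finset.Ioc 0 n from Finset.Icc_succ_left_eq_Ioc _ _,
        show 1 = Nat.card {I : Ideal (𝓞 F) // Ideal.absNorm I = 0} by
          simp [Ideal.absNorm_eq_zero_iff],
        Finset.sum_Ioc_add_eq_sum_Icc (n.zero_le),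
        ← Finset.card_preimage_eq_sum_card_image_eq
          (fun k _ ↦ Ideal.finite_setOfPred_absNorm_eq k)]
      simp [Set.coe_eq_subtype]
    · filter_upwards with n
      simp
  have hL := LSeriesSummable_of_sum_norm_bigO_and_nonneg (s := (k : ℂ)) hO
    (fun n => Nat.cast_nonneg _) zero_le_one (by simpa using by exact_mod_cast hk)
  rw [← (Equiv.sigmaFiberEquiv (fun I : Ideal (𝓞 F) => I.absNorm)).summable_iff]
  refine (summable_sigma_of_nonneg fun _ => by simp only [Function.comp_apply]; positivity).2
    ⟨fun n => ?_, ?_⟩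
  · have : Finite {I : Ideal (𝓞 F) // I.absNorm = n} := Ideal.finite_setOfPred_absNorm_eq n
    exact Summable.of_finite
  · refine hL.norm.congr fun n => ?_
    have hc : ∀ y : {I : Ideal (𝓞 F) // I.absNorm = n},
        ((fun I : Ideal (𝓞 F) => ((I.absNorm : ℝ) ^ k)⁻¹) ∘
          (Equiv.sigmaFiberEquiv fun I : Ideal (𝓞 F) => I.absNorm)) ⟨n, y⟩ = ((n : ℝ) ^ k)⁻¹ := by
      rintro ⟨y, rfl⟩; rfl
    simp only [hc]
    rw [tsum_const, nsmul_eq_mul, LSeries.norm_term_eq]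
    split_ifs with hn
    -- The zero ideal contributes `(0 ^ k)⁻¹ = 0`, and the term of index `0` of an L-series is `0`
    -- by convention.
    · subst hn; simp [show k ≠ 0 by omega]
    · simp [c, div_eq_mul_inv]

end

/-! ### Integration over the finite ideles and the Euler product. -/

section

variable {F : Type*} [Field F] [NumberField F]

/-! ### The multiplicative Haar measure -/

instance : (mulMeasure F).IsMulLeftInvariant := by unfold mulMeasure; infer_instance

theorem mulMeasure_integralUnits :
    mulMeasure F (integralUnits F) = ENNReal.ofReal (1 / √|(discr F : ℝ)|) := by
  rw [mulMeasure, Measure.smul_apply, smul_eq_mul]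
  have h := Measure.haarMeasure_self (K₀ := (⟨⟨integralUnits F, isCompact_integralUnits F⟩,
      ⟨1, (isOpen_integralUnits F).interior_eq.symm ▸ (integralUnits F).one_mem⟩⟩ :
      TopologicalSpace.PositiveCompacts (Af F)ˣ))
  exact (congrArg _ h).trans (mul_one _)

theorem abs_discr_pos : 0 < |(discr F : ℝ)| := abs_pos.2 (Int.cast_ne_zero.2 (discr_ne_zero F))

theorem integral_mul_left_mulMeasure (f : (Af F)ˣ → ℂ) (u : (Af F)ˣ) :
    ∫ t, f (u * t) ∂mulMeasure F = ∫ t, f t ∂mulMeasure F :=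
  integral_mul_left_eq_self f u

instance : Countable (Ideal (𝓞 F)) := by
  have : ∀ n, Finite {I : Ideal (𝓞 F) // I.absNorm = n} := fun n =>
    Ideal.finite_setOfPred_absNorm_eq n
  exact (Equiv.sigmaFiberEquiv (fun I : Ideal (𝓞 F) => I.absNorm)).symm.injective.countable

instance : Countable (HeightOneSpectrum (𝓞 F)) :=
  Function.Injective.countable (f := fun v : HeightOneSpectrum (𝓞 F) => v.asIdeal)
    fun _ _ h => HeightOneSpectrum.ext h

/-- The set of integral finite ideles. -/
def integralIdeles (F : Type*) [Field F] [NumberField F] : Set (Af F)ˣ :=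
  {t | (t : Af F) ∈ integralAdeles F}

theorem isClosed_integralIdeles : IsClosed (integralIdeles F) :=
  (isCompact_integralAdeles F).isClosed.preimage Units.continuous_val

theorem measurableSet_integralIdeles : MeasurableSet (integralIdeles F) :=
  isClosed_integralIdeles.measurableSet

/-- Cut the integral ideles into the countably many fibres over ideals `I`. Each fibre is empty or
lies in one coset of `Ô^×`, on which the norm is `N(I)⁻¹`, so the total is at most the volume of
`Ô^×` times the sum of `N(I)^{-k}`. -/
theorem integrableOn_finNorm_pow {k : ℕ} (hk : 2 ≤ k) :
    IntegrableOn (fun t => finNorm F t ^ k) (integralIdeles F) (mulMeasure F) := by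
  refine ⟨((continuous_finNorm.pow k).aestronglyMeasurable), ?_⟩
  let D : Ideal (𝓞 F) → Set (Af F)ˣ := fun I => {t | t ∈ integralIdeles F ∧ idealOf t = I}
  have hD : integralIdeles F ⊆ ⋃ I, D I := fun t ht => Set.mem_iUnion.2 ⟨_, ht, rfl⟩
  have hbound : ∀ I, ∫⁻ t in D I, ‖finNorm F t ^ k‖ₑ ∂mulMeasure F ≤
      ENNReal.ofReal (((I.absNorm : ℝ) ^ k)⁻¹) * mulMeasure F (integralUnits F) := by
    intro I
    rcases (D I).eq_empty_or_nonempty with h | ⟨s, hs, hsI⟩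
    · simp [h]
    have hDs : D I ⊆ (fun t => s⁻¹ * t) ⁻¹' (integralUnits F : Set (Af F)ˣ) := fun t ht =>
      mul_inv_mem_integralUnits hs ht.1 (hsI.trans ht.2.symm)
    have hm : MeasurableSet ((fun t => s⁻¹ * t) ⁻¹' (integralUnits F : Set (Af F)ˣ)) :=
      ((isOpen_integralUnits F).preimage (continuous_const_mul s⁻¹)).measurableSet
    calc ∫⁻ t in D I, ‖finNorm F t ^ k‖ₑ ∂mulMeasure F
        ≤ ∫⁻ t in (fun t => s⁻¹ * t) ⁻¹' (integralUnits F : Set (Af F)ˣ), ‖finNorm F t ^ k‖ₑ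
          ∂mulMeasure F := lintegral_mono_set hDs
      _ = ∫⁻ t in (fun t => s⁻¹ * t) ⁻¹' (integralUnits F : Set (Af F)ˣ),
          ENNReal.ofReal (((I.absNorm : ℝ) ^ k)⁻¹) ∂mulMeasure F := by
          refine setLIntegral_congr_fun hm fun t ht => ?_
          have h1 : finNorm F t = finNorm F s := by
            have := finNorm_eq_one (show s⁻¹ * t ∈ integralUnits F from ht)
            rwa [finNorm_mul, finNorm_inv, inv_mul_eq_one₀ (finNorm_pos s).ne', eq_comm] at this
          have h2 : finNorm F t = ((I.absNorm : ℝ))⁻¹ := by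
            rw [h1, ← hsI, absNorm_idealOf hs, inv_inv]
          rw [← ofReal_norm, Real.norm_of_nonneg (pow_nonneg (finNorm_pos t).le k), h2,
            inv_pow]
      _ = _ := by rw [setLIntegral_const, measure_preimage_mul]
  refine (lintegral_mono_set hD).trans_lt ((lintegral_iUnion_le _ _).trans_lt ?_)
  refine (ENNReal.tsum_le_tsum hbound).trans_lt ?_
  rw [ENNReal.tsum_mul_right]
  refine ENNReal.mul_lt_top ?_ ?_
  · exact (summable_absNorm_pow hk).tsum_ofReal_lt_top
  · rw [mulMeasure_integralUnits]; exact ENNReal.ofReal_lt_top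

/-- A continuous function on the finite ideles which is bounded by a constant times `‖t‖^k` and is
supported in a lattice is integrable. -/
theorem integrable_of_norm_le {k : ℕ} (hk : 2 ≤ k) {f : (Af F)ˣ → ℂ} (hf : Continuous f) (C : ℝ)
    (s : (Af F)ˣ) (hb : ∀ t, ‖f t‖ ≤ C * finNorm F t ^ k)
    (hs : ∀ t : (Af F)ˣ, (t : Af F) ∉ lattice s → f t = 0) : Integrable f (mulMeasure F) := by
  have h1 : Integrable (fun t => (integralIdeles F).indicator (fun t => finNorm F t ^ k) (s⁻¹ * t))
      (mulMeasure F) :=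
    ((integrable_indicator_iff measurableSet_integralIdeles).2
      (integrableOn_finNorm_pow hk)).comp_mul_left s⁻¹
  refine (h1.const_mul (C * finNorm F s ^ k)).mono' hf.aestronglyMeasurable
    (Eventually.of_forall fun t => ?_)
  by_cases ht : (t : Af F) ∈ lattice s
  · rw [Set.indicator_of_mem, finNorm_mul, finNorm_inv, mul_pow, mul_assoc, inv_pow,
      mul_inv_cancel_left₀ (pow_ne_zero _ (finNorm_pos s).ne')]
    · exact hb t
    · exact inv_mul_mem_iff.2 ht
  · rw [hs t ht, norm_zero, Set.indicator_of_notMem, mul_zero]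
    exact fun h => ht (inv_mul_mem_iff.1 h)

theorem isLocallyConstant_of_trivial_on {G H : Type*} [Group G] [TopologicalSpace G]
    [IsTopologicalGroup G] [Group H] (f : G →* H) (U : Subgroup G) (hU : IsOpen (U : Set G))
    (h : ∀ u ∈ U, f u = 1) : IsLocallyConstant f := by
  rw [IsLocallyConstant.iff_exists_open]
  intro t
  refine ⟨(fun s => t⁻¹ * s) ⁻¹' U, hU.preimage (continuous_const_mul t⁻¹), ?_, fun s hs => ?_⟩
  · rw [Set.mem_preimage, inv_mul_cancel]; exact one_mem _
  · have := h _ hs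
    rw [map_mul, map_inv, inv_mul_eq_one] at this
    exact this.symm

/-! ### The Euler product -/

section Away

variable (N : ℕ)

open Classical in
/-- The finite idele with the components of `t` at the places not dividing `N`, and `1` at the
other places. -/
def awayPart : (Af F)ˣ →* (Af F)ˣ where
  toFun t := Af.mkUnit (fun v => if (N : 𝓞 F) ∈ v.asIdeal then 1 else (t : Af F) v)
    (fun v => by split_ifs; exacts [one_ne_zero, Af.unit_ne_zero t v])
    ((Af.unit_eventually t).mono fun v hv => by split_ifs; exacts [norm_one, hv])
  map_one' := Units.ext (FiniteAdeleRing.ext F fun v => by simp)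
  map_mul' s t := Units.ext (FiniteAdeleRing.ext F fun v => by
    simp only [Af.mkUnit_apply, Units.val_mul, Af.mul_apply]
    split_ifs <;> simp)

theorem awayPart_apply_of_mem {v : HeightOneSpectrum (𝓞 F)} (h : (N : 𝓞 F) ∈ v.asIdeal)
    (t : (Af F)ˣ) : (awayPart N t : Af F) v = 1 := if_pos h

theorem awayPart_apply_of_notMem {v : HeightOneSpectrum (𝓞 F)} (h : (N : 𝓞 F) ∉ v.asIdeal)
    (t : (Af F)ˣ) : (awayPart N t : Af F) v = (t : Af F) v := if_neg h

variable {N}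

theorem mem_unitLevel_of_eq_one (hN : N ≠ 0) {t : (Af F)ˣ} (ht : t ∈ integralUnits F)
    (h : ∀ v : HeightOneSpectrum (𝓞 F), (N : 𝓞 F) ∈ v.asIdeal → (t : Af F) v = 1) :
    t ∈ unitLevel F N := by
  refine (mem_unitLevel hN).2 ⟨ht, mem_natLattice.2 fun v => ?_⟩
  by_cases hv : (N : 𝓞 F) ∈ v.asIdeal
  · simp [h v hv]
  · rw [(norm_natCast_eq_one_iff v N).2 hv]
    exact mem_integralAdeles.1 (sub_mem ht.1 (one_mem _)) v

/-- Consequently a character trivial on `U_N`, composed with `awayPart N`, is trivial on all of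
`Ô^×`. -/
theorem awayPart_mem_unitLevel (hN : N ≠ 0) {t : (Af F)ˣ} (ht : t ∈ integralUnits F) :
    awayPart N t ∈ unitLevel F N := by
  refine mem_unitLevel_of_eq_one hN (mem_integralUnits.2 fun v => ?_)
    fun v hv => awayPart_apply_of_mem N hv t
  by_cases hv : (N : 𝓞 F) ∈ v.asIdeal
  · rw [awayPart_apply_of_mem N hv, norm_one]
  · rw [awayPart_apply_of_notMem N hv]; exact mem_integralUnits.1 ht v

end Away

theorem uniformizer_apply_self (v : HeightOneSpectrum (𝓞 F)) :
    Valued.v ((uniformizer v : Af F) v) = WithZero.exp (-1 : ℤ) := by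
  have h : (uniformizer v : Af F) v =
      algebraMap F (v.adicCompletion F) (Classical.choose (v.valuation_exists_uniformizer F)) :=
    by classical exact RestrictedProduct.mulSingle_eq_same _ _ _
  rw [h]
  exact (v.valuedAdicCompletion_eq_valuation' _).trans
    (Classical.choose_spec (v.valuation_exists_uniformizer F))

theorem uniformizer_apply_of_ne {v w : HeightOneSpectrum (𝓞 F)} (h : w ≠ v) :
    (uniformizer v : Af F) w = 1 := by
  classical exact RestrictedProduct.mulSingle_eq_of_ne _ _ h

theorem norm_uniformizer (v : HeightOneSpectrum (𝓞 F)) :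
    ‖(uniformizer v : Af F) v‖ = (v.asIdeal.absNorm : ℝ)⁻¹ := by
  rw [FinitePlace.norm_def, uniformizer_apply_self, WithZeroMulInt.toNNReal_neg_apply _ (by simp)]
  have : Multiplicative.toAdd (WithZero.unzero (WithZero.exp_ne_zero (a := (-1 : ℤ)))) =
    (-1 : ℤ) := rfl
  rw [this]
  simp

theorem finNorm_uniformizer (v : HeightOneSpectrum (𝓞 F)) :
    finNorm F (uniformizer v) = (v.asIdeal.absNorm : ℝ)⁻¹ := by
  rw [finNorm, finprod_eq_single _ v fun w hw => by rw [uniformizer_apply_of_ne hw, norm_one],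
    norm_uniformizer]

/-- The integral finite ideles which are units at the places in a set `S`. -/
def integralIdelesAway (S : Set (HeightOneSpectrum (𝓞 F))) : Set (Af F)ˣ :=
  {t | t ∈ integralIdeles F ∧ ∀ v ∈ S, ‖(t : Af F) v‖ = 1}

theorem measurableSet_integralIdelesAway (S : Set (HeightOneSpectrum (𝓞 F))) :
    MeasurableSet (integralIdelesAway S) := by
  have : integralIdelesAway S = integralIdeles F ∩
      ⋂ v ∈ S, {t : (Af F)ˣ | ‖(t : Af F) v‖ = 1} := by
    ext t; simp [integralIdelesAway]
  rw [this]
  refine (isClosed_integralIdeles.inter (isClosed_biInter fun v _ => ?_)).measurableSet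
  exact isClosed_eq ((Af.continuous_apply v).comp Units.continuous_val).norm continuous_const

/-- Translation by `π_v` carries the domain of integration attached to `S` onto the part of it that
is lost when `v` is added to `S`. This is what splits off one Euler factor. -/
theorem mul_uniformizer_mem_iff {S : Set (HeightOneSpectrum (𝓞 F))} {v : HeightOneSpectrum (𝓞 F)}
    (hv : v ∉ S) (t : (Af F)ˣ) : uniformizer v * t ∈ integralIdelesAway S ∧
      uniformizer v * t ∉ integralIdelesAway (insert v S) ↔ t ∈ integralIdelesAway S := by
  have hw : ∀ w, w ≠ v → ((uniformizer v * t : (Af F)ˣ) : Af F) w = (t : Af F) w := fun w h => by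
    rw [Units.val_mul, Af.mul_apply, uniformizer_apply_of_ne h, one_mul]
  have hq : 1 < (v.asIdeal.absNorm : ℝ) := by
    exact_mod_cast NumberField.HeightOneSpectrum.one_lt_absNorm v
  have hvv : ‖((uniformizer v * t : (Af F)ˣ) : Af F) v‖ =
      (v.asIdeal.absNorm : ℝ)⁻¹ * ‖(t : Af F) v‖ := by
    rw [Units.val_mul, Af.mul_apply, norm_mul, norm_uniformizer]
  constructor
  · rintro ⟨⟨h1, h2⟩, h3⟩
    refine ⟨mem_integralAdeles.2 fun w => ?_, fun w hwS => ?_⟩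
    · by_cases h : w = v
      · subst h
        have h4 : ‖((uniformizer w * t : (Af F)ˣ) : Af F) w‖ ≠ 1 := fun h => h3 ⟨h1, by
          rintro u (rfl | hu)
          exacts [h, h2 u hu]⟩
        -- A non-unit has order at least `1`, so one uniformizer can be divided out without losing
        -- integrality.
        have h5 : ordNat (uniformizer w * t) w ≠ 0 := fun h => h4 ((ordNat_eq_zero_iff h1 w).1 h)
        rw [norm_eq_absNorm_pow h1] at hvv
        have h6 : ‖(t : Af F) w‖ = (w.asIdeal.absNorm : ℝ) *
            ((w.asIdeal.absNorm : ℝ) ^ ordNat (uniformizer w * t) w)⁻¹ := by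
          rw [hvv, mul_inv_cancel_left₀ (by positivity)]
        rw [h6, ← div_eq_mul_inv, div_le_one (by positivity)]
        exact le_self_pow₀ hq.le h5
      · rw [← hw w h]; exact mem_integralAdeles.1 h1 w
    · rw [← hw w (fun h => hv (h ▸ hwS))]; exact h2 w hwS
  · rintro ⟨h1, h2⟩
    have hlt : ‖((uniformizer v * t : (Af F)ˣ) : Af F) v‖ < 1 := by
      rw [hvv]
      exact mul_lt_one_of_nonneg_of_lt_one_left (by positivity) (inv_lt_one_of_one_lt₀ hq)
        (mem_integralAdeles.1 h1 v)
    refine ⟨⟨mem_integralAdeles.2 fun w => ?_, fun w hwS => ?_⟩, fun h => ?_⟩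
    · by_cases h : w = v
      · subst h; exact hlt.le
      · rw [hw w h]; exact mem_integralAdeles.1 h1 w
    · rw [hw w (fun h => hv (h ▸ hwS))]; exact h2 w hwS
    · exact hlt.ne (h.2 v (Set.mem_insert v S))

/-- Let `J(S)` be the integral over the integral ideles which are units on `S`, and `T` the set of
places dividing `N`. Translating by `π_v` gives `J(S ∪ {v}) = (1 - x_v) J(S)`, where `x_v` is the
parameter in the Euler factor. As `S` exhausts the places, `J(S)` tends to the volume of `Ô^×`. So
the products of the `1 - x_v`, multiplied by `J(T)`, converge to a non-zero number, which yields
convergence, non-vanishing and the value of `J(T)` at once. -/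
theorem exists_eulerProduct {N : ℕ} (hN : N ≠ 0) {k : ℕ} (hk : 2 ≤ k) (θ : (Af F)ˣ →* ℂˣ)
    (hθ : ∀ u ∈ unitLevel F N, θ u = 1) (hθ' : ∀ t, ‖(θ t : ℂ)‖ = 1) :
    ∃ L : ℂ, L ≠ 0 ∧ HasProd (fun v : {v : HeightOneSpectrum (𝓞 F) // (N : 𝓞 F) ∉ v.asIdeal} =>
        (1 - (θ (uniformizer (v : HeightOneSpectrum (𝓞 F))) : ℂ) *
          ((v.1.asIdeal.absNorm : ℂ) ^ k)⁻¹)⁻¹) L ∧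
      ∫ t in integralIdelesAway {v : HeightOneSpectrum (𝓞 F) | (N : 𝓞 F) ∈ v.asIdeal},
        (θ (awayPart N t) : ℂ) * (finNorm F t : ℂ) ^ k ∂mulMeasure F =
          (1 / √|(discr F : ℝ)| : ℝ) * L := by
  classical
  set T : Set (HeightOneSpectrum (𝓞 F)) := {v | (N : 𝓞 F) ∈ v.asIdeal} with hT
  set h : (Af F)ˣ → ℂ := fun t => (θ (awayPart N t) : ℂ) * (finNorm F t : ℂ) ^ k with hh
  have hcont : Continuous h := by
    have h1 : IsLocallyConstant (θ.comp (awayPart N)) := isLocallyConstant_of_trivial_on _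
      (integralUnits F) (isOpen_integralUnits F) fun u hu => hθ _ (awayPart_mem_unitLevel hN hu)
    exact (h1.comp (fun u : ℂˣ => (u : ℂ))).continuous.mul
      ((Complex.continuous_ofReal.comp continuous_finNorm).pow k)
  have hnorm : ∀ t, ‖h t‖ = finNorm F t ^ k := fun t => by
    rw [hh]
    simp only [norm_mul, norm_pow, hθ', one_mul, Complex.norm_real,
      Real.norm_of_nonneg (finNorm_pos t).le]
  have hint : IntegrableOn h (integralIdeles F) (mulMeasure F) :=
    (integrableOn_finNorm_pow hk).mono' hcont.aestronglyMeasurable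
      (Eventually.of_forall fun t => (hnorm t).le)
  have hint' : ∀ S, IntegrableOn h (integralIdelesAway S) (mulMeasure F) := fun S =>
    hint.mono_set fun t ht => ht.1
  let x : HeightOneSpectrum (𝓞 F) → ℂ := fun v =>
    (θ (uniformizer v) : ℂ) * ((v.asIdeal.absNorm : ℂ) ^ k)⁻¹
  let J : Set (HeightOneSpectrum (𝓞 F)) → ℂ := fun S =>
    ∫ t in integralIdelesAway S, h t ∂mulMeasure F
  have hshift : ∀ v ∉ T, ∀ t, h (uniformizer v * t) = x v * h t := by
    intro v hv t
    have h1 : awayPart N (uniformizer v) = uniformizer v := by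
      refine Units.ext (FiniteAdeleRing.ext F fun w => ?_)
      by_cases hw : (N : 𝓞 F) ∈ w.asIdeal
      · rw [awayPart_apply_of_mem N hw, uniformizer_apply_of_ne]
        rintro rfl; exact hv hw
      · rw [awayPart_apply_of_notMem N hw]
    simp only [hh, x, map_mul, h1, finNorm_mul, finNorm_uniformizer, Units.val_mul]
    push_cast
    rw [mul_pow, inv_pow]
    ring
  have hstep : ∀ S v, v ∉ S → v ∉ T → J (insert v S) = (1 - x v) * J S := by
    intro S v hvS hvT
    have h1 : J S = J (insert v S) + x v * J S := by
      have hsub : integralIdelesAway (insert v S) ⊆ integralIdelesAway S := fun t ht =>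
        ⟨ht.1, fun w hw => ht.2 w (Set.mem_insert_of_mem _ hw)⟩
      have h2 := integral_inter_add_sdiff (s := integralIdelesAway S)
        (measurableSet_integralIdelesAway (insert v S)) (hint' S)
      rw [Set.inter_eq_right.2 hsub] at h2
      simp only [J]
      rw [← h2]
      congr 1
      rw [h2, ← integral_indicator ((measurableSet_integralIdelesAway _).diff
        (measurableSet_integralIdelesAway _)), ← integral_mul_left_mulMeasure _ (uniformizer v),
        ← integral_const_mul, ← integral_indicator (measurableSet_integralIdelesAway _)]
      congr 1
      funext t
      by_cases ht : t ∈ integralIdelesAway S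
      · rw [Set.indicator_of_mem ht, Set.indicator_of_mem
          (by exact (mul_uniformizer_mem_iff hvS t).2 ht), hshift v hvT]
      · rw [Set.indicator_of_notMem ht, Set.indicator_of_notMem
          (s := integralIdelesAway S \ integralIdelesAway (insert v S))
          (fun h => ht ((mul_uniformizer_mem_iff hvS t).1 h))]
    linear_combination -h1
  let P := {v : HeightOneSpectrum (𝓞 F) // (N : 𝓞 F) ∉ v.asIdeal}
  have hprod : ∀ S : Finset P, J (T ∪ Subtype.val '' (S : Set P)) =
      (∏ v ∈ S, (1 - x v.1)) * J T := by
    intro S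
    induction S using Finset.induction_on with
    | empty => simp
    | insert v S hv ih =>
      rw [Finset.prod_insert hv, mul_assoc, ← ih, ← hstep _ v.1 _ v.2, Finset.coe_insert,
        Set.image_insert_eq, Set.union_insert]
      rintro (h | ⟨w, hw, hwv⟩)
      · exact v.2 h
      · exact hv (by rwa [← Subtype.ext hwv])
  -- Dominated convergence: a given idele is a non-unit at finitely many places only, so its
  -- indicator values are eventually constant and equal to that of `Ô^×`.
  have hlim : Tendsto (fun S : Finset P => J (T ∪ Subtype.val '' (S : Set P))) atTop
      (𝓝 ((1 / √|(discr F : ℝ)| : ℝ) : ℂ)) := by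
    have hval : ∫ t, (integralUnits F : Set (Af F)ˣ).indicator h t ∂mulMeasure F =
        ((1 / √|(discr F : ℝ)| : ℝ) : ℂ) := by
      rw [integral_indicator (isOpen_integralUnits F).measurableSet,
        setIntegral_congr_fun (isOpen_integralUnits F).measurableSet (g := fun _ => (1 : ℂ)),
        setIntegral_const, Measure.real, mulMeasure_integralUnits,
        ENNReal.toReal_ofReal (by positivity)]
      · simp
      · intro t ht
        simp [hh, hθ _ (awayPart_mem_unitLevel hN ht), finNorm_eq_one ht]
    rw [← hval]
    simp only [J, ← integral_indicator (measurableSet_integralIdelesAway _)]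
    refine tendsto_integral_filter_of_dominated_convergence
      (fun t => (integralIdeles F).indicator (fun t => finNorm F t ^ k) t)
      (Eventually.of_forall fun S => (hcont.aestronglyMeasurable).indicator
        (measurableSet_integralIdelesAway _)) (Eventually.of_forall fun S =>
        Eventually.of_forall fun t => ?_) ((integrable_indicator_iff
        measurableSet_integralIdeles).2 (integrableOn_finNorm_pow hk))
      (Eventually.of_forall fun t => ?_)
    · by_cases ht : t ∈ integralIdelesAway (T ∪ Subtype.val '' (S : Set P))
      · rw [Set.indicator_of_mem ht, Set.indicator_of_mem ht.1, hnorm]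
      · rw [Set.indicator_of_notMem ht, norm_zero]
        exact Set.indicator_nonneg (fun t _ => pow_nonneg (finNorm_pos t).le k) t
    · refine tendsto_const_nhds.congr' ?_
      have hfin : {v : P | ¬ ‖(t : Af F) v.1‖ = 1}.Finite :=
        Set.Finite.preimage (f := (Subtype.val : P → HeightOneSpectrum (𝓞 F)))
          Subtype.val_injective.injOn (Af.unit_eventually t)
      filter_upwards [eventually_ge_atTop hfin.toFinset] with S hS
      have : t ∈ (integralUnits F : Set (Af F)ˣ) ↔
          t ∈ integralIdelesAway (T ∪ Subtype.val '' (S : Set P)) := by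
        refine ⟨fun ht => ⟨ht.1, fun v _ => mem_integralUnits.1 ht v⟩, fun ht =>
          mem_integralUnits.2 fun v => ?_⟩
        by_cases hv : (N : 𝓞 F) ∈ v.asIdeal
        · exact ht.2 v (Or.inl hv)
        · by_contra h1
          exact h1 (ht.2 v (Or.inr ⟨⟨v, hv⟩, hS (by simpa using h1), rfl⟩))
      by_cases ht : t ∈ (integralUnits F : Set (Af F)ˣ)
      · rw [Set.indicator_of_mem ht, Set.indicator_of_mem (this.1 ht)]
      · rw [Set.indicator_of_notMem ht, Set.indicator_of_notMem fun h => ht (this.2 h)]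
  have hc : ((1 / √|(discr F : ℝ)| : ℝ) : ℂ) ≠ 0 := by
    have := abs_discr_pos (F := F)
    exact_mod_cast (by positivity : (0 : ℝ) < 1 / √|(discr F : ℝ)|).ne'
  simp only [hprod] at hlim
  -- If `J T` vanished, so would the limit, which is the volume of `Ô^×`.
  have hJ : J T ≠ 0 := by
    intro h0
    simp only [h0, mul_zero] at hlim
    exact hc (tendsto_nhds_unique hlim tendsto_const_nhds)
  have hlim' : Tendsto (fun S : Finset P => ∏ v ∈ S, (1 - x v.1)) atTop
      (𝓝 (((1 / √|(discr F : ℝ)| : ℝ) : ℂ) / J T)) := by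
    refine (hlim.div_const (J T)).congr fun S => ?_
    rw [mul_div_cancel_right₀ _ hJ]
  -- The inverse of the limit of the products of the `1 - x_v`.
  refine ⟨J T / ((1 / √|(discr F : ℝ)| : ℝ) : ℂ), div_ne_zero hJ hc, ?_, ?_⟩
  · have h1 := hlim'.inv₀ (div_ne_zero hc hJ)
    rw [inv_div] at h1
    refine Tendsto.congr (fun S => ?_) h1
    exact (Finset.prod_inv_distrib _).symm
  · exact (mul_div_cancel₀ _ hc).symm

end

/-! ### The additive character, the inverse different and self-duality of the measure. -/

section

variable {F : Type*} [Field F] [NumberField F]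

/-! ### The additive character -/

theorem exists_sub_mem_integralAdeles (x : Af F) :
    ∃ a : F, x - algebraMap F (Af F) a ∈ integralAdeles F := by
  obtain ⟨a, ha⟩ := exists_field_sub_le x 1
  exact ⟨a, mem_integralAdeles.2 fun v => (ha v).trans_eq (by simp)⟩

theorem exp_rat_eq_one_iff (q : ℚ) :
    Complex.exp (2 * Real.pi * Complex.I * (q : ℂ)) = 1 ↔ ∃ n : ℤ, (n : ℚ) = q := by
  rw [Complex.exp_eq_one_iff]
  refine exists_congr fun n => ?_
  rw [mul_comm (n : ℂ), mul_right_inj' Complex.two_pi_I_ne_zero, eq_comm]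
  exact_mod_cast Iff.rfl

theorem exists_int_eq_trace (b : 𝓞 F) : ∃ n : ℤ, (n : ℚ) = Algebra.trace ℚ F (b : F) :=
  IsIntegrallyClosed.isIntegral_iff.1 (Algebra.isIntegral_trace b.isIntegral_coe)

/-- Two admissible choices of `a` differ by an element of `𝓞 F`, and its trace is a rational
integer. Thus the value does not depend on the choice made in the definition. -/
theorem adelicChar_eq {x : Af F} {a : F} (h : x - algebraMap F (Af F) a ∈ integralAdeles F) :
    adelicChar F x =
      Complex.exp (2 * Real.pi * Complex.I * ((Algebra.trace ℚ F a : ℚ) : ℂ)) := by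
  have h' : ∃ a : F, x - algebraMap F (Af F) a ∈ integralAdeles F := ⟨a, h⟩
  rw [adelicChar, dif_pos h']
  have h1 : algebraMap F (Af F) (h'.choose - a) ∈ integralAdeles F := by
    have := sub_mem h h'.choose_spec
    rw [map_sub]
    convert this using 1
    ring
  obtain ⟨b, hb⟩ := mem_integers_of_algebraMap_mem h1
  have h2 := (exp_rat_eq_one_iff (Algebra.trace ℚ F (b : F))).2 (exists_int_eq_trace b)
  rw [hb, map_sub, Rat.cast_sub, mul_sub, Complex.exp_sub,
    div_eq_one_iff_eq (Complex.exp_ne_zero _)] at h2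
  exact h2

theorem adelicChar_add (x y : Af F) : adelicChar F (x + y) = adelicChar F x * adelicChar F y := by
  obtain ⟨a, ha⟩ := exists_sub_mem_integralAdeles x
  obtain ⟨b, hb⟩ := exists_sub_mem_integralAdeles y
  have hab : x + y - algebraMap F (Af F) (a + b) ∈ integralAdeles F := by
    rw [map_add, add_sub_add_comm]; exact add_mem ha hb
  rw [adelicChar_eq ha, adelicChar_eq hb, adelicChar_eq hab, ← Complex.exp_add, map_add,
    Rat.cast_add, mul_add]

theorem adelicChar_of_mem {x : Af F} (h : x ∈ integralAdeles F) : adelicChar F x = 1 := by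
  rw [adelicChar_eq (a := 0) (by simpa using h)]; simp

@[simp] theorem adelicChar_zero : adelicChar F 0 = 1 := adelicChar_of_mem (zero_mem _)

theorem adelicChar_algebraMap (a : F) : adelicChar F (algebraMap F (Af F) a) =
    Complex.exp (2 * Real.pi * Complex.I * ((Algebra.trace ℚ F a : ℚ) : ℂ)) :=
  adelicChar_eq (by simp [zero_mem])

theorem adelicChar_mul_neg (x : Af F) : adelicChar F x * adelicChar F (-x) = 1 := by
  rw [← adelicChar_add, add_neg_cancel, adelicChar_zero]

theorem conj_adelicChar (x : Af F) : starRingEnd ℂ (adelicChar F x) = adelicChar F (-x) := by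
  obtain ⟨a, ha⟩ := exists_sub_mem_integralAdeles x
  have ha' : -x - algebraMap F (Af F) (-a) ∈ integralAdeles F := by
    rw [map_neg, sub_neg_eq_add, neg_add_eq_sub, ← neg_sub]; exact neg_mem ha
  rw [adelicChar_eq ha, adelicChar_eq ha', ← Complex.exp_conj]
  congr 1
  simp [Complex.conj_ofReal, Complex.conj_ofNat]

theorem isLocallyConstant_adelicChar : IsLocallyConstant (adelicChar F) := by
  rw [IsLocallyConstant.iff_eventually_eq]
  intro x
  have h : ∀ᶠ y in 𝓝 x, y - x ∈ integralAdeles F :=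
    (continuous_sub_right x).continuousAt.eventually_mem
      ((isOpen_integralAdeles F).mem_nhds (by simp [zero_mem]))
  refine h.mono fun y hy => ?_
  rw [← sub_add_cancel y x, adelicChar_add, adelicChar_of_mem hy, one_mul]

theorem continuous_adelicChar : Continuous (adelicChar F) := isLocallyConstant_adelicChar.continuous

/-! ### Duality of lattices -/

/-- The orthogonal complement of a subgroup under the pairing given by the additive character. -/
def charDual (Λ : AddSubgroup (Af F)) : AddSubgroup (Af F) where
  carrier := {x | ∀ y ∈ Λ, adelicChar F (x * y) = 1}
  zero_mem' y _ := by simp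
  add_mem' hx hz y hy := by rw [add_mul, adelicChar_add, hx y hy, hz y hy, one_mul]
  neg_mem' {x} hx y hy := by
    have := adelicChar_mul_neg (x * y)
    rw [hx y hy, one_mul] at this
    rw [neg_mul, this]

/-- `Ô` as an additive subgroup. -/
abbrev integralLattice (F : Type*) [Field F] [NumberField F] : AddSubgroup (Af F) :=
  (integralAdeles F).toAddSubgroup

theorem integralLattice_le_charDual : integralLattice F ≤ charDual (integralLattice F) :=
  fun x hx y hy => adelicChar_of_mem (mul_mem (show x ∈ integralAdeles F from hx) hy)

/-- The dual of `𝓞 F` under the trace form. -/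
def traceDual (F : Type*) [Field F] [NumberField F] : Submodule ℤ F :=
  (Algebra.traceForm ℚ F).dualSubmodule (Submodule.span ℤ (Set.range (integralBasis F)))

theorem mem_traceDual {a : F} :
    a ∈ traceDual F ↔ ∀ b : 𝓞 F, ∃ n : ℤ, (n : ℚ) = Algebra.trace ℚ F (a * b) := by
  rw [traceDual, LinearMap.BilinForm.mem_dualSubmodule]
  constructor
  · intro h b
    obtain ⟨n, hn⟩ := Submodule.mem_one.1
      (h (b : F) ((mem_span_integralBasis F).2 ⟨b, rfl⟩))
    exact ⟨n, by simpa using hn⟩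
  · intro h y hy
    obtain ⟨b, rfl⟩ := (mem_span_integralBasis F).1 hy
    obtain ⟨n, hn⟩ := h b
    exact Submodule.mem_one.2 ⟨n, by simpa using hn⟩

/-- Links adelic duality to the inverse different: pairing a field element with `Ô` can be tested on
the subring `𝓞 F`. -/
theorem algebraMap_mem_charDual_iff {a : F} :
    algebraMap F (Af F) a ∈ charDual (integralLattice F) ↔ a ∈ traceDual F := by
  rw [mem_traceDual]
  constructor
  · intro h b
    have := h _ (algebraMap_mem_integralAdeles b)
    rw [← map_mul, adelicChar_algebraMap, exp_rat_eq_one_iff] at this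
    exact this
  · intro h y hy
    -- If `N` clears the denominators of `a`, then `y` may be changed modulo `N Ô` without affecting
    -- the character, hence replaced by an element `b` of `𝓞 F`.
    obtain ⟨N, hN, hNa⟩ := exists_nat_mul_mem (algebraMap F (Af F) a)
    obtain ⟨b, hb⟩ := exists_integer_sub_le_of_mem (x := y) hy (N : 𝓞 F) (Nat.cast_ne_zero.2 hN)
    have hy' : y - algebraMap F (Af F) b ∈ natLattice N hN := mem_natLattice.2 fun v =>
      (hb v).trans_eq (by simp)
    obtain ⟨z, hz, hyz⟩ := mem_natLattice_iff_exists.1 hy'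
    have h1 : algebraMap F (Af F) a * y =
        algebraMap F (Af F) (a * b) + (N * algebraMap F (Af F) a) * z := by
      rw [eq_add_of_sub_eq hyz, map_mul]; ring
    rw [h1, adelicChar_add, adelicChar_of_mem (mul_mem hNa hz), mul_one, adelicChar_algebraMap,
      exp_rat_eq_one_iff]
    exact h b

/-- Since `𝔸_f = F + Ô` and `Ô` is contained in its own dual, the dual is generated by `Ô` and by
the field elements in it. -/
theorem charDual_eq_sup : charDual (integralLattice F) =
    integralLattice F ⊔ (traceDual F).toAddSubgroup.map (algebraMap F (Af F)).toAddMonoidHom := by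
  apply le_antisymm
  · intro x hx
    obtain ⟨a, ha⟩ := exists_sub_mem_integralAdeles x
    rw [← sub_add_cancel x (algebraMap F (Af F) a)]
    refine AddSubgroup.add_mem_sup ha ⟨a, ?_, rfl⟩
    refine algebraMap_mem_charDual_iff.1 ?_
    rw [← sub_sub_cancel x (algebraMap F (Af F) a)]
    exact sub_mem hx (integralLattice_le_charDual ha)
  · refine sup_le integralLattice_le_charDual ?_
    rintro _ ⟨a, ha, rfl⟩
    exact algebraMap_mem_charDual_iff.2 ha

theorem span_integralBasis_eq : (Submodule.span ℤ (Set.range (integralBasis F))).toAddSubgroup =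
    (integralLattice F).comap (algebraMap F (Af F)).toAddMonoidHom := by
  ext a
  refine (mem_span_integralBasis F).trans ⟨?_, fun h => ?_⟩
  · rintro ⟨b, rfl⟩
    exact algebraMap_mem_integralAdeles b
  · obtain ⟨b, hb⟩ := mem_integers_of_algebraMap_mem (a := a) h
    exact ⟨b, hb⟩

/-- The index equals that of `𝓞 F` in its trace dual. The matrix expressing an integral basis in the
dual basis is the trace matrix, whose determinant is the discriminant. -/
theorem relIndex_charDual :
    (integralLattice F).relIndex (charDual (integralLattice F)) = (discr F).natAbs := by
  rw [charDual_eq_sup, sup_comm, AddSubgroup.relIndex_sup_right, ← AddSubgroup.relIndex_comap,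
    ← span_integralBasis_eq]
  let b := integralBasis F
  let b' := (Algebra.traceForm ℚ F).dualBasis (traceForm_nondegenerate ℚ F) b
  qify
  refine (AddSubgroup.relIndex_eq_abs_det _ (traceDual F).toAddSubgroup ?_ b b' ?_ ?_).trans ?_
  · rw [span_integralBasis_eq]
    intro a ha
    exact algebraMap_mem_charDual_iff.1 (integralLattice_le_charDual ha)
  · apply AddSubgroup.toIntSubmodule.injective
    rw [AddSubgroup.toIntSubmodule_closure, Submodule.toIntSubmodule_toAddSubgroup]
    rfl
  · apply AddSubgroup.toIntSubmodule.injective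
    rw [AddSubgroup.toIntSubmodule_closure, ← LinearMap.BilinForm.dualSubmodule_span_of_basis,
      Submodule.toIntSubmodule_toAddSubgroup]
    rfl
  · simp only [Module.Basis.det_apply, discr, Algebra.discr]
    rw [← eq_intCast (algebraMap ℤ ℚ), RingHom.map_det]
    congr! 2
    ext i j
    simp [b', Module.Basis.toMatrix_apply, mul_comm (RingOfIntegers.basis F i),
      b, integralBasis_apply, ← map_mul, Algebra.trace_localization ℤ (nonZeroDivisors ℤ)]

/-- Modulo `Ô` it is enough to treat field elements, for which this is the double dual of a lattice
under the non-degenerate trace form. -/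
theorem charDual_charDual_integralLattice :
    charDual (charDual (integralLattice F)) = integralLattice F := by
  refine le_antisymm (fun x hx => ?_) fun x hx y hy => ?_
  · obtain ⟨a, ha⟩ := exists_sub_mem_integralAdeles x
    have h1 : algebraMap F (Af F) a ∈ charDual (charDual (integralLattice F)) := by
      rw [← sub_sub_cancel x (algebraMap F (Af F) a)]
      refine sub_mem hx fun y hy => ?_
      rw [mul_comm]
      exact hy _ ha
    have h2 : a ∈ (Algebra.traceForm ℚ F).dualSubmodule (traceDual F) := by
      rw [LinearMap.BilinForm.mem_dualSubmodule]
      intro y hy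
      have := h1 _ (algebraMap_mem_charDual_iff.2 hy)
      rw [← map_mul, adelicChar_algebraMap, exp_rat_eq_one_iff] at this
      obtain ⟨n, hn⟩ := this
      exact Submodule.mem_one.2 ⟨n, by simpa using hn⟩
    rw [traceDual, LinearMap.BilinForm.dualSubmodule_dualSubmodule_of_basis _
      (traceForm_nondegenerate ℚ F) (Algebra.traceForm_isSymm ℚ)] at h2
    obtain ⟨b, rfl⟩ := (mem_span_integralBasis F).1 h2
    rw [← sub_add_cancel x (algebraMap F (Af F) (algebraMap (𝓞 F) F b))]
    exact add_mem ha (algebraMap_mem_integralAdeles b)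
  · rw [mul_comm]
    exact hy _ hx

theorem mem_charDual_lattice {t : (Af F)ˣ} {x : Af F} :
    x ∈ charDual (lattice t) ↔ (t : Af F) * x ∈ charDual (integralLattice F) := by
  constructor
  · intro h y hy
    have := h (t * y) (inv_mul_mem_iff.1 (by rwa [Units.inv_mul_cancel_left]))
    rwa [mul_comm (t : Af F), mul_assoc]
  · intro h y hy
    have := h (((t⁻¹ : (Af F)ˣ) : Af F) * y) (inv_mul_mem_iff.2 hy)
    rwa [mul_mul_mul_comm, Units.mul_inv, one_mul] at this

theorem charDual_charDual_lattice (t : (Af F)ˣ) : charDual (charDual (lattice t)) = lattice t := by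
  refine le_antisymm (fun x hx => ?_) fun x hx y hy => ?_
  · rw [← inv_mul_mem_iff]
    have : ((t⁻¹ : (Af F)ˣ) : Af F) * x ∈ charDual (charDual (integralLattice F)) := by
      intro y hy
      have := hx (((t⁻¹ : (Af F)ˣ) : Af F) * y) (mem_charDual_lattice.2 (by simpa using hy))
      rwa [mul_left_comm, ← mul_assoc] at this
    rw [charDual_charDual_integralLattice] at this
    exact this
  · rw [mul_comm]
    exact hy _ hx

theorem isOpen_charDual_integralLattice : IsOpen (charDual (integralLattice F) : Set (Af F)) :=
  AddSubgroup.isOpen_mono integralLattice_le_charDual (isOpen_integralAdeles F)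

/-- The quotient of the dual by `Ô` is killed by its order `|disc F|`, so the dual is a closed
subset of the compact lattice `|disc F|⁻¹ Ô`. -/
theorem isCompact_charDual_integralLattice :
    IsCompact (charDual (integralLattice F) : Set (Af F)) := by
  have hd : (discr F).natAbs ≠ 0 := Int.natAbs_ne_zero.2 (discr_ne_zero F)
  have h : (charDual (integralLattice F) : Set (Af F)) ⊆
      (lattice (Af.natUnit (discr F).natAbs hd)⁻¹ : AddSubgroup (Af F)) := by
    intro x hx
    rw [SetLike.mem_coe, ← inv_mul_mem_iff, inv_inv, Af.coe_natUnit]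
    have := AddSubgroup.nsmul_index_mem ((integralLattice F).addSubgroupOf
      (charDual (integralLattice F))) ⟨x, hx⟩
    rw [← AddSubgroup.relIndex, relIndex_charDual, AddSubgroup.mem_addSubgroupOf,
      AddSubgroup.coe_nsmul, nsmul_eq_mul] at this
    exact this
  exact (isCompact_lattice _).of_isClosed_subset
    (AddSubgroup.isClosed_of_isOpen _ isOpen_charDual_integralLattice) h

/-! ### The additive Haar measure -/

instance : LocallyCompactSpace (Af F) :=
  (isCompact_integralAdeles F).locallyCompactSpace_of_mem_nhds_of_addGroup
    ((isOpen_integralAdeles F).mem_nhds (zero_mem _))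

theorem discr_constant_ne_zero : ENNReal.ofReal (1 / √|(discr F : ℝ)|) ≠ 0 := by
  have := abs_discr_pos (F := F)
  exact (ENNReal.ofReal_pos.2 (by positivity)).ne'

instance : (addMeasure F).IsAddHaarMeasure :=
  Measure.IsAddHaarMeasure.smul _ discr_constant_ne_zero ENNReal.ofReal_ne_top

instance : (addMeasure F).Regular := Measure.Regular.smul ENNReal.ofReal_ne_top

theorem addMeasure_integralAdeles :
    addMeasure F (integralAdeles F) = ENNReal.ofReal (1 / √|(discr F : ℝ)|) := by
  have h := Measure.addHaarMeasure_self (K₀ := (⟨⟨integralAdeles F, isCompact_integralAdeles F⟩,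
      ⟨0, (isOpen_integralAdeles F).interior_eq.symm ▸ (integralAdeles F).zero_mem⟩⟩ :
        TopologicalSpace.PositiveCompacts (Af F)))
  rw [addMeasure, Measure.smul_apply, smul_eq_mul]
  exact (congrArg _ h).trans (mul_one _)

theorem relIndex_mul_measure {G : Type*} [AddGroup G] [MeasurableSpace G] [MeasurableAdd G]
    {H K : AddSubgroup G} (hHK : H ≤ K) (h : H.relIndex K ≠ 0) (hH : MeasurableSet (H : Set G))
    (hK : MeasurableSet (K : Set G)) (μ : Measure G) [μ.IsAddLeftInvariant] :
    H.relIndex K * μ H = μ K := by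
  have : (H.addSubgroupOf K).FiniteIndex := ⟨h⟩
  have he : MeasurableEmbedding ((↑) : K → G) := MeasurableEmbedding.subtype_coe hK
  have : MeasurableAdd K :=
    ⟨fun c => ((measurable_const_add (c : G)).comp measurable_subtype_coe).subtype_mk,
      fun c => ((measurable_add_const (c : G)).comp measurable_subtype_coe).subtype_mk⟩
  have := Measure.IsAddLeftInvariant.comap μ (f := K.subtype) he
  have h1 := (H.addSubgroupOf K).index_mul_measure (he.measurable hH) (μ.comap K.subtype)
  have he' : MeasurableEmbedding K.subtype := he
  rw [he'.comap_apply, he'.comap_apply] at h1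
  have h2 : K.subtype '' ((H.addSubgroupOf K : AddSubgroup K) : Set K) = H := by
    ext x
    exact ⟨by rintro ⟨y, hy, rfl⟩; exact hy, fun hx => ⟨⟨x, hHK hx⟩, hx, rfl⟩⟩
  have h3 : K.subtype '' Set.univ = K := by simp
  rw [h2, h3] at h1
  exact h1

theorem addMeasure_charDual_integralLattice :
    addMeasure F (charDual (integralLattice F)) = ENNReal.ofReal √|(discr F : ℝ)| := by
  have hd : (discr F).natAbs ≠ 0 := Int.natAbs_ne_zero.2 (discr_ne_zero F)
  have h := relIndex_mul_measure (integralLattice_le_charDual (F := F))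
    (by rwa [relIndex_charDual]) (isOpen_integralAdeles F).measurableSet
    isOpen_charDual_integralLattice.measurableSet (addMeasure F)
  have h1 := addMeasure_integralAdeles (F := F)
  rw [← h, relIndex_charDual]
  refine (congrArg _ h1).trans ?_
  rw [← ENNReal.ofReal_natCast, ← ENNReal.ofReal_mul (Nat.cast_nonneg _), Nat.cast_natAbs,
    Int.cast_abs]
  congr 1
  rw [mul_one_div, Real.div_sqrt]

open Pointwise in
theorem smul_integralLattice (t : (Af F)ˣ) :
    t • (integralLattice F : Set (Af F)) = lattice t := by
  ext x
  rw [Set.mem_smul_set_iff_inv_smul_mem]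
  exact inv_mul_mem_iff

open Pointwise in
theorem smul_charDual_lattice (t : (Af F)ˣ) :
    t • (charDual (lattice t) : Set (Af F)) = charDual (integralLattice F) := by
  ext x
  rw [Set.mem_smul_set_iff_inv_smul_mem, SetLike.mem_coe, mem_charDual_lattice, Units.smul_def,
    smul_eq_mul, Units.mul_inv_cancel_left]
  rfl

theorem isOpen_charDual_lattice (t : (Af F)ˣ) : IsOpen (charDual (lattice t) : Set (Af F)) := by
  have : (charDual (lattice t) : Set (Af F)) =
      (fun x => (t : Af F) * x) ⁻¹' charDual (integralLattice F) :=
    Set.ext fun x => mem_charDual_lattice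
  rw [this]
  exact isOpen_charDual_integralLattice.preimage (continuous_const_mul _)

theorem isCompact_charDual_lattice (t : (Af F)ˣ) :
    IsCompact (charDual (lattice t) : Set (Af F)) := by
  have : (charDual (lattice t) : Set (Af F)) =
      (Homeomorph.smul t) ⁻¹' charDual (integralLattice F) :=
    Set.ext fun x => mem_charDual_lattice
  rw [this]
  exact (Homeomorph.smul t).isCompact_preimage.2 isCompact_charDual_integralLattice

/-- Multiplication by `t` scales `t Ô` and its dual in opposite directions, so the product of
volumes does not depend on `t`. For `Ô` it is `d_F^{-1/2} · d_F^{1/2} = 1`: the normalization of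
`dx` makes the measure self-dual. -/
theorem addMeasure_lattice_mul_charDual (t : (Af F)ˣ) :
    addMeasure F (lattice t) * addMeasure F (charDual (lattice t)) = 1 := by
  have h1 := distribHaarChar_mul (addMeasure F) t (integralLattice F : Set (Af F))
  have h2 := distribHaarChar_mul (addMeasure F) t (charDual (lattice t) : Set (Af F))
  rw [smul_integralLattice] at h1
  rw [smul_charDual_lattice, addMeasure_charDual_integralLattice] at h2
  have h0 : addMeasure F (integralLattice F : Set (Af F)) = _ := addMeasure_integralAdeles
  rw [← h1, h0, mul_right_comm, h2, ← ENNReal.ofReal_mul (by positivity)]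
  have := abs_discr_pos (F := F)
  rw [mul_one_div_cancel (by positivity), ENNReal.ofReal_one]

theorem measureReal_lattice_mul_charDual (t : (Af F)ˣ) :
    (addMeasure F).real (lattice t) * (addMeasure F).real (charDual (lattice t)) = 1 := by
  rw [Measure.real, Measure.real, ← ENNReal.toReal_mul, addMeasure_lattice_mul_charDual,
    ENNReal.toReal_one]

/-- Multiplication by `z` preserves `Ô`, which has positive finite volume; so its modulus is `1`. -/
theorem integral_mul_left_addMeasure {E : Type*} [NormedAddCommGroup E] [NormedSpace ℝ E]
    (h : Af F → E) {z : (Af F)ˣ} (hz : z ∈ integralUnits F) :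
    ∫ x, h (z * x) ∂addMeasure F = ∫ x, h x ∂addMeasure F := by
  have h0 : distribHaarChar (Af F) z = 1 := by
    refine distribHaarChar_eq_of_measure_smul_eq_mul (μ := addMeasure F)
      (s := (integralLattice F : Set (Af F))) ?_ ?_ ?_
    · exact addMeasure_integralAdeles.trans_ne discr_constant_ne_zero
    · exact addMeasure_integralAdeles.trans_ne ENNReal.ofReal_ne_top
    · rw [smul_integralLattice, ENNReal.coe_one, one_mul]
      congr 1
      ext x
      have h1 := mem_integralUnits.1 hz
      simp only [SetLike.mem_coe, mem_lattice, h1]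
      exact mem_integralAdeles.symm
  have h1 : MeasurePreserving (fun x : Af F => (z : Af F) * x) (addMeasure F) (addMeasure F) := by
    refine ⟨(continuous_const_mul _).measurable, Measure.ext fun s hs => ?_⟩
    rw [Measure.map_apply (continuous_const_mul _).measurable hs]
    have h2 := distribHaarChar_mul (addMeasure F) z ((fun x : Af F => (z : Af F) * x) ⁻¹' s)
    rw [h0, ENNReal.coe_one, one_mul] at h2
    rw [h2]
    congr 1
    ext x
    rw [Set.mem_smul_set_iff_inv_smul_mem, Set.mem_preimage, Units.smul_def, smul_eq_mul,
      Units.mul_inv_cancel_left]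
  exact h1.integral_comp (Homeomorph.smul z).measurableEmbedding h

end

/-! ### Schwartz-Bruhat functions and Fourier inversion. -/

section

variable {F : Type*} [Field F] [NumberField F]

/-! ### Schwartz-Bruhat functions -/

/-- Schwartz-Bruhat functions: locally constant functions with compact support. -/
structure IsSchwartzBruhat {X : Type*} [TopologicalSpace X] (φ : X → ℂ) : Prop where
  isLocallyConstant : IsLocallyConstant φ
  hasCompactSupport : HasCompactSupport φ

theorem IsSchwartzBruhat.continuous {X : Type*} [TopologicalSpace X] {φ : X → ℂ}
    (h : IsSchwartzBruhat φ) : Continuous φ := h.1.continuous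

theorem IsSchwartzBruhat.add {X : Type*} [TopologicalSpace X] {φ ψ : X → ℂ}
    (h : IsSchwartzBruhat φ) (h' : IsSchwartzBruhat ψ) : IsSchwartzBruhat (φ + ψ) :=
  ⟨h.1.add h'.1, h.2.add h'.2⟩

theorem IsSchwartzBruhat.zero {X : Type*} [TopologicalSpace X] :
    IsSchwartzBruhat (0 : X → ℂ) :=
  ⟨IsLocallyConstant.const 0, HasCompactSupport.zero⟩

theorem IsSchwartzBruhat.const_mul {X : Type*} [TopologicalSpace X] {φ : X → ℂ}
    (h : IsSchwartzBruhat φ) (c : ℂ) : IsSchwartzBruhat fun x => c * φ x :=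
  ⟨h.1.comp (c * ·), h.2.mul_left (f := fun _ => c)⟩

theorem IsSchwartzBruhat.mul {X : Type*} [TopologicalSpace X] {φ ψ : X → ℂ}
    (h : IsSchwartzBruhat φ) (h' : IsLocallyConstant ψ) : IsSchwartzBruhat fun x => φ x * ψ x :=
  ⟨h.1.mul h', h.2.mul_right⟩

theorem isLocallyConstant_indicator {X : Type*} [TopologicalSpace X] {s : Set X} (hs : IsClopen s) :
    IsLocallyConstant (s.indicator (1 : X → ℂ)) := by
  rw [IsLocallyConstant.iff_eventually_eq]
  intro x
  by_cases hx : x ∈ s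
  · filter_upwards [hs.isOpen.mem_nhds hx] with y hy
    simp [hx, hy]
  · filter_upwards [hs.compl.isOpen.mem_nhds hx] with y hy
    rw [Set.indicator_of_notMem hx, Set.indicator_of_notMem hy]

/-- The vectors all of whose coordinates are in `Λ`. -/
def box (Λ : AddSubgroup (Af F)) : AddSubgroup (Fin 2 → Af F) := AddSubgroup.pi Set.univ fun _ => Λ

theorem mem_box {Λ : AddSubgroup (Af F)} {v : Fin 2 → Af F} : v ∈ box Λ ↔ ∀ i, v i ∈ Λ := by
  simp [box, AddSubgroup.mem_pi]

theorem coe_box (Λ : AddSubgroup (Af F)) :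
    (box Λ : Set (Fin 2 → Af F)) = Set.univ.pi fun _ => (Λ : Set (Af F)) := by
  ext v; simp [mem_box]

theorem isOpen_box {Λ : AddSubgroup (Af F)} (h : IsOpen (Λ : Set (Af F))) :
    IsOpen (box Λ : Set (Fin 2 → Af F)) := by
  rw [coe_box]; exact isOpen_set_pi Set.finite_univ fun _ _ => h

theorem isCompact_box {Λ : AddSubgroup (Af F)} (h : IsCompact (Λ : Set (Af F))) :
    IsCompact (box Λ : Set (Fin 2 → Af F)) := by
  rw [coe_box]; exact isCompact_univ_pi fun _ => h

/-- The function `v ↦ ψ(p₀ v₀ + p₁ v₁)` on the box `c + Λ²`. -/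
def wave (Λ : AddSubgroup (Af F)) (c p v : Fin 2 → Af F) : ℂ :=
  (Λ : Set (Af F)).indicator 1 (v 0 - c 0) * (Λ : Set (Af F)).indicator 1 (v 1 - c 1) *
    adelicChar F (p 0 * v 0 + p 1 * v 1)

theorem wave_zero (Λ : AddSubgroup (Af F)) (c v : Fin 2 → Af F) :
    wave Λ c 0 v = ((box Λ : Set (Fin 2 → Af F)).indicator 1 (v - c) : ℂ) := by
  classical
  simp only [wave, Pi.zero_apply, zero_mul, add_zero, adelicChar_zero, mul_one,
    Set.indicator_apply, SetLike.mem_coe, mem_box, Fin.forall_fin_two, Pi.sub_apply, Pi.one_apply]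
  split_ifs <;> simp_all

theorem isSchwartzBruhat_wave {Λ : AddSubgroup (Af F)} (h : IsOpen (Λ : Set (Af F)))
    (h' : IsCompact (Λ : Set (Af F))) (c p : Fin 2 → Af F) : IsSchwartzBruhat (wave Λ c p) := by
  have hb : IsSchwartzBruhat (wave Λ c 0) := by
    have h1 : wave Λ c 0 = ((Homeomorph.subRight c) ⁻¹' (box Λ : Set (Fin 2 → Af F))).indicator 1 :=
      funext fun v => (wave_zero Λ c v).trans rfl
    have hc : IsClosed (box Λ : Set (Fin 2 → Af F)) := (isCompact_box h').isClosed
    rw [h1]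
    refine ⟨isLocallyConstant_indicator ⟨hc.preimage (Homeomorph.subRight c).continuous,
      (isOpen_box h).preimage (Homeomorph.subRight c).continuous⟩, ?_⟩
    refine HasCompactSupport.of_support_subset_isCompact
      ((Homeomorph.subRight c).isCompact_preimage.2 (isCompact_box h')) ?_
    exact Set.support_indicator_subset
  have := hb.mul (ψ := fun v => adelicChar F (p 0 * v 0 + p 1 * v 1))
    (isLocallyConstant_adelicChar.comp_continuous (by fun_prop))
  convert this using 2 with v
  simp [wave]

/-- A Schwartz-Bruhat function on `𝔸_f²` is invariant under a lattice. -/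
theorem IsSchwartzBruhat.exists_level {φ : (Fin 2 → Af F) → ℂ} (h : IsSchwartzBruhat φ) :
    ∃ (N : ℕ) (hN : N ≠ 0), ∀ v, ∀ w ∈ box (natLattice N hN), φ (v + w) = φ v := by
  -- The pairs `(v, w)` that violate invariance, with `v` in the support and `w` in `N V(Ô)`, form
  -- compact sets, decreasing for divisibility, with empty intersection. Hence one of these sets is
  -- empty.
  obtain ⟨N, hN, hV⟩ := exists_subset_of_iInter_subset
    (fun N => {x : (Fin 2 → Af F) × (Fin 2 → Af F) | x.1 ∈ tsupport φ ∧
      (∀ i v, ‖x.2 i v‖ ≤ ‖(N : v.adicCompletion F)‖) ∧ φ (x.1 + x.2) ≠ φ x.1})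
    (fun N hN => by
      have hb : IsCompact (box (natLattice (F := F) N hN) : Set (Fin 2 → Af F)) :=
        isCompact_box (isCompact_lattice _)
      have hc := h.2.isCompact.prod hb
      have ho : IsOpen {x : (Fin 2 → Af F) × (Fin 2 → Af F) | φ (x.1 + x.2) = φ x.1} := by
        have : IsLocallyConstant fun x : (Fin 2 → Af F) × (Fin 2 → Af F) =>
            φ (x.1 + x.2) - φ x.1 :=
          (h.1.comp_continuous continuous_add).sub (h.1.comp_continuous continuous_fst)
        convert this.isOpen_fiber 0 using 1
        ext x; exact sub_eq_zero.symm
      convert hc.inter_right ho.isClosed_compl using 1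
      ext x
      simp only [Set.mem_ofPred_eq, Set.mem_inter_iff, Set.mem_prod, SetLike.mem_coe, mem_box,
        mem_natLattice, Set.mem_compl_iff, and_assoc, ne_eq])
    (fun M N _ _ hMN x hx => ⟨hx.1, fun i v => (hx.2.1 i v).trans (norm_natCast_le_of_dvd v hMN),
      hx.2.2⟩)
    isOpen_empty (fun x hx => by
      have h0 : x.2 = 0 := funext fun i => FiniteAdeleRing.ext F fun v =>
        eq_zero_of_norm_le_natCast fun N hN => (hx N hN).2.1 i v
      exact (hx 1 one_ne_zero).2.2 (by rw [h0, add_zero]))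
  have key : ∀ v ∈ tsupport φ, ∀ w ∈ box (natLattice N hN), φ (v + w) = φ v := by
    intro v hv w hw
    by_contra h1
    exact hV (show (v, w) ∈ _ from ⟨hv, fun i => mem_natLattice.1 (mem_box.1 hw i), h1⟩)
  refine ⟨N, hN, fun v w hw => ?_⟩
  by_cases hv : v ∈ tsupport φ
  · exact key v hv w hw
  -- If only `v + w` lies in the support, apply the invariance there to `-w`.
  by_cases hvw : v + w ∈ tsupport φ
  · have := key _ hvw (-w) (neg_mem hw)
    rw [← this, add_neg_cancel_right]
  · rw [image_eq_zero_of_notMem_tsupport hv, image_eq_zero_of_notMem_tsupport hvw]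

/-- A Schwartz-Bruhat function factors through the discrete quotient by a lattice, and there its
support is finite. It is thus a finite combination of indicator functions of cosets, namely of waves
with frequency `0`. -/
theorem IsSchwartzBruhat.induction {P : ((Fin 2 → Af F) → ℂ) → Prop} (h0 : P 0)
    (hadd : ∀ φ ψ, IsSchwartzBruhat φ → IsSchwartzBruhat ψ → P φ → P ψ → P (φ + ψ))
    (hmul : ∀ (c : ℂ) φ, IsSchwartzBruhat φ → P φ → P fun v => c * φ v)
    (hwave : ∀ (t : (Af F)ˣ) c, P (wave (lattice t) c 0))
    {φ : (Fin 2 → Af F) → ℂ} (h : IsSchwartzBruhat φ) : P φ := by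
  classical
  obtain ⟨N, hN, hφ⟩ := h.exists_level
  let Λ : AddSubgroup (Fin 2 → Af F) := box (natLattice N hN)
  have hΛ : IsOpen (Λ : Set (Fin 2 → Af F)) := isOpen_box (isOpen_lattice _)
  have : DiscreteTopology ((Fin 2 → Af F) ⧸ Λ) := QuotientAddGroup.discreteTopology hΛ
  let q : (Fin 2 → Af F) → (Fin 2 → Af F) ⧸ Λ := QuotientAddGroup.mk
  have hfin : (q '' tsupport φ).Finite :=
    (h.2.image QuotientAddGroup.continuous_mk).finite_of_discrete
  have hq : ∀ v, ((v - (q v).out : Fin 2 → Af F)) ∈ Λ := fun v => by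
    rw [sub_eq_neg_add]
    exact QuotientAddGroup.eq.1 (Quotient.out_eq' (q v))
  have hsum : φ = ∑ x ∈ hfin.toFinset, fun v => φ x.out * wave (natLattice N hN) x.out 0 v := by
    funext v
    rw [Finset.sum_apply, Finset.sum_eq_single (q v)]
    · rw [wave_zero, Set.indicator_of_mem (hq v), Pi.one_apply, mul_one]
      conv_lhs => rw [← add_sub_cancel (q v).out v]
      exact hφ _ _ (hq v)
    · intro x _ hx
      rw [wave_zero, Set.indicator_of_notMem, mul_zero]
      intro hm
      apply hx
      rw [← Quotient.out_eq' x]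
      exact QuotientAddGroup.eq.2 (by rw [neg_add_eq_sub]; exact hm)
    · intro hv
      have hv' : v ∉ tsupport φ := fun h1 => hv (hfin.mem_toFinset.2 ⟨v, h1, rfl⟩)
      have : φ (q v).out = φ v := by
        conv_rhs => rw [← add_sub_cancel (q v).out v]
        exact (hφ _ _ (hq v)).symm
      rw [this, image_eq_zero_of_notMem_tsupport hv', zero_mul]
  have hsb : ∀ x : Fin 2 → Af F, IsSchwartzBruhat (wave (natLattice N hN) x 0) := fun x =>
    isSchwartzBruhat_wave (isOpen_lattice (Af.natUnit N hN)) (isCompact_lattice _) x 0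
  rw [hsum]
  have : ∀ s : Finset ((Fin 2 → Af F) ⧸ Λ),
      IsSchwartzBruhat (∑ x ∈ s, fun v => φ x.out * wave (natLattice N hN) x.out 0 v) ∧
      P (∑ x ∈ s, fun v => φ x.out * wave (natLattice N hN) x.out 0 v) := by
    intro s
    induction s using Finset.induction_on with
    | empty => exact ⟨IsSchwartzBruhat.zero, h0⟩
    | insert x s hx ih =>
      rw [Finset.sum_insert hx]
      exact ⟨((hsb _).const_mul _).add ih.1,
        hadd _ _ ((hsb _).const_mul _) ih.1 (hmul _ _ (hsb _) (hwave _ _)) ih.2⟩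
  exact (this _).2

/-! ### The Fourier transform -/

/-- Orthogonality of characters on the compact group `Λ`; the centre `c` only contributes a phase.
-/
theorem integral_indicator_mul_adelicChar {Λ : AddSubgroup (Af F)} (h : IsOpen (Λ : Set (Af F)))
    (h' : IsCompact (Λ : Set (Af F))) (c x : Af F) :
    ∫ b, (Λ : Set (Af F)).indicator 1 (b - c) * adelicChar F (x * b) ∂addMeasure F =
      (addMeasure F).real Λ * (charDual Λ : Set (Af F)).indicator 1 x * adelicChar F (x * c) := by
  rw [← integral_add_right_eq_self _ c]
  simp only [add_sub_cancel_right, mul_add, adelicChar_add, ← mul_assoc]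
  rw [integral_mul_const]
  congr 1
  by_cases hx : x ∈ charDual Λ
  · rw [Set.indicator_of_mem (s := (charDual Λ : Set (Af F))) hx, Pi.one_apply, mul_one]
    have : (fun b => (Λ : Set (Af F)).indicator (1 : Af F → ℂ) b * adelicChar F (x * b)) =
        (Λ : Set (Af F)).indicator 1 := by
      funext b
      by_cases hb : b ∈ Λ
      · rw [hx b hb, mul_one]
      · rw [Set.indicator_of_notMem (s := (Λ : Set (Af F))) hb, zero_mul]
    rw [this, integral_indicator h.measurableSet]
    simp
  · rw [Set.indicator_of_notMem (s := (charDual Λ : Set (Af F))) hx, mul_zero]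
    obtain ⟨y, hy, hxy⟩ : ∃ y ∈ Λ, adelicChar F (x * y) ≠ 1 := by
      by_contra h1; push Not at h1; exact hx h1
    -- Translation by an element `y` of `Λ` at which the character is not `1` multiplies the
    -- integral by that value.
    have h1 := integral_add_right_eq_self (μ := addMeasure F)
      (fun b => (Λ : Set (Af F)).indicator (1 : Af F → ℂ) b * adelicChar F (x * b)) y
    have h2 : ∀ b, (Λ : Set (Af F)).indicator (1 : Af F → ℂ) (b + y) =
        (Λ : Set (Af F)).indicator 1 b := fun b => by
      classical
      simp only [Set.indicator_apply, SetLike.mem_coe, add_mem_cancel_right hy, Pi.one_apply]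
    simp only [h2, mul_add, adelicChar_add, ← mul_assoc] at h1
    rw [integral_mul_const] at h1
    by_contra h3
    exact hxy ((mul_eq_left₀ h3).1 h1)

theorem integrable_indicator_mul_adelicChar {Λ : AddSubgroup (Af F)} (h : IsOpen (Λ : Set (Af F)))
    (h' : IsCompact (Λ : Set (Af F))) (c x : Af F) :
    Integrable (fun b => (Λ : Set (Af F)).indicator 1 (b - c) * adelicChar F (x * b))
      (addMeasure F) := by
  have h1 : IsLocallyConstant fun b : Af F => (Λ : Set (Af F)).indicator (1 : Af F → ℂ) (b - c) :=
    (isLocallyConstant_indicator ⟨h'.isClosed, h⟩).comp_continuous (continuous_sub_right c)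
  refine (h1.continuous.mul
    (continuous_adelicChar.comp (continuous_const_mul x))).integrable_of_hasCompactSupport ?_
  refine HasCompactSupport.mul_right (HasCompactSupport.of_support_subset_isCompact
    ((Homeomorph.subRight c).isCompact_preimage.2 h') fun b hb => ?_)
  by_contra h2
  exact hb (Set.indicator_of_notMem (s := (Λ : Set (Af F))) h2 _)

theorem wave_mul_conj (Λ : AddSubgroup (Af F)) (c p x : Fin 2 → Af F) (a b : Af F) :
    wave Λ c p ![a, b] * starRingEnd ℂ (adelicChar F (x 0 * b - x 1 * a)) =
      ((Λ : Set (Af F)).indicator 1 (a - c 0) * adelicChar F ((p 0 + x 1) * a)) *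
      ((Λ : Set (Af F)).indicator 1 (b - c 1) * adelicChar F ((p 1 - x 0) * b)) := by
  rw [conj_adelicChar, wave, mul_assoc, ← adelicChar_add, mul_mul_mul_comm, ← adelicChar_add]
  simp only [Matrix.cons_val_zero, Matrix.cons_val_one]
  congr 2
  ring

/-- Waves are stable under the transform: centre and frequency are exchanged up to a rotation, and
`Λ` becomes its dual. This is why frequencies are carried along. -/
theorem finFourier_wave {Λ : AddSubgroup (Af F)} (h : IsOpen (Λ : Set (Af F)))
    (h' : IsCompact (Λ : Set (Af F))) (c p x : Fin 2 → Af F) :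
    finFourier F (wave Λ c p) x = (addMeasure F).real Λ ^ 2 * adelicChar F (p 0 * c 0 + p 1 * c 1) *
      wave (charDual Λ) ![p 1, -p 0] ![-c 1, c 0] x := by
  have hn : (charDual Λ : Set (Af F)).indicator (1 : Af F → ℂ) (p 1 - x 0) =
      (charDual Λ : Set (Af F)).indicator 1 (x 0 - p 1) := by
    classical
    simp only [Set.indicator_apply, SetLike.mem_coe, ← neg_sub (p 1) (x 0), neg_mem_iff,
      Pi.one_apply]
  simp only [finFourier, wave_mul_conj, integral_const_mul, integral_mul_const,
    integral_indicator_mul_adelicChar h h', hn]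
  have e : adelicChar F ((p 0 + x 1) * c 0) * adelicChar F ((p 1 - x 0) * c 1) =
      adelicChar F (p 0 * c 0 + p 1 * c 1) * adelicChar F (-c 1 * x 0 + c 0 * x 1) := by
    rw [← adelicChar_add, ← adelicChar_add]
    congr 1
    ring
  simp only [wave, Matrix.cons_val_zero, Matrix.cons_val_one]
  rw [show x 1 - -p 0 = p 0 + x 1 by ring]
  linear_combination ((addMeasure F).real Λ ^ 2 *
    (charDual Λ : Set (Af F)).indicator (1 : Af F → ℂ) (p 0 + x 1) *
    (charDual Λ : Set (Af F)).indicator (1 : Af F → ℂ) (x 0 - p 1) : ℂ) * e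

/-- The integrals in the definition of the Fourier transform converge. -/
def FourierIntegrable (φ : (Fin 2 → Af F) → ℂ) : Prop :=
  ∀ x : Fin 2 → Af F,
    (∀ a, Integrable (fun b => φ ![a, b] * starRingEnd ℂ (adelicChar F (x 0 * b - x 1 * a)))
      (addMeasure F)) ∧
    Integrable (fun a => ∫ b, φ ![a, b] * starRingEnd ℂ (adelicChar F (x 0 * b - x 1 * a))
      ∂addMeasure F) (addMeasure F)

theorem finFourier_const_mul (c : ℂ) (φ : (Fin 2 → Af F) → ℂ) :
    (finFourier F fun v => c * φ v) = fun x => c * finFourier F φ x := by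
  funext x
  simp only [finFourier, mul_assoc, integral_const_mul]

theorem FourierIntegrable.finFourier_add {φ ψ : (Fin 2 → Af F) → ℂ} (h : FourierIntegrable φ)
    (h' : FourierIntegrable ψ) : finFourier F (φ + ψ) = finFourier F φ + finFourier F ψ := by
  funext x
  rw [Pi.add_apply]
  simp only [finFourier, Pi.add_apply, add_mul]
  rw [← integral_add (h x).2 (h' x).2]
  congr 1
  funext a
  exact integral_add ((h x).1 a) ((h' x).1 a)

theorem finFourier_zero : finFourier F (0 : (Fin 2 → Af F) → ℂ) = 0 := by
  funext x; simp [finFourier]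

/-- The transform is an iterated integral, so its additivity needs integrability of both the inner
and the outer integrand. -/
theorem IsSchwartzBruhat.fourierIntegrable {φ : (Fin 2 → Af F) → ℂ} (h : IsSchwartzBruhat φ) :
    FourierIntegrable φ := by
  refine IsSchwartzBruhat.induction (P := fun φ => FourierIntegrable φ) ?_ ?_ ?_ ?_ h
  · intro x; simp
  · intro φ ψ _ _ h h' x
    simp only [Pi.add_apply, add_mul]
    refine ⟨fun a => ((h x).1 a).add ((h' x).1 a), ?_⟩
    refine ((h x).2.add (h' x).2).congr (Eventually.of_forall fun a => ?_)
    exact (integral_add ((h x).1 a) ((h' x).1 a)).symm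
  · intro c φ _ h x
    simp only [mul_assoc, integral_const_mul]
    exact ⟨fun a => ((h x).1 a).const_mul c, (h x).2.const_mul c⟩
  · intro t c x
    simp only [wave_mul_conj, integral_const_mul]
    have h := fun c x => integrable_indicator_mul_adelicChar (isOpen_lattice t) (isCompact_lattice t)
      c x
    exact ⟨fun a => (h _ _).const_mul _, (h _ _).mul_const _⟩

theorem IsSchwartzBruhat.finFourier {φ : (Fin 2 → Af F) → ℂ} (h : IsSchwartzBruhat φ) :
    IsSchwartzBruhat (finFourier F φ) := by
  refine IsSchwartzBruhat.induction (P := fun φ => IsSchwartzBruhat (Horospherical.finFourier F φ)) ?_ ?_ ?_ ?_ h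
  · rw [finFourier_zero]; exact IsSchwartzBruhat.zero
  · intro φ ψ hφ hψ h h'
    rw [hφ.fourierIntegrable.finFourier_add hψ.fourierIntegrable]; exact h.add h'
  · intro c φ _ h; rw [finFourier_const_mul]; exact h.const_mul c
  · intro t c
    rw [funext (finFourier_wave (isOpen_lattice t) (isCompact_lattice t) c 0)]
    exact (isSchwartzBruhat_wave (isOpen_charDual_lattice t) (isCompact_charDual_lattice t) _
      _).const_mul _

/-- No reflection `v ↦ -v` occurs: the pairing `det(x, v)` is alternating, and its sign cancels that
of the usual double transform. On waves the constants cancel by `measureReal_lattice_mul_charDual`.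
-/
theorem IsSchwartzBruhat.finFourier_finFourier {φ : (Fin 2 → Af F) → ℂ} (h : IsSchwartzBruhat φ) :
    Horospherical.finFourier F (Horospherical.finFourier F φ) = φ := by
  refine IsSchwartzBruhat.induction (P := fun φ => Horospherical.finFourier F (Horospherical.finFourier F φ) = φ) ?_ ?_ ?_ ?_ h
  · rw [finFourier_zero, finFourier_zero]
  · intro φ ψ hφ hψ h h'
    rw [hφ.fourierIntegrable.finFourier_add hψ.fourierIntegrable,
      hφ.finFourier.fourierIntegrable.finFourier_add hψ.finFourier.fourierIntegrable, h, h']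
  · intro c φ _ h; rw [finFourier_const_mul, finFourier_const_mul, h]
  · intro t c
    rw [funext (finFourier_wave (isOpen_lattice t) (isCompact_lattice t) c 0), finFourier_const_mul,
      funext (finFourier_wave (isOpen_charDual_lattice t) (isCompact_charDual_lattice t) _ _)]
    have h1 : ((addMeasure F).real (lattice t) : ℂ) *
        (addMeasure F).real (charDual (lattice t)) = 1 := by
      exact_mod_cast measureReal_lattice_mul_charDual t
    funext v
    rw [charDual_charDual_lattice]
    have h2 : (![![-c 1, c 0] 1, -![-c 1, c 0] 0] : Fin 2 → Af F) = c := by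
      funext i; fin_cases i <;> simp
    have h3 : (![-![(0 : Fin 2 → Af F) 1, -(0 : Fin 2 → Af F) 0] 1,
        ![(0 : Fin 2 → Af F) 1, -(0 : Fin 2 → Af F) 0] 0] : Fin 2 → Af F) = 0 := by
      funext i; fin_cases i <;> simp
    rw [h2, h3]
    simp only [Pi.zero_apply, zero_mul, add_zero, adelicChar_zero, mul_one, neg_zero,
      Matrix.cons_val_zero, Matrix.cons_val_one, mul_zero]
    -- With `a`, `b` the two volumes this is `a² b² - 1 = (a b + 1)(a b - 1)`.
    linear_combination ((addMeasure F).real (lattice t) *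
        (addMeasure F).real (charDual (lattice t)) + 1) * wave (lattice t) c 0 v * h1

/-- The Fourier transform commutes with the action of integral unit scalars. -/
theorem finFourier_units_smul {φ : (Fin 2 → Af F) → ℂ} {z : (Af F)ˣ} (hz : z ∈ integralUnits F)
    (h : ∀ v, φ ((z : Af F) • v) = φ v) (x : Fin 2 → Af F) :
    finFourier F φ ((z : Af F) • x) = finFourier F φ x := by
  rw [finFourier, finFourier]
  -- The substitution `v ↦ z v` preserves the measure, and `det(z x, v) = det(x, z v)`.
  conv_rhs => rw [← integral_mul_left_addMeasure _ hz]
  congr 1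
  funext a
  conv_rhs => rw [← integral_mul_left_addMeasure _ hz]
  congr 1
  funext b
  have h1 := h ![a, b]
  have h2 : (z : Af F) • ![a, b] = ![z * a, z * b] := by
    funext i; fin_cases i <;> simp
  rw [h2] at h1
  rw [h1]
  simp only [Pi.smul_apply, smul_eq_mul]
  congr 3
  ring

end

/-! ### Iwasawa decomposition and strong approximation. -/

section

variable {F : Type*} [Field F] [NumberField F]

/-! ### Generators and decompositions of `GL₂` -/

theorem Af.denseRange_algebraMap : DenseRange (algebraMap F (Af F)) := by
  intro x
  rw [mem_closure_iff]
  intro U hU hx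
  obtain ⟨N, hN, h⟩ := exists_natLattice_subset (U := (fun y => x + y) ⁻¹' U)
    (hU.preimage (continuous_const_add x)) (by simpa using hx)
  obtain ⟨a, ha⟩ := exists_field_sub_le x (Af.natUnit N hN)
  refine ⟨algebraMap F (Af F) a, ?_, a, rfl⟩
  have h1 : algebraMap F (Af F) a - x ∈ natLattice N hN := by
    rw [← neg_sub, neg_mem_iff]
    exact fun v => ha v
  have := h h1
  rwa [Set.mem_preimage, add_sub_cancel] at this

section Elementary

variable {R : Type*} [CommRing R]

/-- The matrix `(1, x; 0, 1)`. -/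
def upper (x : R) : GL (Fin 2) R where
  val := !![1, x; 0, 1]
  inv := !![1, -x; 0, 1]
  val_inv := by simp [Matrix.one_fin_two]
  inv_val := by simp [Matrix.one_fin_two]

/-- The matrix `(1, 0; x, 1)`. -/
def lower (x : R) : GL (Fin 2) R where
  val := !![1, 0; x, 1]
  inv := !![1, 0; -x, 1]
  val_inv := by simp [Matrix.one_fin_two]
  inv_val := by simp [Matrix.one_fin_two]

theorem coe_upper (x : R) : (upper x : Matrix (Fin 2) (Fin 2) R) = !![1, x; 0, 1] := rfl

theorem coe_lower (x : R) : (lower x : Matrix (Fin 2) (Fin 2) R) = !![1, 0; x, 1] := rfl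

theorem det_upper (x : R) : Matrix.GeneralLinearGroup.det (upper x) = 1 :=
  Units.ext (by simp [coe_upper])

theorem det_lower (x : R) : Matrix.GeneralLinearGroup.det (lower x) = 1 :=
  Units.ext (by simp [coe_lower])

theorem lower_neg_mul (x : R) : lower (-x) * lower x = 1 :=
  Units.ext (by simp [coe_lower, Matrix.one_fin_two])

theorem continuous_upper [TopologicalSpace R] [IsTopologicalRing R] :
    Continuous (upper : R → GL (Fin 2) R) := by
  refine Units.continuous_iff.2 ⟨?_, ?_⟩
  · refine continuous_matrix fun i j => ?_
    fin_cases i <;> fin_cases j <;> simp [coe_upper] <;> fun_prop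
  · refine continuous_matrix fun i j => ?_
    change Continuous fun x : R => (!![1, -x; 0, 1] : Matrix (Fin 2) (Fin 2) R) i j
    fin_cases i <;> fin_cases j <;> simp <;> fun_prop

theorem continuous_lower [TopologicalSpace R] [IsTopologicalRing R] :
    Continuous (lower : R → GL (Fin 2) R) := by
  refine Units.continuous_iff.2 ⟨?_, ?_⟩
  · refine continuous_matrix fun i j => ?_
    fin_cases i <;> fin_cases j <;> simp [coe_lower] <;> fun_prop
  · refine continuous_matrix fun i j => ?_
    change Continuous fun x : R => (!![1, 0; -x, 1] : Matrix (Fin 2) (Fin 2) R) i j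
    fin_cases i <;> fin_cases j <;> simp <;> fun_prop

/-- An element of determinant `1` with invertible lower left entry is a product of elementary
matrices. -/
theorem eq_upper_mul_lower_mul_upper (g : GL (Fin 2) R)
    (hg : Matrix.GeneralLinearGroup.det g = 1) (c : Rˣ)
    (hc : (c : R) = (g : Matrix (Fin 2) (Fin 2) R) 1 0) :
    g = upper ((g 0 0 - 1) * (c⁻¹ : Rˣ)) * lower (c : R) * upper ((g 1 1 - 1) * (c⁻¹ : Rˣ)) := by
  have hd : g 0 0 * g 1 1 - g 0 1 * g 1 0 = 1 := by
    have := congrArg Units.val hg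
    rwa [Matrix.GeneralLinearGroup.val_det_apply, Matrix.det_fin_two] at this
  have hcc : (c : R) * (c⁻¹ : Rˣ) = 1 := c.mul_inv
  rw [← hc] at hd
  set a := g 0 0
  set b := g 0 1
  set d := g 1 1
  set i : R := ((c⁻¹ : Rˣ) : R)
  refine Units.ext (Matrix.ext fun r s => ?_)
  rw [Units.val_mul, Units.val_mul, coe_upper, coe_lower, coe_upper]
  fin_cases r <;> fin_cases s
  · change a = _
    simp [Matrix.mul_apply, Fin.sum_univ_two]
    linear_combination (1 - a) * hcc
  · change b = _
    simp [Matrix.mul_apply, Fin.sum_univ_two]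
    linear_combination (-b - (a - 1) * (d - 1) * i) * hcc - i * hd
  · change g 1 0 = _
    simp [Matrix.mul_apply, Fin.sum_univ_two, hc]
  · change d = _
    simp [Matrix.mul_apply, Fin.sum_univ_two]
    linear_combination (1 - d) * hcc

end Elementary

theorem det_apply_fin_two (g : GL (Fin 2) (Af F)) (v : HeightOneSpectrum (𝓞 F)) :
    (Matrix.GeneralLinearGroup.det g : Af F) v = g 0 0 v * g 1 1 v - g 0 1 v * g 1 0 v := by
  rw [Matrix.GeneralLinearGroup.val_det_apply, Matrix.det_fin_two]
  rfl

/-- For a column `(a, c)` of an invertible matrix, the larger of the local norms of `a` and `c`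
is `1` at almost all places. -/
theorem eventually_max_norm_eq_one (g : GL (Fin 2) (Af F)) :
    ∀ᶠ v in cofinite, max ‖g 0 0 v‖ ‖g 1 0 v‖ = 1 := by
  filter_upwards [(g 0 0).eventually_norm_le_one, (g 0 1).eventually_norm_le_one,
    (g 1 0).eventually_norm_le_one, (g 1 1).eventually_norm_le_one,
    Af.unit_eventually (Matrix.GeneralLinearGroup.det g)] with v h1 h2 h3 h4 h5
  refine le_antisymm (max_le h1 h3) ?_
  rw [← h5, det_apply_fin_two, sub_eq_add_neg]
  refine (norm_add_le_max v _ _).trans (max_le_max ?_ ?_)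
  · rw [norm_mul]; exact mul_le_of_le_one_right (norm_nonneg _) h4
  · rw [norm_neg, norm_mul]; exact mul_le_of_le_one_left (norm_nonneg _) h2

theorem column_ne_zero (g : GL (Fin 2) (Af F)) (v : HeightOneSpectrum (𝓞 F)) :
    0 < max ‖g 0 0 v‖ ‖g 1 0 v‖ := by
  by_contra h
  have h1 := (le_max_left _ _).trans (not_lt.1 h)
  have h2 := (le_max_right _ _).trans (not_lt.1 h)
  rw [norm_le_zero_iff] at h1 h2
  apply Af.unit_ne_zero (Matrix.GeneralLinearGroup.det g) v
  rw [det_apply_fin_two, h1, h2, zero_mul, mul_zero, sub_zero]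

/-- If `(x, y)` spans the unit ideal, then `x + z y` is a unit for some integral `z`. -/
theorem exists_unit_eq_add_mul {x y : Af F} (h0 : ∀ v, 0 < max ‖x v‖ ‖y v‖)
    (h : ∀ᶠ v in cofinite, max ‖x v‖ ‖y v‖ = 1) :
    ∃ z ∈ integralAdeles F, ∃ u : (Af F)ˣ, (u : Af F) = x + z * y ∧
      ∀ v, ‖(u : Af F) v‖ = max ‖x v‖ ‖y v‖ := by
  classical
  -- Add `y` exactly at the places where it strictly dominates `x`. The two norms differ there, so
  -- the ultrametric inequality is an equality.
  let z₀ : ∀ v : HeightOneSpectrum (𝓞 F), v.adicCompletion F :=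
    fun v => if ‖y v‖ ≤ ‖x v‖ then 0 else 1
  have hz₀ : ∀ v, ‖z₀ v‖ ≤ 1 := fun v => by
    simp only [z₀]; split_ifs <;> simp
  let z : Af F := Af.mk z₀ (Eventually.of_forall hz₀)
  have hn : ∀ v, ‖(x + z * y) v‖ = max ‖x v‖ ‖y v‖ := fun v => by
    rw [Af.add_apply, Af.mul_apply, Af.mk_apply]
    simp only [z₀]
    split_ifs with hv
    · rw [zero_mul, add_zero, max_eq_left hv]
    · rw [one_mul]
      exact IsUltrametricDist.norm_add_eq_max_of_norm_ne_norm (not_le.1 hv).ne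
  have hu : IsUnit (x + z * y) := Af.isUnit_iff_norm.2
    ⟨fun v => norm_pos_iff.1 (by rw [hn]; exact h0 v), h.mono fun v hv => by rw [hn, hv]⟩
  exact ⟨z, mem_integralAdeles.2 hz₀, hu.unit, rfl, hn⟩

theorem upper_mem_levelOne {z : Af F} (hz : z ∈ integralAdeles F) : upper z ∈ levelOne F := by
  refine mem_levelOne_of_det (fun i j => ?_) (by rw [det_upper]; exact one_mem _)
  have h0 : (0 : Af F) ∈ integralAdeles F := zero_mem _
  have h1 : (1 : Af F) ∈ integralAdeles F := one_mem _
  fin_cases i <;> fin_cases j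
  · exact h1
  · exact hz
  · exact h0
  · exact h1

theorem lower_mem_levelOne {z : Af F} (hz : z ∈ integralAdeles F) : lower z ∈ levelOne F := by
  refine mem_levelOne_of_det (fun i j => ?_) (by rw [det_lower]; exact one_mem _)
  have h0 : (0 : Af F) ∈ integralAdeles F := zero_mem _
  have h1 : (1 : Af F) ∈ integralAdeles F := one_mem _
  fin_cases i <;> fin_cases j
  · exact h1
  · exact h0
  · exact hz
  · exact h1

/-- The upper triangular matrix `(t₁, t₁ u; 0, t₂)`. -/
def borel (t₁ t₂ : (Af F)ˣ) (u : Af F) : GL (Fin 2) (Af F) :=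
  (BorelPi.mk t₁ t₂ u 1 1).toGpi.1

theorem coe_borel (t₁ t₂ : (Af F)ˣ) (u : Af F) : (borel t₁ t₂ u : Matrix (Fin 2) (Fin 2) (Af F)) =
    !![(t₁ : Af F), t₁ * u; 0, (t₂ : Af F)] := rfl

theorem det_borel (t₁ t₂ : (Af F)ˣ) (u : Af F) :
    Matrix.GeneralLinearGroup.det (borel t₁ t₂ u) = t₁ * t₂ :=
  Units.ext (by
    rw [Matrix.GeneralLinearGroup.val_det_apply, coe_borel, Matrix.det_fin_two_of]; simp)

theorem toGpi_eq (b : BorelPi F) : b.toGpi = (borel b.t₁ b.t₂ b.u, b.ε₁ * b.ε₂) := rfl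

/-- An invertible matrix with vanishing lower left entry is upper triangular. -/
theorem exists_eq_borel (g : GL (Fin 2) (Af F)) (hg : g 1 0 = 0) :
    ∃ t₁ t₂ u, g = borel t₁ t₂ u ∧ (t₁ : Af F) = g 0 0 ∧ (t₂ : Af F) = g 1 1 := by
  have hd : g 0 0 * g 1 1 = Matrix.GeneralLinearGroup.det g := by
    rw [Matrix.GeneralLinearGroup.val_det_apply, Matrix.det_fin_two, hg, mul_zero, sub_zero]
  have h1 : IsUnit (g 0 0) := isUnit_of_mul_isUnit_left (hd ▸ Units.isUnit _)
  have h2 : IsUnit (g 1 1) := isUnit_of_mul_isUnit_right (hd ▸ Units.isUnit _)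
  refine ⟨h1.unit, h2.unit, ((h1.unit⁻¹ : (Af F)ˣ) : Af F) * g 0 1, Units.ext ?_, rfl, rfl⟩
  rw [coe_borel, Units.mul_inv_cancel_left, IsUnit.unit_spec, IsUnit.unit_spec, ← hg]
  exact Matrix.eta_fin_two _

/-- The Iwasawa decomposition. -/
theorem exists_iwasawa (g : GL (Fin 2) (Af F)) :
    ∃ k ∈ levelOne F, ∃ t₁ t₂ u, g = k * borel t₁ t₂ u := by
  -- The integral row operation `upper z` makes the upper left entry an idele `a` of maximal norm in
  -- its column; then `lower (-w)`, with integral `w`, clears the entry below it.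
  obtain ⟨z, hz, a, ha, hn⟩ := exists_unit_eq_add_mul (column_ne_zero g)
    (eventually_max_norm_eq_one g)
  have hw : ((a⁻¹ : (Af F)ˣ) : Af F) * g 1 0 ∈ integralAdeles F :=
    inv_mul_mem_iff.2 fun v => by rw [hn]; exact le_max_right _ _
  set w := ((a⁻¹ : (Af F)ˣ) : Af F) * g 1 0 with hw'
  have h0 : (lower (-w) * (upper z * g)) 1 0 = 0 := by
    have h1 : (lower (-w) * (upper z * g)) 1 0 = -w * (g 0 0 + z * g 1 0) + g 1 0 := by
      rw [Units.val_mul, Units.val_mul, coe_lower, coe_upper]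
      simp only [Matrix.mul_apply, Fin.sum_univ_two, Matrix.of_apply, Matrix.cons_val_zero,
        Matrix.cons_val_one]
      ring
    rw [h1, ← ha, hw', neg_mul, mul_right_comm, Units.inv_mul, one_mul, neg_add_cancel]
  obtain ⟨t₁, t₂, u, h, -⟩ := exists_eq_borel _ h0
  refine ⟨(lower (-w) * upper z)⁻¹, inv_mem (mul_mem (lower_mem_levelOne (neg_mem hw))
    (upper_mem_levelOne hz)), t₁, t₂, u, ?_⟩
  rw [← h, ← mul_assoc (lower (-w)), inv_mul_cancel_left]

/-! ### Strong approximation -/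

/-- The image of `SL₂(F)` in `GL₂(𝔸_f)`. -/
def rationalSL (F : Type*) [Field F] [NumberField F] : Subgroup (GL (Fin 2) (Af F)) :=
  (Matrix.GeneralLinearGroup.det : GL (Fin 2) F →* Fˣ).ker.map
    (Matrix.GeneralLinearGroup.map (algebraMap F (Af F)))

theorem upper_mem_closure (x : Af F) : upper x ∈ (rationalSL F).topologicalClosure :=
  map_mem_closure continuous_upper (Af.denseRange_algebraMap x) (by
    rintro _ ⟨a, rfl⟩
    refine ⟨upper a, det_upper a, Units.ext (Matrix.ext fun i j => ?_)⟩
    fin_cases i <;> fin_cases j <;> simp [coe_upper])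

theorem lower_mem_closure (x : Af F) : lower x ∈ (rationalSL F).topologicalClosure :=
  map_mem_closure continuous_lower (Af.denseRange_algebraMap x) (by
    rintro _ ⟨a, rfl⟩
    refine ⟨lower a, det_lower a, Units.ext (Matrix.ext fun i j => ?_)⟩
    fin_cases i <;> fin_cases j <;> simp [coe_lower])

/-- An integral row operation makes the lower left entry an idele, after which the matrix is a
product of elementary ones. Each of these is a limit of rational elementary matrices because `F` is
dense in `𝔸_f`. -/
theorem mem_closure_rationalSL {g : GL (Fin 2) (Af F)}
    (hg : Matrix.GeneralLinearGroup.det g = 1) : g ∈ (rationalSL F).topologicalClosure := by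
  obtain ⟨z, hz, c, hc, -⟩ := exists_unit_eq_add_mul (x := g 1 0) (y := g 0 0)
    (fun v => by rw [max_comm]; exact column_ne_zero g v)
    ((eventually_max_norm_eq_one g).mono fun v hv => by rwa [max_comm])
  have h1 : g = lower (-z) * (lower z * g) := by rw [← mul_assoc, lower_neg_mul, one_mul]
  have hd : Matrix.GeneralLinearGroup.det (lower z * g) = 1 := by
    rw [map_mul, det_lower, hg, one_mul]
  have hc' : (c : Af F) = (lower z * g) 1 0 := by
    rw [hc]
    simp [coe_lower, Matrix.mul_apply, Fin.sum_univ_two, add_comm]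
  rw [h1, eq_upper_mul_lower_mul_upper _ hd c hc']
  exact mul_mem (lower_mem_closure _) (mul_mem (mul_mem (upper_mem_closure _)
    (lower_mem_closure _)) (upper_mem_closure _))

/-- Strong approximation for `SL₂`. -/
theorem exists_mul_mem_rationalSL {U : Subgroup (GL (Fin 2) (Af F))}
    (hU : IsOpen (U : Set (GL (Fin 2) (Af F)))) {g : GL (Fin 2) (Af F)}
    (hg : Matrix.GeneralLinearGroup.det g = 1) : ∃ k ∈ U, k * g ∈ rationalSL F := by
  have h := mem_closure_rationalSL hg
  obtain ⟨x, hx, hx'⟩ := mem_closure_iff.1 h ((fun x => x * g⁻¹) ⁻¹' (U : Set (GL (Fin 2) (Af F))))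
    (hU.preimage (continuous_mul_const g⁻¹)) (by simp [one_mem])
  exact ⟨x * g⁻¹, hx, by rwa [inv_mul_cancel_right]⟩

variable [IsTotallyReal F]

theorem finPart_detIdele (g : Gpi F) :
    finPart F (detIdele g) = Matrix.GeneralLinearGroup.det g.1 := by
  rw [detIdele, map_mul, finPart_finIdele, finPart_realIdele, mul_one]

theorem signHom_detIdele (g : Gpi F) : signHom (realPart (detIdele g)) = g.2 := by
  rw [detIdele, map_mul, map_mul, realPart_finIdele, realPart_realIdele, map_one, one_mul,
    signHom_signReal]

theorem detIdele_mul (g h : Gpi F) : detIdele (g * h) = detIdele g * detIdele h := by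
  simp only [detIdele, Prod.fst_mul, Prod.snd_mul, map_mul]
  exact mul_mul_mul_comm _ _ _ _

theorem rational_mul (γ δ : GL (Fin 2) F) : rational F (γ * δ) = rational F γ * rational F δ := by
  refine Prod.ext (map_mul _ γ δ) ?_
  rw [Prod.snd_mul]
  simp only [← signHom_realPart_principal, map_mul]

theorem detIdele_rational_mem {U : Subgroup (Af F)ˣ} (γ : GL (Fin 2) F) :
    detIdele (rational F γ) ∈ idealClassSubgroup U :=
  mem_idealClassSubgroup.2 ⟨1, one_mem _, Matrix.GeneralLinearGroup.det γ, by
    rw [finPart_detIdele, one_mul]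
    exact Matrix.GeneralLinearGroup.map_det _ _, by
    rw [signHom_detIdele, signHom_realPart_principal]⟩

/-- Two elements of `G(𝔸_f) × π₀(G(ℝ))` whose determinants agree in the class group of level `K`
are in the same double coset of `K` and `GL₂(F)`. -/
theorem exists_eq_mul_rational {K : Subgroup (GL (Fin 2) (Af F))}
    (hK : IsOpen (K : Set (GL (Fin 2) (Af F)))) {g h : Gpi F}
    (hgh : (detIdele g)⁻¹ * detIdele h ∈ clSubgroup F K) :
    ∃ k ∈ K, ∃ γ, h = (k, 1) * (g * rational F γ) := by
  rw [clSubgroup_eq, mem_idealClassSubgroup] at hgh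
  obtain ⟨_, ⟨k₀, hk₀, rfl⟩, a, h1, h2⟩ := hgh
  rw [map_mul, map_inv, finPart_detIdele, finPart_detIdele] at h1
  rw [map_mul, map_mul, map_inv, map_inv, signHom_detIdele, signHom_detIdele] at h2
  -- The discrepancy of the determinants is absorbed by `k₀` on the left and by `diag(a, 1)` on the
  -- right; the signs of `a` take care of the infinite places.
  let γ₀ : GL (Fin 2) F := Matrix.GeneralLinearGroup.mk'' !![(a : F), 0; 0, 1]
    (by simp)
  have hγ₀ : Matrix.GeneralLinearGroup.det γ₀ = a := Units.ext (by
    rw [Matrix.GeneralLinearGroup.val_det_apply]; simp [γ₀])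
  have hr₁ : ∀ γ, Matrix.GeneralLinearGroup.det (rational F γ).1 =
      finPrincipal (Matrix.GeneralLinearGroup.det γ) := fun γ => by
    exact Matrix.GeneralLinearGroup.map_det _ _
  have hr₂ := signHom_realPart_principal γ₀
  rw [hγ₀] at hr₂
  -- reduce to the case of equal determinants
  set s := (g * rational F γ₀).1⁻¹ * (k₀⁻¹ * h.1) with hs
  have hsd : Matrix.GeneralLinearGroup.det s = 1 := by
    rw [hs, map_mul, map_inv, map_mul, map_inv, Prod.fst_mul, map_mul, hr₁, hγ₀,
      eq_mul_of_inv_mul_eq h1, mul_left_comm (Matrix.GeneralLinearGroup.det g.1),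
      inv_mul_cancel_left, inv_mul_cancel]
  set r := (g * rational F γ₀).1 with hr
  -- Strong approximation is applied with `r⁻¹ K r`, so that the correcting factor can be moved to
  -- the left of `r` into `K`.
  have hU : IsOpen ((K.comap (MulAut.conj r).toMonoidHom : Subgroup (GL (Fin 2) (Af F))) :
      Set (GL (Fin 2) (Af F))) :=
    hK.preimage ((continuous_const_mul r).mul continuous_const)
  obtain ⟨u, hu, γ₁, hγ₁, hus⟩ := exists_mul_mem_rationalSL hU hsd
  have hu' : r * u * r⁻¹ ∈ K := hu
  have hγ₁' : (rational F γ₁).2 = 1 := by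
    rw [← signHom_realPart_principal, MonoidHom.mem_ker.1 hγ₁, map_one, map_one, map_one]
  refine ⟨k₀ * (r * u * r⁻¹)⁻¹, mul_mem hk₀ (inv_mem hu'), γ₀ * γ₁, ?_⟩
  rw [rational_mul, ← mul_assoc g]
  refine Prod.ext ?_ ?_
  · rw [Prod.fst_mul, Prod.fst_mul, ← hr]
    change h.1 = k₀ * (r * u * r⁻¹)⁻¹ * (r * Matrix.GeneralLinearGroup.map (algebraMap F (Af F)) γ₁)
    have : Matrix.GeneralLinearGroup.map (algebraMap F (Af F)) γ₁ = u * s := hus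
    rw [this, hs]
    group
  · rw [Prod.snd_mul, Prod.snd_mul, Prod.snd_mul, hγ₁', mul_one, one_mul, ← hr₂, ← h2,
      mul_inv_cancel_left]

end

/-! ### Levels, convergence and independence of the level. -/

section

variable {F : Type*} [Field F] [NumberField F]

/-! ### Characters of finite quotients -/

section FiniteCharacters

variable {G : Type*} [CommGroup G]

theorem norm_apply_eq_one_of_finiteIndex {H : Subgroup G} [H.FiniteIndex] {χ : G →* ℂˣ}
    (hχ : H ≤ χ.ker) (t : G) : ‖(χ t : ℂ)‖ = 1 := by
  refine Complex.norm_eq_one_of_pow_eq_one (n := H.index) ?_ Subgroup.FiniteIndex.index_ne_zero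
  rw [← Units.val_pow_eq_pow_val, ← map_pow, MonoidHom.mem_ker.1 (hχ (H.pow_index_mem t)),
    Units.val_one]

theorem finite_setOf_le_ker (H : Subgroup G) [H.FiniteIndex] :
    {χ : G →* ℂˣ | H ≤ χ.ker}.Finite := by
  have h : {χ : G →* ℂˣ | H ≤ χ.ker} ⊆
      Set.range fun η : (G ⧸ H) →* ℂˣ => η.comp (QuotientGroup.mk' H) := fun χ hχ =>
    ⟨QuotientGroup.lift H χ hχ, MonoidHom.ext fun _ => rfl⟩
  exact (Set.finite_range _).subset h

/-- Every function on a finite abelian group is a linear combination of characters. -/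
theorem exists_eq_sum_characters [Finite G] (f : G → ℂ) :
    ∃ (s : Finset (G →* ℂˣ)) (a : (G →* ℂˣ) → ℂ), ∀ x, f x = ∑ η ∈ s, a η * (η x : ℂ) := by
  classical
  have := Fintype.ofFinite G
  have := Fintype.ofFinite (G →* ℂˣ)
  have hli : LinearIndependent ℂ fun η : G →* ℂˣ => fun x => (η x : ℂ) :=
    (linearIndependent_monoidHom G ℂ).comp (fun η : G →* ℂˣ => (Units.coeHom ℂ).comp η)
      fun η θ h => MonoidHom.ext fun x => Units.ext (DFunLike.congr_fun h x)
  have hcard : Fintype.card (G →* ℂˣ) = Module.finrank ℂ (G → ℂ) := by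
    rw [Module.finrank_fintype_fun_eq_card, ← Nat.card_eq_fintype_card, ← Nat.card_eq_fintype_card]
    exact Nat.card_congr
      (CommGroup.monoidHom_mulEquiv_of_hasEnoughRootsOfUnity G ℂ).some.toEquiv
  have hspan := hli.span_eq_top_of_card_eq_finrank hcard
  obtain ⟨a, ha⟩ := (Submodule.mem_span_range_iff_exists_fun ℂ).1
    (hspan ▸ Submodule.mem_top : f ∈ Submodule.span ℂ (Set.range _))
  refine ⟨Finset.univ, a, fun x => ?_⟩
  rw [← ha, Finset.sum_apply]
  rfl

end FiniteCharacters

/-! ### Levels -/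

/-- Let `N₁` bound the denominators on the support and let `φ` be invariant under `N₂ V(Ô)`. A
matrix congruent to `1` modulo `N₁ N₂` moves a vector of the support by an element of `N₂ V(Ô)`. -/
theorem IsSchwartzBruhat.exists_levelGroup {φ : (Fin 2 → Af F) → ℂ} (h : IsSchwartzBruhat φ) :
    ∃ N : ℕ, N ≠ 0 ∧ ∀ k ∈ levelGroup F N, ∀ v,
      φ ((k : Matrix (Fin 2) (Fin 2) (Af F)).mulVec v) = φ v := by
  obtain ⟨N₂, hN₂, h2⟩ := h.exists_level
  have hc : ∀ i : Fin 2, IsCompact ((fun v : Fin 2 → Af F => v i) '' tsupport φ) := fun i =>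
    h.2.isCompact.image (continuous_apply i)
  obtain ⟨N₁, hN₁, h1⟩ := exists_nat_mul_mem_of_isCompact ((hc 0).union (hc 1))
  have h1' : ∀ v ∈ tsupport φ, ∀ i, (N₁ : Af F) * v i ∈ integralAdeles F := fun v hv i => by
    fin_cases i
    · exact h1 _ (Or.inl ⟨v, hv, rfl⟩)
    · exact h1 _ (Or.inr ⟨v, hv, rfl⟩)
  have hN : N₁ * N₂ ≠ 0 := mul_ne_zero hN₁ hN₂
  have key : ∀ k ∈ levelGroup F (N₁ * N₂), ∀ v ∈ tsupport φ,
      φ ((k : Matrix (Fin 2) (Fin 2) (Af F)).mulVec v) = φ v := by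
    intro k hk v hv
    rw [← add_sub_cancel v ((k : Matrix (Fin 2) (Fin 2) (Af F)).mulVec v)]
    refine h2 _ _ (mem_box.2 fun i => ?_)
    have e : ((k : Matrix (Fin 2) (Fin 2) (Af F)).mulVec v - v) i =
        ∑ j, ((k : Matrix (Fin 2) (Fin 2) (Af F)) i j - (1 : Matrix (Fin 2) (Fin 2) (Af F)) i j) *
          v j := by
      conv_lhs => rw [← Matrix.one_mulVec v, Matrix.mulVec_mulVec, mul_one, ← Matrix.sub_mulVec]
      rfl
    rw [e]
    refine sum_mem fun j _ => ?_
    obtain ⟨y, hy, hyk⟩ := mem_natLattice_iff_exists.1 (((mem_levelGroup hN).1 hk).2 i j)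
    rw [hyk]
    refine mem_natLattice_iff_exists.2 ⟨y * (N₁ * v j), mul_mem hy (h1' v hv j), ?_⟩
    push_cast
    ring
  refine ⟨N₁ * N₂, hN, fun k hk v => ?_⟩
  by_cases hv : v ∈ tsupport φ
  · exact key k hk v hv
  -- If only `k v` lies in the support, apply the invariance there to `k⁻¹`.
  by_cases hkv : (k : Matrix (Fin 2) (Fin 2) (Af F)).mulVec v ∈ tsupport φ
  · have := key k⁻¹ (inv_mem hk) _ hkv
    rw [Matrix.mulVec_mulVec, ← Units.val_mul, inv_mul_cancel, Units.val_one,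
      Matrix.one_mulVec] at this
    exact this.symm
  · rw [image_eq_zero_of_notMem_tsupport hv, image_eq_zero_of_notMem_tsupport hkv]

theorem isOpen_detGroup {K : Subgroup (GL (Fin 2) (Af F))}
    (hK : IsOpen (K : Set (GL (Fin 2) (Af F)))) : IsOpen (detGroup F K : Set (Af F)ˣ) := by
  obtain ⟨N, hN, h⟩ := exists_levelGroup_subset hK (one_mem K)
  refine Subgroup.isOpen_mono (H₁ := unitLevel F N) ?_ (isOpen_unitLevel hN)
  rw [← detGroup_levelGroup hN]
  exact Subgroup.map_mono h

/-- A scalar in a compact subgroup is an integral unit. -/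
theorem mem_integralUnits_of_scalar_mem {K : Subgroup (GL (Fin 2) (Af F))}
    (hK : IsCompact (K : Set (GL (Fin 2) (Af F)))) {z : (Af F)ˣ}
    (hz : Matrix.GeneralLinearGroup.scalar (Fin 2) z ∈ K) : z ∈ integralUnits F := by
  have hc : IsCompact ((fun k : GL (Fin 2) (Af F) => k 0 0) '' (K : Set (GL (Fin 2) (Af F)))) :=
    hK.image ((continuous_id.matrix_elem 0 0).comp Units.continuous_val)
  obtain ⟨N, hN, h⟩ := exists_nat_mul_mem_of_isCompact hc
  have key : ∀ w : (Af F)ˣ, Matrix.GeneralLinearGroup.scalar (Fin 2) w ∈ K →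
      ∀ v, ‖(w : Af F) v‖ ≤ 1 := by
    intro w hw v
    by_contra h1
    have h0 := norm_natCast_pos v hN
    -- All powers of `w` stay in `K`, where `N` bounds the denominators of the entries. A local norm
    -- exceeding `1` would make them unbounded.
    obtain ⟨n, hn⟩ := pow_unbounded_of_one_lt ‖(N : v.adicCompletion F)‖⁻¹ (not_le.1 h1)
    have h2 := mem_integralAdeles.1 (h _ ⟨_, pow_mem hw n, rfl⟩) v
    rw [← map_pow] at h2
    change ‖((N : Af F) * ((w ^ n : (Af F)ˣ) : Af F)) v‖ ≤ 1 at h2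
    rw [Af.mul_apply, Af.natCast_apply, Units.val_pow_eq_pow_val, Af.pow_apply, norm_mul,
      norm_pow] at h2
    exact absurd hn (not_lt.2 ((le_inv_mul_iff₀ h0).2 h2 |>.trans (by simp)))
  refine mem_integralUnits.2 fun v => le_antisymm (key z hz v) ?_
  have := key z⁻¹ (by rw [map_inv]; exact inv_mem hz) v
  rw [Af.inv_apply, norm_inv] at this
  exact (inv_le_one₀ (Af.unit_norm_pos z v)).1 this

/-- The Fourier transform in the first variable. -/
def fourier (f : (Fin 2 → Af F) → Gpi F → ℂ) : (Fin 2 → Af F) → Gpi F → ℂ :=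
  fun v g => finFourier F (fun w => f w g) v

variable [IsTotallyReal F]

theorem finiteIndex_clSubgroup {K : Subgroup (GL (Fin 2) (Af F))}
    (hK : IsOpen (K : Set (GL (Fin 2) (Af F)))) : (clSubgroup F K).FiniteIndex :=
  finiteIndex_idealClassSubgroup (isOpen_detGroup hK)

theorem isSchwartzBruhat_of_mem_schwartz {f : (Fin 2 → Af F) → Gpi F → ℂ} (hf : f ∈ schwartz F)
    (g : Gpi F) : IsSchwartzBruhat fun v => f v g := ⟨(hf.1 g).1, (hf.1 g).2⟩

theorem fourier_mem_schwartz {f : (Fin 2 → Af F) → Gpi F → ℂ} (hf : f ∈ schwartz F) :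
    fourier f ∈ schwartz F := by
  refine ⟨fun g => ?_, ?_, fun v x γ => ?_⟩
  · have := (isSchwartzBruhat_of_mem_schwartz hf g).finFourier
    exact ⟨this.1, this.2⟩
  · obtain ⟨K, hK, hK', h⟩ := hf.2.1
    refine ⟨K, hK, hK', fun k hk x => funext fun v => ?_⟩
    exact congrArg (fun φ => finFourier F φ v) (h k hk x)
  · exact congrArg (fun φ => finFourier F φ v) (funext fun w => hf.2.2 w x γ)

theorem fourier_fourier {f : (Fin 2 → Af F) → Gpi F → ℂ} (hf : f ∈ schwartz F) :
    fourier (fourier f) = f := by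
  funext v g
  exact congrFun (isSchwartzBruhat_of_mem_schwartz hf g).finFourier_finFourier v

/-- An element of `G(𝔸_f) × π₀(G(ℝ))` with given determinant. -/
def ofDet (t : Ideles F) : Gpi F := (diag (finPart F t) 1, signHom (realPart t))

theorem detIdele_ofDet_inv_mul_mem (U : Subgroup (Af F)ˣ) (t : Ideles F) :
    (detIdele (ofDet t))⁻¹ * t ∈ idealClassSubgroup U :=
  mem_idealClassSubgroup.2 ⟨1, one_mem _, 1, by
    rw [map_mul, map_inv, finPart_detIdele, ofDet, det_diag]; simp, by
    rw [map_mul, map_mul, map_inv, map_inv, signHom_detIdele, ofDet]; simp⟩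

/-- A function in `𝒮` depends on `g` only through the class of its determinant. -/
theorem apply_eq_of_mem_clSubgroup {f : (Fin 2 → Af F) → Gpi F → ℂ} (hf : f ∈ schwartz F)
    {K : Subgroup (GL (Fin 2) (Af F))} (hK : IsOpen (K : Set (GL (Fin 2) (Af F))))
    (h : ∀ k ∈ K, ∀ v x, f v ((k, 1) * x) = f v x) {g g' : Gpi F}
    (hg : (detIdele g)⁻¹ * detIdele g' ∈ clSubgroup F K) (v : Fin 2 → Af F) : f v g' = f v g := by
  obtain ⟨k, hk, γ, rfl⟩ := exists_eq_mul_rational hK hg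
  rw [h k hk, hf.2.2]

theorem isLevel_levelGroup_mono {f : (Fin 2 → Af F) → Gpi F → ℂ} {N M : ℕ} (hN : N ≠ 0)
    (hM : M ≠ 0) (h : N ∣ M) (hf : IsLevel f (levelGroup F N)) : IsLevel f (levelGroup F M) where
  isOpen := isOpen_levelGroup hM
  isCompact := isCompact_levelGroup hM
  det_eq := by rw [detGroup_levelGroup hM, comap_scalar_levelGroup hM]
  left k hk := hf.left k (levelGroup_mono hN hM h hk)
  right k hk := hf.right k (levelGroup_mono hN hM h hk)

/-- A priori the invariance of `f(·, x)` under `k` holds at a level depending on `x`. As `f(·, x)`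
depends only on the class of `det x` in a finite group, the product of finitely many levels works
for all `x`. -/
theorem exists_isLevel {f : (Fin 2 → Af F) → Gpi F → ℂ} (hf : f ∈ schwartz F) :
    ∃ N : ℕ, N ≠ 0 ∧ IsLevel f (levelGroup F N) := by
  classical
  obtain ⟨K, hK, -, hKf⟩ := hf.2.1
  obtain ⟨N₁, hN₁, h1⟩ := exists_levelGroup_subset hK (one_mem K)
  have hKf' : ∀ k ∈ levelGroup F N₁, ∀ v x, f v ((k, 1) * x) = f v x := fun k hk v x =>
    congrFun (hKf k (h1 hk) x) v
  have := finiteIndex_clSubgroup (isOpen_levelGroup (F := F) hN₁)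
  have : Finite (Ideles F ⧸ clSubgroup F (levelGroup F N₁)) := Subgroup.finite_quotient_of_finiteIndex
  have := Fintype.ofFinite (Ideles F ⧸ clSubgroup F (levelGroup F N₁))
  choose n hn hn' using fun q : Ideles F ⧸ clSubgroup F (levelGroup F N₁) =>
    (isSchwartzBruhat_of_mem_schwartz hf (ofDet q.out)).exists_levelGroup
  have hM : N₁ * ∏ q, n q ≠ 0 := mul_ne_zero hN₁ (Finset.prod_ne_zero_iff.2 fun q _ => hn q)
  refine ⟨N₁ * ∏ q, n q, hM, isOpen_levelGroup hM, isCompact_levelGroup hM,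
    by rw [detGroup_levelGroup hM, comap_scalar_levelGroup hM], fun k hk v x => ?_,
    fun k hk => hKf' k (levelGroup_mono hN₁ hM (dvd_mul_right _ _) hk)⟩
  set q : Ideles F ⧸ clSubgroup F (levelGroup F N₁) := QuotientGroup.mk (detIdele x) with hq
  have hx : (detIdele (ofDet q.out))⁻¹ * detIdele x ∈ clSubgroup F (levelGroup F N₁) := by
    have h2 : q.out⁻¹ * detIdele x ∈ clSubgroup F (levelGroup F N₁) :=
      QuotientGroup.eq.1 (Quotient.out_eq' q)
    have := mul_mem (detIdele_ofDet_inv_mul_mem (detGroup F (levelGroup F N₁)) q.out) h2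
    rwa [mul_assoc, mul_inv_cancel_left] at this
  have h3 := fun v => apply_eq_of_mem_clSubgroup hf (isOpen_levelGroup hN₁) hKf' hx v
  rw [h3, h3]
  exact hn' q k (levelGroup_mono (hn q) hM (Dvd.dvd.mul_left
    (Finset.dvd_prod_of_mem n (Finset.mem_univ q)) _) hk) v

/-! ### The horospherical map is well defined -/

theorem norm_classChar {K : Subgroup (GL (Fin 2) (Af F))}
    (hK : IsOpen (K : Set (GL (Fin 2) (Af F)))) {χ : Ideles F →* ℂˣ} (hχ : clSubgroup F K ≤ χ.ker)
    (t : Ideles F) : ‖(χ t : ℂ)‖ = 1 :=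
  have := finiteIndex_clSubgroup hK
  norm_apply_eq_one_of_finiteIndex hχ t

theorem finite_classChars {K : Subgroup (GL (Fin 2) (Af F))}
    (hK : IsOpen (K : Set (GL (Fin 2) (Af F)))) (m : ℕ) : (classChars F K m).Finite :=
  have := finiteIndex_clSubgroup hK
  (finite_setOf_le_ker (clSubgroup F K)).subset fun χ hχ => hχ.1

theorem mulVec_e_apply (g : Matrix (Fin 2) (Fin 2) (Af F)) (i : Fin 2) :
    g.mulVec ![1, 0] i = g i 0 := by
  simp [Matrix.mulVec, dotProduct]

theorem continuous_classChar {K : Subgroup (GL (Fin 2) (Af F))}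
    (hK : IsOpen (K : Set (GL (Fin 2) (Af F)))) {χ : Ideles F →* ℂˣ} (hχ : clSubgroup F K ≤ χ.ker) :
    Continuous fun t => (χ t : ℂ) :=
  ((isLocallyConstant_of_trivial_on χ _ (isOpen_idealClassSubgroup (isOpen_detGroup hK))
    fun u hu => hχ hu).comp fun u : ℂˣ => (u : ℂ)).continuous

/-- The transform is bounded and `χ` has absolute value `1`, so `integrable_of_norm_le` applies once
`t` is confined to a lattice. -/
theorem integrable_rhoIntegrand (m : ℕ) {f : (Fin 2 → Af F) → Gpi F → ℂ} (hf : f ∈ schwartz F)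
    {K : Subgroup (GL (Fin 2) (Af F))} (hK : IsOpen (K : Set (GL (Fin 2) (Af F))))
    {χ : Ideles F →* ℂˣ} (hχ : clSubgroup F K ≤ χ.ker) (g : Gpi F) :
    Integrable (rhoIntegrand F m f χ g) (mulMeasure F) := by
  have hφ := (isSchwartzBruhat_of_mem_schwartz hf g).finFourier
  set φ := finFourier F fun v => f v g with hφ'
  obtain ⟨C, hC⟩ := hφ.2.exists_bound_of_continuous hφ.continuous
  -- The idele `e` is a greatest common divisor of the first column of `g`. If `t g e¹` has
  -- denominator `N`, then `N e t` is integral.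
  obtain ⟨z, hz, e, -, he⟩ := exists_unit_eq_add_mul (column_ne_zero g.1)
    (eventually_max_norm_eq_one g.1)
  have hc : ∀ i : Fin 2, IsCompact ((fun v : Fin 2 → Af F => v i) '' tsupport φ) := fun i =>
    hφ.2.isCompact.image (continuous_apply i)
  obtain ⟨N, hN, h1⟩ := exists_nat_mul_mem_of_isCompact ((hc 0).union (hc 1))
  have hcont : Continuous (rhoIntegrand F m f χ g) := by
    refine ((hφ.continuous.comp ?_).mul ((continuous_classChar hK hχ).comp
      (continuous_finIdele.comp (continuous_const_mul _)))).mul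
      ((Complex.continuous_ofReal.comp (continuous_finNorm.comp (continuous_const_mul _))).pow _)
    exact continuous_pi fun i => Units.continuous_val.mul continuous_const
  refine integrable_of_norm_le (k := m + 2) (by omega) hcont
    (C * finNorm F (Matrix.GeneralLinearGroup.det g.1) ^ (m + 2))
    (Af.natUnit N hN * e)⁻¹ (fun t => ?_) fun t ht => ?_
  · rw [rhoIntegrand, norm_mul, norm_mul, norm_classChar hK hχ, mul_one, norm_pow,
      Complex.norm_real, Real.norm_of_nonneg (finNorm_pos _).le, finNorm_mul, mul_pow, ← mul_assoc]
    exact mul_le_mul_of_nonneg_right (mul_le_mul_of_nonneg_right (hC _)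
      (pow_nonneg (finNorm_pos _).le _)) (pow_nonneg (finNorm_pos _).le _)
  · by_contra h0
    have h2 : (t : Af F) • (g.1 : Matrix (Fin 2) (Fin 2) (Af F)).mulVec ![1, 0] ∈ tsupport φ := by
      refine subset_closure fun h3 => h0 ?_
      rw [rhoIntegrand, ← hφ', h3, zero_mul, zero_mul]
    apply ht
    rw [← inv_mul_mem_iff, inv_inv, mem_integralAdeles]
    intro v
    have h3 := mem_integralAdeles.1 (h1 _ (Or.inl ⟨_, h2, rfl⟩)) v
    have h4 := mem_integralAdeles.1 (h1 _ (Or.inr ⟨_, h2, rfl⟩)) v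
    simp only [Pi.smul_apply, mulVec_e_apply, smul_eq_mul, Af.mul_apply, norm_mul,
      Units.val_mul, Af.coe_natUnit] at h3 h4 ⊢
    rw [he]
    rcases max_choice ‖g.1 0 0 v‖ ‖g.1 1 0 v‖ with h5 | h5
    · rw [h5, mul_assoc, mul_comm ‖g.1 0 0 v‖]; exact h3
    · rw [h5, mul_assoc, mul_comm ‖g.1 1 0 v‖]; exact h4

theorem rhoIntegrand_mul (m : ℕ) {f : (Fin 2 → Af F) → Gpi F → ℂ} (χ : Ideles F →* ℂˣ) (g : Gpi F)
    {z : (Af F)ˣ} (hz : z ∈ integralUnits F) (h : ∀ v, f ((z : Af F) • v) g = f v g)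
    (t : (Af F)ˣ) :
    rhoIntegrand F m f χ g (z * t) = χ (finIdele F z) * rhoIntegrand F m f χ g t := by
  rw [rhoIntegrand, rhoIntegrand, Units.val_mul, mul_smul, finFourier_units_smul hz h,
    mul_left_comm _ z t, map_mul, map_mul, finNorm_mul, finNorm_eq_one hz, one_mul, Units.val_mul]
  ring

/-- The contribution of characters which are not of level `K` vanishes. -/
theorem integral_rhoIntegrand_eq_zero (m : ℕ) {f : (Fin 2 → Af F) → Gpi F → ℂ}
    {χ : Ideles F →* ℂˣ} (g : Gpi F) {z : (Af F)ˣ} (hz : z ∈ integralUnits F)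
    (h : ∀ v, f ((z : Af F) • v) g = f v g) (hχ : χ (finIdele F z) ≠ 1) :
    ∫ t, rhoIntegrand F m f χ g t ∂mulMeasure F = 0 := by
  have h1 := integral_mul_left_mulMeasure (rhoIntegrand F m f χ g) z
  simp only [rhoIntegrand_mul m χ g hz h] at h1
  rw [integral_const_mul] at h1
  by_contra h2
  exact hχ (Units.ext ((mul_eq_right₀ h2).1 h1))

theorem clSubgroup_mono {K L : Subgroup (GL (Fin 2) (Af F))} (h : K ≤ L) :
    clSubgroup F K ≤ clSubgroup F L :=
  idealClassSubgroup_mono (Subgroup.map_mono h)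

theorem mem_ker_of_realIdele_pos {m : ℕ} {χ : Ideles F →* ℂˣ}
    (hχ : ∀ x : InfinitePlace F → ℝˣ,
      ((χ (realIdele F x) : ℂˣ) : ℂ) = ((realSign (∏ v, (x v : ℝ)) : ℤˣ) : ℤ) ^ m)
    {x : InfinitePlace F → ℝˣ} (hx : ∀ v, 0 < (x v : ℝ)) : χ (realIdele F x) = 1 := by
  refine Units.ext ((hχ x).trans ?_)
  rw [realSign_of_pos (Finset.prod_pos fun v _ => hx v)]
  simp

/-- A character of level `L` that is not of level `K` is non-trivial on some `z` in `det K`, and its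
integral vanishes by `integral_rhoIntegrand_eq_zero`. -/
theorem rhoAt_eq_of_le (m : ℕ) {f : (Fin 2 → Af F) → Gpi F → ℂ} (hf : f ∈ schwartz F)
    {K L : Subgroup (GL (Fin 2) (Af F))} (hK : IsLevel f K) (h : L ≤ K) :
    rhoAt F m L f = rhoAt F m K f := by
  funext g
  refine finsum_mem_inter_support_eq' _ _ _ fun χ hχ => ⟨fun h1 => ⟨?_, h1.2⟩, fun h1 =>
    ⟨(clSubgroup_mono h).trans h1.1, h1.2⟩⟩
  have h2 := h1.1
  rw [clSubgroup_eq, idealClassSubgroup, sup_le_iff, sup_le_iff] at h2 ⊢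
  refine ⟨⟨?_, h2.1.2⟩, h2.2⟩
  rintro _ ⟨z, hz, rfl⟩
  by_contra h3
  apply hχ
  -- The condition `det K = K ∩ Z` turns the determinant `z` into a scalar matrix of `K`, under
  -- which `f` is invariant.
  rw [SetLike.mem_coe, hK.det_eq] at hz
  have hz' : Matrix.GeneralLinearGroup.scalar (Fin 2) z ∈ K := hz
  simp only
  rw [integral_rhoIntegrand_eq_zero m g (mem_integralUnits_of_scalar_mem hK.isCompact hz')
    (fun v => ?_) h3, mul_zero]
  rw [← hK.left _ hz' v g]
  congr 1
  funext i
  simp [Matrix.GeneralLinearGroup.scalar]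

theorem exists_levelGroup_le {K L : Subgroup (GL (Fin 2) (Af F))}
    (hK : IsOpen (K : Set (GL (Fin 2) (Af F)))) (hL : IsOpen (L : Set (GL (Fin 2) (Af F)))) :
    ∃ N : ℕ, N ≠ 0 ∧ levelGroup F N ≤ K ∧ levelGroup F N ≤ L := by
  obtain ⟨N, hN, h⟩ := exists_levelGroup_subset (hK.inter hL) ⟨one_mem K, one_mem L⟩
  exact ⟨N, hN, fun k hk => (h hk).1, fun k hk => (h hk).2⟩

/-- The level picked in the definition and the given one are compared through a congruence subgroup
contained in both. -/
theorem rho_eq_rhoAt (m : ℕ) {f : (Fin 2 → Af F) → Gpi F → ℂ} (hf : f ∈ schwartz F)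
    {K : Subgroup (GL (Fin 2) (Af F))} (hK : IsLevel f K) : rho F m f = rhoAt F m K f := by
  have h : ∃ K, IsLevel f K := ⟨K, hK⟩
  rw [rho, dif_pos h]
  obtain ⟨N, hN, h1, h2⟩ := exists_levelGroup_le h.choose_spec.isOpen hK.isOpen
  rw [← rhoAt_eq_of_le m hf h.choose_spec h1, ← rhoAt_eq_of_le m hf hK h2]

theorem rho_eq_rhoAt_levelGroup (m : ℕ) {f : (Fin 2 → Af F) → Gpi F → ℂ} (hf : f ∈ schwartz F)
    {N M : ℕ} (hN : N ≠ 0) (hM : M ≠ 0) (h : N ∣ M) (hf' : IsLevel f (levelGroup F N)) :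
    rho F m f = rhoAt F m (levelGroup F M) f :=
  rho_eq_rhoAt m hf (isLevel_levelGroup_mono hN hM h hf')

theorem rho_add (m : ℕ) {f f' : (Fin 2 → Af F) → Gpi F → ℂ} (hf : f ∈ schwartz F)
    (hf' : f' ∈ schwartz F) : rho F m (f + f') = rho F m f + rho F m f' := by
  obtain ⟨N₁, hN₁, h1⟩ := exists_isLevel hf
  obtain ⟨N₂, hN₂, h2⟩ := exists_isLevel hf'
  obtain ⟨N₃, hN₃, h3⟩ := exists_isLevel (add_mem hf hf')
  have hN : N₁ * N₂ * N₃ ≠ 0 := mul_ne_zero (mul_ne_zero hN₁ hN₂) hN₃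
  rw [rho_eq_rhoAt_levelGroup m hf hN₁ hN ⟨N₂ * N₃, by ring⟩ h1,
    rho_eq_rhoAt_levelGroup m hf' hN₂ hN ⟨N₁ * N₃, by ring⟩ h2,
    rho_eq_rhoAt_levelGroup m (add_mem hf hf') hN₃ hN ⟨N₁ * N₂, by ring⟩ h3]
  funext g
  rw [Pi.add_apply, rhoAt, rhoAt, rhoAt,
    ← finsum_mem_add_distrib (finite_classChars (isOpen_levelGroup hN) m)]
  refine finsum_mem_congr rfl fun χ hχ => ?_
  rw [← mul_add, ← integral_add (integrable_rhoIntegrand m hf (isOpen_levelGroup hN) hχ.1 g)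
    (integrable_rhoIntegrand m hf' (isOpen_levelGroup hN) hχ.1 g)]
  congr 2
  funext t
  have h4 : (finFourier F fun v => (f + f') v g) =
      finFourier F (fun v => f v g) + finFourier F (fun v => f' v g) :=
    FourierIntegrable.finFourier_add (isSchwartzBruhat_of_mem_schwartz hf g).fourierIntegrable
      (isSchwartzBruhat_of_mem_schwartz hf' g).fourierIntegrable
  rw [rhoIntegrand, h4, Pi.add_apply, add_mul, add_mul]
  rfl

theorem rho_smul (m : ℕ) {f : (Fin 2 → Af F) → Gpi F → ℂ} (hf : f ∈ schwartz F) (c : ℂ) :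
    rho F m (c • f) = c • rho F m f := by
  obtain ⟨N, hN, h⟩ := exists_isLevel hf
  have h' : IsLevel (c • f) (levelGroup F N) := ⟨h.isOpen, h.isCompact, h.det_eq,
    fun k hk v x => congrArg (c * ·) (h.left k hk v x),
    fun k hk v x => congrArg (c * ·) (h.right k hk v x)⟩
  rw [rho_eq_rhoAt m hf h, rho_eq_rhoAt m (Submodule.smul_mem _ c hf) h']
  funext g
  rw [Pi.smul_apply, smul_eq_mul, rhoAt, rhoAt, mul_finsum_mem]
  refine finsum_mem_congr rfl fun χ hχ => ?_
  rw [mul_left_comm, ← integral_const_mul c]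
  congr 2
  funext t
  have h4 : (finFourier F fun v => (c • f) v g) = fun v => c * finFourier F (fun v => f v g) v :=
    finFourier_const_mul c _
  rw [rhoIntegrand, h4, rhoIntegrand, mul_assoc, mul_assoc, mul_assoc]

end

section

variable {F : Type*} [Field F] [NumberField F] [IsTotallyReal F]

/-! ### The horospherical map takes values in the induced module -/

/-- The idele norm as a character. -/
def ideleNormHom (F : Type*) [Field F] [NumberField F] [IsTotallyReal F] : Ideles F →* ℂˣ where
  toFun t := Units.mk0 (ideleNorm t : ℂ) (Complex.ofReal_ne_zero.2 (ideleNorm_pos t).ne')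
  map_one' := by
    refine Units.ext ?_
    have h := ideleNorm_mul (F := F) 1 1
    rw [mul_one] at h
    have h1 := (mul_eq_left₀ (ideleNorm_pos (1 : Ideles F)).ne').1 h.symm
    simp [h1]
  map_mul' s t := Units.ext (by simp [ideleNorm_mul])

theorem coe_ideleNormHom (t : Ideles F) : (ideleNormHom F t : ℂ) = ideleNorm t := rfl

/-- The character `(t₁, t₂) ↦ η(t₁ t₂) χ(t₂) ‖t₂‖^{m+2}`. -/
def heckeOf (m : ℕ) (η χ : Ideles F →* ℂˣ) : Ideles F × Ideles F →* ℂˣ :=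
  η.comp (MonoidHom.fst _ _) * (η * χ * ideleNormHom F ^ (m + 2)).comp (MonoidHom.snd _ _)

theorem heckeOf_apply (m : ℕ) (η χ : Ideles F →* ℂˣ) (s t : Ideles F) :
    heckeOf m η χ (s, t) = η (s * t) * χ t * ideleNormHom F t ^ (m + 2) := by
  simp only [heckeOf, MonoidHom.mul_apply, MonoidHom.comp_apply, MonoidHom.coe_fst,
    MonoidHom.coe_snd, MonoidHom.pow_apply, map_mul]
  rw [mul_assoc, mul_assoc, mul_assoc]

theorem coe_realNorm (x : InfinitePlace F → ℝˣ) :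
    (realNorm F x : ℂ) = ((∏ v, (x v : ℝ) : ℝ) : ℂ) := by
  simp [realNorm, Units.coe_prod]

theorem prod_signReal (ε : Signs F) : ∏ v, (signReal F ε v : ℝ) = (((∏ v, ε v : ℤˣ) : ℤ) : ℝ) := by
  simp [coe_signReal_apply, Units.coe_prod]

theorem ideleNormHom_realIdele_signReal (ε : Signs F) :
    ideleNormHom F (realIdele F (signReal F ε)) = 1 := by
  refine Units.ext ?_
  rw [coe_ideleNormHom, ideleNorm_realIdele]
  have : ∀ v, |(signReal F ε v : ℝ)| = 1 := fun v => by
    rw [coe_signReal_apply]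
    rcases Int.units_eq_one_or (ε v) with h | h <;> simp [h]
  rw [Finset.prod_congr rfl fun v _ => this v, Finset.prod_const_one, Complex.ofReal_one,
    Units.val_one]

theorem gammaChar_one (m : ℕ) (x y : InfinitePlace F → ℝˣ) :
    gammaChar F m 1 x y = (realNorm F y ^ (m + 2))⁻¹ := by
  rw [gammaChar, sub_self, neg_zero, zpow_zero, mul_one, zpow_neg]
  congr 1

/-- The parity condition `χ = sgn(N)^m` cancels the sign of `N(t₂)^{-(m+2)}`. Only `η` of the
product of the signs is left, and this is trivial on the centre. -/
theorem heckeSign_heckeOf {m : ℕ} (η χ : Ideles F →* ℂˣ)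
    (hχ : ∀ x : InfinitePlace F → ℝˣ,
      ((χ (realIdele F x) : ℂˣ) : ℂ) = ((realSign (∏ v, (x v : ℝ)) : ℤˣ) : ℤ) ^ m)
    (ε₁ ε₂ : Signs F) :
    heckeSign F m 1 (heckeOf m η χ) ε₁ ε₂ = η (realIdele F (signReal F (ε₁ * ε₂))) := by
  rw [heckeSign, heckeOf_apply, gammaChar_one, ideleNormHom_realIdele_signReal, one_pow, mul_one,
    map_mul (signReal F), map_mul (realIdele F), mul_assoc]
  refine mul_eq_left.2 (Units.ext ?_)
  rw [Units.val_mul, hχ, Units.val_inv_eq_inv_val, Units.val_pow_eq_pow_val, coe_realNorm,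
    prod_signReal, realSign_intUnits]
  rcases Int.units_eq_one_or (∏ v, ε₂ v) with h | h
  · simp [h]
  · simp [h, pow_add]

theorem continuous_of_clSubgroup_le_ker {K : Subgroup (GL (Fin 2) (Af F))}
    (hK : IsOpen (K : Set (GL (Fin 2) (Af F)))) {η : Ideles F →* ℂˣ}
    (hη : clSubgroup F K ≤ η.ker) : Continuous η :=
  (isLocallyConstant_of_trivial_on η _ (isOpen_idealClassSubgroup (isOpen_detGroup hK))
    fun u hu => hη hu).continuous

theorem heckeOf_mem_heckeChars {m : ℕ} {K : Subgroup (GL (Fin 2) (Af F))}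
    (hK : IsOpen (K : Set (GL (Fin 2) (Af F)))) {η χ : Ideles F →* ℂˣ}
    (hη : clSubgroup F K ≤ η.ker) (hχ : χ ∈ classChars F K m) :
    heckeOf m η χ ∈ heckeChars F m := by
  have hpr : ∀ {θ : Ideles F →* ℂˣ}, clSubgroup F K ≤ θ.ker → ∀ a, θ (principal F a) = 1 :=
    fun h a => h (Subgroup.mem_sup_right ⟨a, rfl⟩)
  have hpos : ∀ {θ : Ideles F →* ℂˣ}, clSubgroup F K ≤ θ.ker → ∀ x : InfinitePlace F → ℝˣ,
      (∀ v, 0 < (x v : ℝ)) → θ (realIdele F x) = 1 := fun h x hx =>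
    h (Subgroup.mem_sup_left (Subgroup.mem_sup_right ⟨x, fun v _ => hx v, rfl⟩))
  refine ⟨⟨?_, fun a b => ?_, fun x y hx hy => ?_⟩, fun ε => ?_⟩
  · have h1 := continuous_of_clSubgroup_le_ker hK hη
    have h2 := continuous_of_clSubgroup_le_ker hK hχ.1
    have h3 : Continuous (ideleNormHom F) := Units.isEmbedding_val₀.continuous_iff.2
      (Complex.continuous_ofReal.comp continuous_ideleNorm)
    have : (heckeOf m η χ : Ideles F × Ideles F → ℂˣ) = fun p =>
        η (p.1 * p.2) * χ p.2 * ideleNormHom F p.2 ^ (m + 2) := funext fun p => heckeOf_apply ..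
    rw [this]
    fun_prop
  · rw [heckeOf_apply, ← map_mul, hpr hη, hpr hχ.1, one_mul, one_mul]
    refine Units.ext ?_
    rw [Units.val_pow_eq_pow_val, coe_ideleNormHom, ideleNorm_principal]
    simp
  · rw [heckeOf_apply, ← map_mul, hpos hη _ fun v => mul_pos (hx v) (hy v), hpos hχ.1 _ hy,
      one_mul, one_mul, gammaChar_one, inv_inv]
    congr 1
    refine Units.ext ?_
    rw [coe_ideleNormHom, ideleNorm_realIdele, coe_realNorm]
    congr 2
    funext v
    exact abs_of_pos (hy v)
  · rw [heckeSign_heckeOf η χ hχ.2, signs_mul_self, map_one, map_one, map_one]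

theorem heckeTilde_heckeOf {m : ℕ} (η : Ideles F →* ℂˣ) {χ : Ideles F →* ℂˣ}
    (hχ : ∀ x : InfinitePlace F → ℝˣ,
      ((χ (realIdele F x) : ℂˣ) : ℂ) = ((realSign (∏ v, (x v : ℝ)) : ℤˣ) : ℤ) ^ m)
    (b : BorelPi F) : heckeTilde F m 1 (heckeOf m η χ) b =
      η (detIdele b.toGpi) * (χ (finIdele F b.t₂) * (finNorm F b.t₂ : ℂ) ^ (m + 2)) := by
  rw [heckeTilde, heckeSign_heckeOf η χ hχ, heckeOf_apply, detIdele, toGpi_eq, det_borel]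
  simp only [map_mul, Units.val_mul, Units.val_pow_eq_pow_val, coe_ideleNormHom,
    ideleNorm_finIdele]
  ring

theorem mulVec_mul_borel (x : GL (Fin 2) (Af F)) (t₁ t₂ : (Af F)ˣ) (u : Af F) :
    ((x * borel t₁ t₂ u : GL (Fin 2) (Af F)) : Matrix (Fin 2) (Fin 2) (Af F)).mulVec ![1, 0] =
      (t₁ : Af F) • (x : Matrix (Fin 2) (Fin 2) (Af F)).mulVec ![1, 0] := by
  funext i
  rw [Pi.smul_apply, mulVec_e_apply, mulVec_e_apply, Units.val_mul, Matrix.mul_apply, coe_borel]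
  simp [mul_comm]

/-- Since `b e¹ = t₁ e¹`, replacing `t` by `t₁⁻¹ t` removes `t₁` from the argument of the transform
and leaves `t₂` in the determinant. -/
theorem rhoIntegrand_mul_toGpi {m : ℕ} {f : (Fin 2 → Af F) → Gpi F → ℂ} (χ : Ideles F →* ℂˣ)
    (x : Gpi F) (b : BorelPi F) (t : (Af F)ˣ) :
    rhoIntegrand F m f χ (x * b.toGpi) (b.t₁⁻¹ * t) =
      (χ (finIdele F b.t₂) * (finNorm F b.t₂ : ℂ) ^ (m + 2)) *
      (fourier f ((t : Af F) • (x.1 : Matrix (Fin 2) (Fin 2) (Af F)).mulVec ![1, 0])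
          (x * b.toGpi) *
        (χ (finIdele F (Matrix.GeneralLinearGroup.det x.1 * t)) : ℂˣ) *
        (finNorm F (Matrix.GeneralLinearGroup.det x.1 * t) : ℂ) ^ (m + 2)) := by
  have h1 : Matrix.GeneralLinearGroup.det (x * b.toGpi).1 * (b.t₁⁻¹ * t) =
      b.t₂ * (Matrix.GeneralLinearGroup.det x.1 * t) := by
    rw [Prod.fst_mul, map_mul, toGpi_eq, det_borel, mul_comm b.t₁ b.t₂, mul_assoc, mul_assoc,
      mul_inv_cancel_left, mul_left_comm]
  have h2 : b.t₁⁻¹ * t * b.t₁ = t := by rw [mul_right_comm, inv_mul_cancel, one_mul]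
  rw [rhoIntegrand, h1, Prod.fst_mul, toGpi_eq, mulVec_mul_borel, smul_smul, ← Units.val_mul, h2, map_mul (finIdele F), map_mul χ, Units.val_mul,
    finNorm_mul b.t₂, Complex.ofReal_mul, mul_pow, fourier]
  ring

/-- The transform of `f` lies in `𝒮` and has a level of its own. For `k` in a common level, `\hat
f(k v, k x) = \hat f(v, x)`, while `χ` and the norm are trivial on `det k`. -/
theorem rho_isSmooth (m : ℕ) {f : (Fin 2 → Af F) → Gpi F → ℂ} (hf : f ∈ schwartz F) :
    IsSmooth F (rho F m f) := by
  obtain ⟨N₁, hN₁, h1⟩ := exists_isLevel hf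
  obtain ⟨N₂, hN₂, h2⟩ := exists_isLevel (fourier_mem_schwartz hf)
  have hN : N₁ * N₂ ≠ 0 := mul_ne_zero hN₁ hN₂
  rw [rho_eq_rhoAt_levelGroup m hf hN₁ hN (dvd_mul_right _ _) h1]
  have h2' := isLevel_levelGroup_mono hN₂ hN (dvd_mul_left _ _) h2
  refine ⟨levelGroup F (N₁ * N₂), isOpen_levelGroup hN, isCompact_levelGroup hN, fun k hk x => ?_⟩
  refine finsum_mem_congr rfl fun χ hχ => ?_
  congr 2
  funext t
  have hd := det_mem_unitLevel hN hk
  have h3 : χ (finIdele F (Matrix.GeneralLinearGroup.det k)) = 1 :=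
    hχ.1 (Subgroup.mem_sup_left (Subgroup.mem_sup_left ⟨_, ⟨k, hk, rfl⟩, rfl⟩))
  have h4 : ∀ v, finFourier F (fun v => f v ((k, 1) * x))
      ((k : Matrix (Fin 2) (Fin 2) (Af F)).mulVec v) = finFourier F (fun v => f v x) v := fun v =>
    (h2'.right k hk _ x).trans (h2'.left k hk v x)
  have h5 : Matrix.GeneralLinearGroup.det (((k, 1) * x : Gpi F)).1 * t =
      Matrix.GeneralLinearGroup.det k * (Matrix.GeneralLinearGroup.det x.1 * t) := by
    rw [Prod.fst_mul, map_mul, mul_assoc]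
  rw [rhoIntegrand, rhoIntegrand, h5, Prod.fst_mul, finNorm_mul (Matrix.GeneralLinearGroup.det k),
    finNorm_eq_one (unitLevel_le_integralUnits hN hd), map_mul (finIdele F), map_mul χ, h3, one_mul,
    one_mul, Units.val_mul, ← Matrix.mulVec_mulVec, ← Matrix.mulVec_smul, h4]

/-- Apart from the factor in `t₂`, the integral at `x b` is a function of the class of `det b` in a
finite group. Its characters `η` give the components in the span. -/
theorem rho_mem_induced (m : ℕ) {f : (Fin 2 → Af F) → Gpi F → ℂ} (hf : f ∈ schwartz F) :
    rho F m f ∈ induced F (heckeTilde F m 1 '' heckeChars F m) := by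
  refine ⟨rho_isSmooth m hf, fun x => ?_⟩
  obtain ⟨N₁, hN₁, h1⟩ := exists_isLevel hf
  obtain ⟨N₂, hN₂, h2⟩ := exists_isLevel (fourier_mem_schwartz hf)
  have hN : N₁ * N₂ ≠ 0 := mul_ne_zero hN₁ hN₂
  have h2' := isLevel_levelGroup_mono hN₂ hN (dvd_mul_left _ _) h2
  have hK := isOpen_levelGroup (F := F) hN
  set K := levelGroup F (N₁ * N₂) with hKdef
  have := finiteIndex_clSubgroup hK
  have : Finite (Ideles F ⧸ clSubgroup F K) := Subgroup.finite_quotient_of_finiteIndex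
  rw [rho_eq_rhoAt_levelGroup m hf hN₁ hN (dvd_mul_right _ _) h1]
  -- the integrals as functions on the class group
  let H : (Ideles F →* ℂˣ) → Ideles F ⧸ clSubgroup F K → ℂ := fun χ q =>
    ∫ t, fourier f ((t : Af F) • (x.1 : Matrix (Fin 2) (Fin 2) (Af F)).mulVec ![1, 0])
        (x * ofDet q.out) *
      (χ (finIdele F (Matrix.GeneralLinearGroup.det x.1 * t)) : ℂˣ) *
      (finNorm F (Matrix.GeneralLinearGroup.det x.1 * t) : ℂ) ^ (m + 2) ∂mulMeasure F
  have hH : ∀ χ (b : BorelPi F), ∫ t, rhoIntegrand F m f χ (x * b.toGpi) t ∂mulMeasure F =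
      (χ (finIdele F b.t₂) * (finNorm F b.t₂ : ℂ) ^ (m + 2)) *
        H χ (QuotientGroup.mk (detIdele b.toGpi)) := by
    intro χ b
    rw [← integral_mul_left_mulMeasure _ b.t₁⁻¹, ← integral_const_mul]
    congr 1
    funext t
    rw [rhoIntegrand_mul_toGpi]
    congr 3
    refine apply_eq_of_mem_clSubgroup (fourier_mem_schwartz hf) hK h2'.right ?_ _
    have h3 : (Quotient.out (QuotientGroup.mk (s := clSubgroup F K) (detIdele b.toGpi)))⁻¹ *
        detIdele b.toGpi ∈ clSubgroup F K := QuotientGroup.eq.1 (Quotient.out_eq' _)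
    have h4 := mul_mem (detIdele_ofDet_inv_mul_mem (detGroup F K)
      (Quotient.out (QuotientGroup.mk (s := clSubgroup F K) (detIdele b.toGpi)))) h3
    rw [mul_assoc, mul_inv_cancel_left] at h4
    rw [detIdele_mul, detIdele_mul, mul_inv, mul_mul_mul_comm, inv_mul_cancel, one_mul]
    exact h4
  have hfin := finite_classChars hK m
  choose s a ha using fun χ => exists_eq_sum_characters (H χ)
  have hrho : (fun b : BorelPi F => rhoAt F m K f (x * b.toGpi)) =
      ∑ χ ∈ hfin.toFinset, ∑ η ∈ s χ, (gammaFactor F m * a χ η) •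
        fun b : BorelPi F => (η (QuotientGroup.mk (detIdele b.toGpi)) : ℂ) *
          (χ (finIdele F b.t₂) * (finNorm F b.t₂ : ℂ) ^ (m + 2)) := by
    funext b
    rw [rhoAt, finsum_mem_eq_finite_toFinset_sum _ hfin, Finset.sum_apply]
    refine Finset.sum_congr rfl fun χ _ => ?_
    rw [hH, ha, Finset.sum_apply, Finset.mul_sum, Finset.mul_sum]
    refine Finset.sum_congr rfl fun η _ => ?_
    rw [Pi.smul_apply, smul_eq_mul]
    ring
  rw [hrho]
  refine Submodule.sum_mem _ fun χ hχ => Submodule.sum_mem _ fun η _ => Submodule.smul_mem _ _ ?_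
  have hχ' := hfin.mem_toFinset.1 hχ
  refine Submodule.subset_span ⟨heckeOf m (η.comp (QuotientGroup.mk' _)) χ,
    heckeOf_mem_heckeChars hK (fun t ht => ?_) hχ', funext fun b => ?_⟩
  · rw [MonoidHom.mem_ker, MonoidHom.comp_apply, QuotientGroup.mk'_apply,
      (QuotientGroup.eq_one_iff t).2 ht, map_one]
  · rw [heckeTilde_heckeOf _ hχ'.2]
    rfl

end

section

variable {F : Type*} [Field F] [NumberField F]

/-! ### Hecke characters -/

/-- `ℂˣ` has no small subgroups. -/
theorem eq_one_of_forall_norm_pow_sub_one_lt {z : ℂ} (h : ∀ n : ℕ, ‖z ^ n - 1‖ < 1 / 2) :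
    z = 1 := by
  -- Repeated squaring: `w² - 1 = (w + 1)(w - 1)`, and `‖w + 1‖ ≥ 3/2` when `‖w - 1‖ < 1/2`. The
  -- distance to `1` would grow geometrically.
  have h1 : ∀ n : ℕ, (3 / 2 : ℝ) ^ n * ‖z - 1‖ ≤ ‖z ^ 2 ^ n - 1‖ := by
    intro n
    induction n with
    | zero => simp
    | succ n ih =>
      have e : z ^ 2 ^ (n + 1) - 1 = (z ^ 2 ^ n + 1) * (z ^ 2 ^ n - 1) := by ring
      have h2 : (3 / 2 : ℝ) ≤ ‖z ^ 2 ^ n + 1‖ := by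
        have h3 := norm_sub_norm_le (2 : ℂ) (-(z ^ 2 ^ n - 1))
        rw [norm_neg, Complex.norm_ofNat, show (2 : ℂ) - -(z ^ 2 ^ n - 1) = z ^ 2 ^ n + 1 by ring]
          at h3
        linarith [h (2 ^ n)]
      rw [e, norm_mul, pow_succ, mul_comm ((3 / 2 : ℝ) ^ n), mul_assoc]
      exact mul_le_mul h2 ih (by positivity) (norm_nonneg _)
  by_contra hz
  have h0 : 0 < ‖z - 1‖ := norm_pos_iff.2 (sub_ne_zero.2 hz)
  obtain ⟨n, hn⟩ := pow_unbounded_of_one_lt (‖z - 1‖⁻¹) (by norm_num : (1 : ℝ) < 3 / 2)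
  have h2 : 1 < (3 / 2 : ℝ) ^ n * ‖z - 1‖ := by
    rwa [inv_lt_iff_one_lt_mul₀ h0] at hn
  linarith [h1 n, h (2 ^ n)]

theorem exists_unitLevel_trivial (θ : (Af F)ˣ →* ℂˣ) (hθ : Continuous θ) :
    ∃ N : ℕ, N ≠ 0 ∧ ∀ u ∈ unitLevel F N, θ u = 1 := by
  obtain ⟨N, hN, h⟩ := exists_unitLevel_subset (F := F)
    (U := {t | ‖(θ t : ℂ) - 1‖ < 1 / 2})
    (isOpen_lt (((Units.continuous_val.comp hθ).sub continuous_const).norm) continuous_const)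
    (by simp)
  refine ⟨N, hN, fun u hu => Units.ext (eq_one_of_forall_norm_pow_sub_one_lt fun n => ?_)⟩
  have := h (pow_mem hu n)
  rwa [Set.mem_ofPred_eq, map_pow, Units.val_pow_eq_pow_val] at this

variable [IsTotallyReal F]

/-- The character `η` of a Hecke character `φ(t₁, t₂) = η(t₁ t₂) χ(t₂) ‖t₂‖^{m+2}`. -/
def etaHom (φ : Ideles F × Ideles F →* ℂˣ) : Ideles F →* ℂˣ := φ.comp (MonoidHom.inl _ _)

/-- The character `χ` of a Hecke character `φ(t₁, t₂) = η(t₁ t₂) χ(t₂) ‖t₂‖^{m+2}`. -/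
def chiHom (m : ℕ) (φ : Ideles F × Ideles F →* ℂˣ) : Ideles F →* ℂˣ :=
  φ.comp (MonoidHom.inr _ _) * (etaHom φ)⁻¹ * (ideleNormHom F ^ (m + 2))⁻¹

theorem etaHom_apply (φ : Ideles F × Ideles F →* ℂˣ) (t : Ideles F) : etaHom φ t = φ (t, 1) := rfl

theorem chiHom_apply (m : ℕ) (φ : Ideles F × Ideles F →* ℂˣ) (t : Ideles F) :
    chiHom m φ t = φ (1, t) * (φ (t, 1))⁻¹ * (ideleNormHom F t ^ (m + 2))⁻¹ := rfl

theorem heckeOf_etaHom_chiHom (m : ℕ) (φ : Ideles F × Ideles F →* ℂˣ) :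
    heckeOf m (etaHom φ) (chiHom m φ) = φ := by
  refine MonoidHom.ext fun p => ?_
  obtain ⟨s, t⟩ := p
  rw [heckeOf_apply, chiHom_apply, ← etaHom_apply φ t, map_mul, etaHom_apply φ s]
  have : φ (s, t) = φ (s, 1) * φ (1, t) := by rw [← map_mul]; simp
  rw [this, ← etaHom_apply φ s]
  have e : ∀ a b c d : ℂˣ, a * b * (c * b⁻¹ * d⁻¹) * d = a * c := fun a b c d => by
    rw [mul_comm c, ← mul_assoc, ← mul_assoc, mul_inv_cancel_right, inv_mul_cancel_right]
  exact e _ _ _ _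

theorem heckeEta_eq (φ : Ideles F × Ideles F →* ℂˣ) (t : Ideles F) :
    heckeEta φ t = etaHom φ t := rfl

theorem heckeChi_eq (m : ℕ) (φ : Ideles F × Ideles F →* ℂˣ) (t : (Af F)ˣ) :
    heckeChi m φ t = chiHom m φ (finIdele F t) := by
  rw [chiHom_apply, Units.val_mul, Units.val_inv_eq_inv_val, Units.val_pow_eq_pow_val,
    coe_ideleNormHom, ideleNorm_finIdele]
  rfl

theorem etaHom_signReal_sq (φ : Ideles F × Ideles F →* ℂˣ) (ε : Signs F) :
    φ (realIdele F (signReal F ε), 1) * φ (realIdele F (signReal F ε), 1) = 1 := by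
  rw [← map_mul, Prod.mk_mul_mk, ← map_mul, ← map_mul, signs_mul_self, map_one, map_one, one_mul,
    Prod.mk_one_one, map_one]

section

variable {m : ℕ} {φ : Ideles F × Ideles F →* ℂˣ}

theorem etaHom_realIdele_of_pos (hφ : φ ∈ heckeChars F m) {x : InfinitePlace F → ℝˣ} (hx : ∀ v, 0 < (x v : ℝ)) :
    etaHom φ (realIdele F x) = 1 := by
  have := hφ.1.map_pos x 1 hx fun v => one_pos
  rw [map_one, gammaChar_one] at this
  rw [etaHom_apply, this]
  simp [realNorm]

/-- Split `x` into a positive element and a family of signs. The type of `φ` settles the positive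
part, triviality on the real centre the signs. -/
theorem chiHom_realIdele (hφ : φ ∈ heckeChars F m) (x : InfinitePlace F → ℝˣ) :
    ((chiHom m φ (realIdele F x) : ℂˣ) : ℂ) = ((realSign (∏ v, (x v : ℝ)) : ℤˣ) : ℤ) ^ m := by
  set ε := signHom x with hε
  set y := x * signReal F ε with hy
  have hypos : ∀ v, 0 < (y v : ℝ) := mul_signReal_pos x
  have hss : signReal F ε * signReal F ε = 1 := by rw [← map_mul, signs_mul_self, map_one]
  have hx : x = y * signReal F ε := by rw [hy, mul_assoc, hss, mul_one]
  have h1 : chiHom m φ (realIdele F y) = 1 := by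
    have h2 := hφ.1.map_pos 1 y (fun v => one_pos) hypos
    rw [map_one, gammaChar_one, inv_inv] at h2
    rw [chiHom_apply, h2, ← etaHom_apply, etaHom_realIdele_of_pos hφ hypos, inv_one, mul_one]
    refine mul_inv_eq_one.2 ?_
    congr 1
    refine Units.ext ?_
    rw [coe_ideleNormHom, ideleNorm_realIdele, coe_realNorm]
    congr 2
    funext v
    exact (abs_of_pos (hypos v)).symm
  have h3 : ∏ v, (x v : ℝ) = (∏ v, (y v : ℝ)) * ∏ v, (signReal F ε v : ℝ) := by
    rw [← Finset.prod_mul_distrib]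
    conv_lhs => rw [hx]
    rfl
  have hp : 0 < ∏ v, (y v : ℝ) := Finset.prod_pos fun v _ => hypos v
  have hs0 : ∏ v, (signReal F ε v : ℝ) ≠ 0 :=
    Finset.prod_ne_zero_iff.2 fun v _ => (signReal F ε v).ne_zero
  -- Triviality on the centre computes `φ(ε, ε)`, and `φ(ε, 1)` is its own inverse.
  have h4 : φ (1, realIdele F (signReal F ε)) * (φ (realIdele F (signReal F ε), 1))⁻¹ =
      realNorm F (signReal F ε) ^ (m + 2) := by
    have h5 := hφ.2 ε
    rw [heckeSign, gammaChar_one, mul_inv_eq_one] at h5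
    have h6 : φ (realIdele F (signReal F ε), realIdele F (signReal F ε)) =
        φ (1, realIdele F (signReal F ε)) * φ (realIdele F (signReal F ε), 1) := by
      rw [← map_mul]; simp
    rw [← h5, h6, inv_eq_of_mul_eq_one_right (etaHom_signReal_sq φ ε)]
  rw [h3, realSign_mul hp.ne' hs0, realSign_of_pos hp, one_mul, prod_signReal, realSign_intUnits]
  conv_lhs => rw [hx]
  rw [map_mul, map_mul, h1, one_mul, chiHom_apply, h4, ideleNormHom_realIdele_signReal, one_pow,
    inv_one, mul_one, Units.val_pow_eq_pow_val, coe_realNorm, prod_signReal]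
  rcases Int.units_eq_one_or (∏ v, ε v) with h | h
  · simp [h]
  · simp [h, pow_add]

theorem clSubgroup_le_ker_etaHom (hφ : φ ∈ heckeChars F m) {N : ℕ} (hN : N ≠ 0)
    (hA : ∀ a ∈ unitLevel F N, ∀ b ∈ unitLevel F N, φ (finIdele F a, finIdele F b) = 1) :
    clSubgroup F (levelGroup F N) ≤ (etaHom φ).ker := by
  rw [clSubgroup_eq, detGroup_levelGroup hN]
  refine sup_le (sup_le ?_ ?_) ?_
  · rintro _ ⟨u, hu, rfl⟩
    have := hA u hu 1 (one_mem _)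
    rwa [map_one] at this
  · rintro _ ⟨x, hx, rfl⟩
    exact etaHom_realIdele_of_pos hφ fun v => hx v trivial
  · rintro _ ⟨a, rfl⟩
    have := hφ.1.map_principal a 1
    rwa [map_one] at this

theorem chiHom_mem_classChars (hφ : φ ∈ heckeChars F m) {N : ℕ} (hN : N ≠ 0)
    (hA : ∀ a ∈ unitLevel F N, ∀ b ∈ unitLevel F N, φ (finIdele F a, finIdele F b) = 1) :
    chiHom m φ ∈ classChars F (levelGroup F N) m := by
  refine ⟨?_, chiHom_realIdele hφ⟩
  rw [clSubgroup_eq, detGroup_levelGroup hN]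
  refine sup_le (sup_le ?_ ?_) ?_
  · rintro _ ⟨u, hu, rfl⟩
    have h1 := hA u hu 1 (one_mem _)
    have h2 := hA 1 (one_mem _) u hu
    rw [map_one] at h1 h2
    have h3 : ideleNormHom F (finIdele F u) = 1 := Units.ext (by
      rw [coe_ideleNormHom, ideleNorm_finIdele,
        finNorm_eq_one (unitLevel_le_integralUnits hN hu)]; simp)
    rw [MonoidHom.mem_ker, chiHom_apply, h1, h2, h3]
    simp
  · rintro _ ⟨x, hx, rfl⟩
    exact mem_ker_of_realIdele_pos (chiHom_realIdele hφ) fun v => hx v trivial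
  · rintro _ ⟨a, rfl⟩
    have h1 := hφ.1.map_principal a 1
    have h2 := hφ.1.map_principal 1 a
    rw [map_one] at h1 h2
    have h3 : ideleNormHom F (principal F a) = 1 := Units.ext (by
      rw [coe_ideleNormHom, ideleNorm_principal]; simp)
    rw [MonoidHom.mem_ker, chiHom_apply, h1, h2, h3]
    simp

end

theorem heckeTilde_eq {m : ℕ} {φ : Ideles F × Ideles F →* ℂˣ} (hφ : φ ∈ heckeChars F m)
    (b : BorelPi F) : heckeTilde F m 1 φ b = etaHom φ (detIdele b.toGpi) *
      (chiHom m φ (finIdele F b.t₂) * (finNorm F b.t₂ : ℂ) ^ (m + 2)) := by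
  rw [← heckeTilde_heckeOf (etaHom φ) (chiHom_realIdele hφ), heckeOf_etaHom_chiHom]

theorem toGpi_one : (BorelPi.mk (F := F) 1 1 0 1 1).toGpi = 1 := by
  refine Prod.ext (Units.ext ?_) (mul_one 1)
  rw [toGpi_eq]
  simp [coe_borel, Matrix.one_fin_two]

theorem heckeTilde_one (m : ℕ) {φ : Ideles F × Ideles F →* ℂˣ} (hφ : φ ∈ heckeChars F m) :
    heckeTilde F m 1 φ (BorelPi.mk 1 1 0 1 1) = 1 := by
  rw [heckeTilde_eq hφ, toGpi_one]
  have h : detIdele (1 : Gpi F) = 1 := by simp [detIdele]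
  have h1 : finNorm F 1 = 1 := finNorm_eq_one (one_mem _)
  simp [h, h1]

/-- Elements of the module induced from a character are equivariant. -/
theorem apply_mul_toGpi {m : ℕ} {φ : Ideles F × Ideles F →* ℂˣ} (hφ : φ ∈ heckeChars F m)
    {ψ : Gpi F → ℂ} (hψ : ψ ∈ induced F {heckeTilde F m 1 φ}) (x : Gpi F) (b : BorelPi F) :
    ψ (x * b.toGpi) = ψ x * heckeTilde F m 1 φ b := by
  obtain ⟨c, hc⟩ := Submodule.mem_span_singleton.1 (hψ.2 x)
  have h1 := congrFun hc (BorelPi.mk 1 1 0 1 1)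
  have h2 := congrFun hc b
  simp only [Pi.smul_apply, smul_eq_mul, heckeTilde_one m hφ, toGpi_one, mul_one] at h1 h2
  rw [← h2, h1]

theorem exists_isAdapted {m : ℕ} {φ : Ideles F × Ideles F →* ℂˣ} (hφ : φ ∈ heckeChars F m)
    {ψ : Gpi F → ℂ} (hψ : IsSmooth F ψ) : ∃ N : ℕ, 0 < N ∧ IsAdapted F N φ ψ := by
  obtain ⟨K, hK, -, h⟩ := hψ
  obtain ⟨N₀, hN₀, h0⟩ := exists_levelGroup_subset hK (one_mem K)
  obtain ⟨N₁, hN₁, h1⟩ := exists_unitLevel_trivial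
    (φ.comp ((MonoidHom.inl _ _).comp (finIdele F)))
    (hφ.1.continuous.comp (continuous_finIdele.prodMk continuous_const))
  obtain ⟨N₂, hN₂, h2⟩ := exists_unitLevel_trivial
    (φ.comp ((MonoidHom.inr _ _).comp (finIdele F)))
    (hφ.1.continuous.comp (continuous_const.prodMk continuous_finIdele))
  have hN : N₀ * N₁ * N₂ ≠ 0 := mul_ne_zero (mul_ne_zero hN₀ hN₁) hN₂
  refine ⟨N₀ * N₁ * N₂, Nat.pos_of_ne_zero hN, fun a ha b hb => ?_, fun k hk x =>
    h k (h0 (levelGroup_mono hN₀ hN ⟨N₁ * N₂, by ring⟩ hk)) x⟩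
  have ha' := h1 a (unitLevel_mono hN₁ hN ⟨N₀ * N₂, by ring⟩ ha)
  have hb' := h2 b (unitLevel_mono hN₂ hN ⟨N₀ * N₁, by ring⟩ hb)
  have : φ (finIdele F a, finIdele F b) = φ (finIdele F a, 1) * φ (1, finIdele F b) := by
    rw [← map_mul]; simp
  rw [this]
  exact (congrArg₂ (· * ·) ha' hb').trans (one_mul 1)

end

section

variable {F : Type*} [Field F] [NumberField F]

/-! ### The functions `\bar ψ` and `s\bar ψ` -/

theorem mul_mem_natLattice {N : ℕ} {hN : N ≠ 0} {A B : Matrix (Fin 2) (Fin 2) (Af F)}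
    (hA : ∀ i j, A i j ∈ natLattice N hN) (hB : ∀ i j, B i j ∈ integralAdeles F) (i j) :
    (A * B) i j ∈ natLattice N hN := by
  rw [Matrix.mul_apply]
  refine sum_mem fun l _ => ?_
  rw [mul_comm]
  exact mul_mem_lattice (hB l j) (hA i l)

theorem borel_mem_levelOne {t₁ t₂ : (Af F)ˣ} {u : Af F} (h₁ : t₁ ∈ integralUnits F)
    (h₂ : t₂ ∈ integralUnits F) (hu : u ∈ integralAdeles F) : borel t₁ t₂ u ∈ levelOne F := by
  have h1 : (t₁ : Af F) ∈ integralAdeles F := h₁.1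
  have h2 : (t₂ : Af F) ∈ integralAdeles F := h₂.1
  refine mem_levelOne_of_det (fun i j => ?_) ?_
  · rw [coe_borel]
    fin_cases i <;> fin_cases j
    · exact h1
    · exact mul_mem h1 hu
    · exact zero_mem _
    · exact h2
  · rw [det_borel]; exact mul_mem h₁ h₂

/-- Elements of `GL₂(Ô)` with congruent first columns differ by an element of `K_N` on the left
and an upper triangular matrix with first column `e¹` on the right. -/
theorem exists_eq_mul_borel {N : ℕ} (hN : N ≠ 0) {x y : GL (Fin 2) (Af F)} (hx : x ∈ levelOne F)
    (hy : y ∈ levelOne F) (h : ∀ i, (x : Matrix (Fin 2) (Fin 2) (Af F)) i 0 -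
      (y : Matrix (Fin 2) (Fin 2) (Af F)) i 0 ∈ natLattice N hN) :
    ∃ k ∈ levelGroup F N, ∃ t ∈ integralUnits F, ∃ u, x = k * (y * borel 1 t u) := by
  set z := y⁻¹ * x with hz
  have hzl : z ∈ levelOne F := mul_mem (inv_mem hy) hx
  have hzi := (mem_levelOne.1 hzl).1
  have hz0 : ∀ i, (z : Matrix (Fin 2) (Fin 2) (Af F)) i 0 -
      (1 : Matrix (Fin 2) (Fin 2) (Af F)) i 0 ∈ natLattice N hN := by
    intro i
    have e : (z : Matrix (Fin 2) (Fin 2) (Af F)) i 0 - (1 : Matrix (Fin 2) (Fin 2) (Af F)) i 0 =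
        (((y⁻¹ : GL (Fin 2) (Af F)) : Matrix (Fin 2) (Fin 2) (Af F)) *
          ((x : Matrix (Fin 2) (Fin 2) (Af F)) - (y : Matrix (Fin 2) (Fin 2) (Af F)))) i 0 := by
      rw [Matrix.mul_sub, Matrix.sub_apply, ← Units.val_mul, ← Units.val_mul, inv_mul_cancel]
      rfl
    rw [e, Matrix.mul_apply]
    exact sum_mem fun l _ => mul_mem_lattice ((mem_levelOne.1 hy).2 i l) (h l)
  set d := Matrix.GeneralLinearGroup.det z with hd
  have hdu : d ∈ integralUnits F := det_mem_integralUnits hzl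
  -- The first column of `z` is `e¹` modulo `N`, so `det z` is congruent to the lower right entry
  -- and `b` is congruent to `z`. Hence `z b⁻¹` lies in `K_N`, and conjugation by `y` keeps it
  -- there.
  set b := borel 1 d ((z : Matrix (Fin 2) (Fin 2) (Af F)) 0 1) with hb
  have hbl : b ∈ levelOne F := borel_mem_levelOne (one_mem _) hdu (hzi 0 1)
  have h00 := hz0 0
  have h10 := hz0 1
  rw [Matrix.one_apply_eq] at h00
  rw [Matrix.one_apply_ne (by decide), sub_zero] at h10
  have hzb : ∀ i j, ((z : Matrix (Fin 2) (Fin 2) (Af F)) - (b : Matrix (Fin 2) (Fin 2) (Af F))) i j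
      ∈ natLattice N hN := by
    intro i j
    rw [Matrix.sub_apply, hb, coe_borel]
    fin_cases i <;> fin_cases j
    · simpa using h00
    · simp
    · simpa using h10
    · have e : (d : Af F) = z 0 0 * z 1 1 - z 0 1 * z 1 0 := by
        rw [hd, Matrix.GeneralLinearGroup.val_det_apply, Matrix.det_fin_two]
      have e2 : (z : Matrix (Fin 2) (Fin 2) (Af F)) 1 1 - (d : Af F) =
          z 0 1 * z 1 0 - z 1 1 * (z 0 0 - 1) := by rw [e]; ring
      simp only [Fin.mk_one, Matrix.of_apply, Matrix.cons_val_one, Matrix.cons_val_fin_one]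
      rw [e2]
      exact sub_mem (mul_mem_lattice (hzi 0 1) h10) (mul_mem_lattice (hzi 1 1) h00)
  have hk : z * b⁻¹ ∈ levelGroup F N := by
    refine (mem_levelGroup hN).2 ⟨mul_mem hzl (inv_mem hbl), fun i j => ?_⟩
    have e : ((z * b⁻¹ : GL (Fin 2) (Af F)) : Matrix (Fin 2) (Fin 2) (Af F)) i j -
        (1 : Matrix (Fin 2) (Fin 2) (Af F)) i j =
        (((z : Matrix (Fin 2) (Fin 2) (Af F)) - (b : Matrix (Fin 2) (Fin 2) (Af F))) *
          ((b⁻¹ : GL (Fin 2) (Af F)) : Matrix (Fin 2) (Fin 2) (Af F))) i j := by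
      rw [Matrix.sub_mul, Matrix.sub_apply, ← Units.val_mul, ← Units.val_mul, mul_inv_cancel]
      rfl
    rw [e]
    exact mul_mem_natLattice hzb (mem_levelOne.1 hbl).2 i j
  refine ⟨y * (z * b⁻¹) * y⁻¹, conj_mem_levelGroup hN hk hy, d, hdu, (z : Matrix (Fin 2) (Fin 2) (Af F)) 0 1, ?_⟩
  rw [← hb, hz]
  group

theorem scalar_comm (t : (Af F)ˣ) (x : GL (Fin 2) (Af F)) :
    (Matrix.GeneralLinearGroup.scalar (Fin 2) t)⁻¹ * x =
      x * (Matrix.GeneralLinearGroup.scalar (Fin 2) t)⁻¹ := by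
  rw [← map_inv]
  refine Units.ext ?_
  rw [Units.val_mul, Units.val_mul]
  exact Matrix.scalar_commute _ (fun r => Commute.all _ r) _

theorem scalar_mul_borel (t t₁ t₂ : (Af F)ˣ) (u : Af F) :
    Matrix.GeneralLinearGroup.scalar (Fin 2) t * borel t₁ t₂ u = borel (t * t₁) (t * t₂) u := by
  refine Units.ext ?_
  have h : ((Matrix.GeneralLinearGroup.scalar (Fin 2) t : GL (Fin 2) (Af F)) :
      Matrix (Fin 2) (Fin 2) (Af F)) = !![(t : Af F), 0; 0, t] :=
    (Matrix.scalar_apply _).trans (Matrix.ext fun i j => by fin_cases i <;> fin_cases j <;> rfl)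
  rw [Units.val_mul, coe_borel, coe_borel, h, Matrix.mul_fin_two]
  simp only [zero_mul, add_zero, mul_zero, zero_add, Units.val_mul, mul_assoc]

theorem scalar_inv_mul_borel (t₁ t₂ : (Af F)ˣ) (u : Af F) :
    (Matrix.GeneralLinearGroup.scalar (Fin 2) (t₁ * t₂))⁻¹ * borel t₁ t₂ u =
      borel t₂⁻¹ t₁⁻¹ u := by
  rw [inv_mul_eq_iff_eq_mul, scalar_mul_borel, mul_inv_cancel_right, mul_comm t₁,
    mul_inv_cancel_right]

/-- `v` lies in `x e¹ + N V(Ô)`, for an element `x` of `GL₂(Ô)`. -/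
def InSupport {N : ℕ} (hN : N ≠ 0) (x : GL (Fin 2) (Af F)) (v : Fin 2 → Af F) : Prop :=
  x ∈ levelOne F ∧ ∀ i, v i - (x : Matrix (Fin 2) (Fin 2) (Af F)) i 0 ∈ natLattice N hN

variable [IsTotallyReal F]

theorem inSupport_iff {N : ℕ} {hN : N ≠ 0} {x : GL (Fin 2) (Af F)} {v : Fin 2 → Af F} :
    InSupport hN x v ↔ x ∈ levelOne F ∧ ∃ w : Fin 2 → Af F, (∀ i, w i ∈ integralAdeles F) ∧
      v = (x : Matrix (Fin 2) (Fin 2) (Af F)).mulVec ![1, 0] + (N : Af F) • w := by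
  refine and_congr_right fun _ => ⟨fun h => ?_, ?_⟩
  · choose w hw hw' using fun i => mem_natLattice_iff_exists.1 (h i)
    refine ⟨w, hw, funext fun i => ?_⟩
    rw [Pi.add_apply, mulVec_e_apply, Pi.smul_apply, smul_eq_mul, ← hw', add_sub_cancel]
  · rintro ⟨w, hw, rfl⟩ i
    rw [Pi.add_apply, mulVec_e_apply, add_sub_cancel_left]
    exact mem_natLattice_iff_exists.2 ⟨w i, hw i, rfl⟩

theorem sBarPsi_of_forall_not {N : ℕ} (hN : N ≠ 0) {φ : Ideles F × Ideles F →* ℂˣ}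
    {ψ : Gpi F → ℂ} {v : Fin 2 → Af F} (h : ∀ x, ¬ InSupport hN x v) : sBarPsi N φ ψ v = 0 :=
  dif_neg fun ⟨x, hx, h'⟩ => h x (inSupport_iff.2 ⟨hx, h'⟩)

theorem InSupport.add {N : ℕ} {hN : N ≠ 0} {x : GL (Fin 2) (Af F)} {v w : Fin 2 → Af F}
    (h : InSupport hN x v) (hw : w ∈ box (natLattice N hN)) : InSupport hN x (v + w) :=
  ⟨h.1, fun i => by
    rw [Pi.add_apply, add_sub_right_comm]
    exact add_mem (h.2 i) (mem_box.1 hw i)⟩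

theorem InSupport.smul {N : ℕ} {hN : N ≠ 0} {x : GL (Fin 2) (Af F)} {v : Fin 2 → Af F}
    (h : InSupport hN x v) {z : (Af F)ˣ} (hz : z ∈ integralUnits F) :
    InSupport hN (x * borel z 1 0) ((z : Af F) • v) := by
  refine ⟨mul_mem h.1 (borel_mem_levelOne hz (one_mem _) (zero_mem _)), fun i => ?_⟩
  have e : ((x * borel z 1 0 : GL (Fin 2) (Af F)) : Matrix (Fin 2) (Fin 2) (Af F)) i 0 =
      z * (x : Matrix (Fin 2) (Fin 2) (Af F)) i 0 := by
    rw [← mulVec_e_apply ((x * borel z 1 0 : GL (Fin 2) (Af F)) : Matrix (Fin 2) (Fin 2) (Af F)),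
      mulVec_mul_borel, Pi.smul_apply, mulVec_e_apply, smul_eq_mul]
  rw [e, Pi.smul_apply, smul_eq_mul, ← mul_sub]
  exact mul_mem_lattice hz.1 (h.2 i)

theorem InSupport.mem_integralAdeles {N : ℕ} {hN : N ≠ 0} {x : GL (Fin 2) (Af F)}
    {v : Fin 2 → Af F} (h : InSupport hN x v) (i) : v i ∈ integralAdeles F := by
  have := add_mem (natLattice_le_integralAdeles hN (h.2 i)) ((mem_levelOne.1 h.1).1 i 0)
  rwa [sub_add_cancel] at this

/-- A function on the plane which is invariant under an open subgroup is locally constant. -/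
theorem isLocallyConstant_of_add {G X : Type*} [AddGroup G] [TopologicalSpace G]
    [IsTopologicalAddGroup G] {f : G → X} (H : AddSubgroup G) (hH : IsOpen (H : Set G))
    (h : ∀ v, ∀ w ∈ H, f (v + w) = f v) : IsLocallyConstant f := by
  refine (IsLocallyConstant.iff_eventually_eq _).2 fun v => ?_
  have h1 : {w | -v + w ∈ H} ∈ 𝓝 v :=
    (hH.preimage (continuous_const.add continuous_id)).mem_nhds (by simp)
  filter_upwards [h1] with w hw
  rw [← h v _ hw, add_neg_cancel_left]

theorem detIdele_mk_one (x : GL (Fin 2) (Af F)) :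
    detIdele ((x, 1) : Gpi F) = finIdele F (Matrix.GeneralLinearGroup.det x) := by
  simp [detIdele]

theorem detIdele_toGpi_one (t₁ t₂ : (Af F)ˣ) (u : Af F) :
    detIdele (BorelPi.mk t₁ t₂ u 1 1).toGpi = finIdele F (t₁ * t₂) := by
  rw [toGpi_eq, mul_one, detIdele_mk_one, det_borel]

section

variable {m N : ℕ} {φ : Ideles F × Ideles F →* ℂˣ} {ψ : Gpi F → ℂ}

theorem etaHom_finIdele (hA : IsAdapted F N φ ψ) {u : (Af F)ˣ} (hu : u ∈ unitLevel F N) :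
    etaHom φ (finIdele F u) = 1 := by
  have := hA.1 u hu 1 (one_mem _)
  rwa [map_one] at this

theorem barPsi_mul_left (hN : N ≠ 0) (hA : IsAdapted F N φ ψ)
    {k : GL (Fin 2) (Af F)} (hk : k ∈ levelGroup F N) (x : GL (Fin 2) (Af F)) :
    barPsi φ ψ (k * x) = barPsi φ ψ x := by
  have hd := det_mem_unitLevel hN hk
  have e : (Matrix.GeneralLinearGroup.scalar (Fin 2)
        (Matrix.GeneralLinearGroup.det (k * x)))⁻¹ * (k * x) =
      (Matrix.GeneralLinearGroup.scalar (Fin 2) (Matrix.GeneralLinearGroup.det k))⁻¹ * k *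
        ((Matrix.GeneralLinearGroup.scalar (Fin 2) (Matrix.GeneralLinearGroup.det x))⁻¹ * x) := by
    rw [map_mul, map_mul, mul_inv_rev]
    rw [scalar_comm _ (_⁻¹), mul_assoc, ← mul_assoc _ k, scalar_comm _ k]
    simp only [mul_assoc]
  have hk' : (Matrix.GeneralLinearGroup.scalar (Fin 2) (Matrix.GeneralLinearGroup.det k))⁻¹ * k ∈
      levelGroup F N := mul_mem (inv_mem ((scalar_mem_levelGroup_iff hN).2 hd)) hk
  have h1 := hA.2 _ hk'
    ((Matrix.GeneralLinearGroup.scalar (Fin 2) (Matrix.GeneralLinearGroup.det x))⁻¹ * x, 1)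
  rw [Prod.mk_mul_mk, mul_one, ← e] at h1
  rw [barPsi, h1, barPsi, heckeEta_eq, heckeEta_eq, map_mul, map_mul, map_mul,
    etaHom_finIdele hA hd, one_mul]

/-- The twist by `det⁻¹` turns the diagonal `(t₁, t₂)` into `(t₂⁻¹, t₁⁻¹)`, so `η` cancels and `t₂`
drops out. This lets `\bar ψ` be viewed as a function of the first column. -/
theorem barPsi_mul_borel (hφ : φ ∈ heckeChars F m) (hψ : ψ ∈ induced F {heckeTilde F m 1 φ})
    (x : GL (Fin 2) (Af F)) (t₁ t₂ : (Af F)ˣ) (u : Af F) :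
    barPsi φ ψ (x * borel t₁ t₂ u) =
      barPsi φ ψ x * ((chiHom m φ (finIdele F t₁))⁻¹ : ℂˣ) * ((finNorm F t₁ : ℂ) ^ (m + 2))⁻¹ := by
  have e : (Matrix.GeneralLinearGroup.scalar (Fin 2)
        (Matrix.GeneralLinearGroup.det (x * borel t₁ t₂ u)))⁻¹ * (x * borel t₁ t₂ u) =
      ((Matrix.GeneralLinearGroup.scalar (Fin 2) (Matrix.GeneralLinearGroup.det x))⁻¹ * x) *
        borel t₂⁻¹ t₁⁻¹ u := by
    rw [← scalar_inv_mul_borel, map_mul, det_borel, mul_comm, map_mul, mul_inv_rev]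
    simp only [mul_assoc]
    rw [← mul_assoc _ x, scalar_comm _ x]
    simp only [mul_assoc]
  have h1 := apply_mul_toGpi hφ hψ
    ((Matrix.GeneralLinearGroup.scalar (Fin 2) (Matrix.GeneralLinearGroup.det x))⁻¹ * x, 1)
    (BorelPi.mk t₂⁻¹ t₁⁻¹ u 1 1)
  rw [heckeTilde_eq hφ, detIdele_toGpi_one, toGpi_eq, Prod.mk_mul_mk, mul_one, mul_one, ← e] at h1
  rw [barPsi, h1, barPsi, heckeEta_eq, heckeEta_eq, map_mul, det_borel, finNorm_inv]
  have h2 : (etaHom φ (finIdele F (Matrix.GeneralLinearGroup.det x * (t₁ * t₂))) : ℂ) *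
      (etaHom φ (finIdele F (t₂⁻¹ * t₁⁻¹)) : ℂ) =
        (etaHom φ (finIdele F (Matrix.GeneralLinearGroup.det x)) : ℂ) := by
    rw [← Units.val_mul, ← map_mul, ← map_mul, ← mul_inv_rev, mul_assoc, mul_inv_cancel, mul_one]
  rw [← h2, map_inv, map_inv]
  push_cast
  rw [inv_pow]
  ring

/-- The matrix picked in the definition is immaterial: by `exists_eq_mul_borel` any two candidates
differ by factors that leave `\bar ψ` unchanged. -/
theorem sBarPsi_eq (hφ : φ ∈ heckeChars F m) (hψ : ψ ∈ induced F {heckeTilde F m 1 φ})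
    (hN : N ≠ 0) (hA : IsAdapted F N φ ψ) {x : GL (Fin 2) (Af F)} {v : Fin 2 → Af F}
    (hx : InSupport hN x v) : sBarPsi N φ ψ v = barPsi φ ψ x := by
  have h : ∃ x ∈ levelOne F, ∃ w : Fin 2 → Af F, (∀ i, w i ∈ integralAdeles F) ∧
      v = (x : Matrix (Fin 2) (Fin 2) (Af F)).mulVec ![1, 0] + (N : Af F) • w :=
    ⟨x, inSupport_iff.1 hx⟩
  have hy : InSupport hN h.choose v := inSupport_iff.2 h.choose_spec
  rw [sBarPsi, dif_pos h]
  obtain ⟨k, hk, t, ht, u, e⟩ := exists_eq_mul_borel hN hx.1 hy.1 fun i => by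
    have := sub_mem (hy.2 i) (hx.2 i)
    rwa [sub_sub_sub_cancel_left] at this
  have h1 : barPsi φ ψ x = barPsi φ ψ h.choose := by
    rw [e, barPsi_mul_left hN hA hk, barPsi_mul_borel hφ hψ]
    simp [finNorm_eq_one (one_mem (integralUnits F))]
  exact h1.symm

theorem sBarPsi_add (hφ : φ ∈ heckeChars F m) (hψ : ψ ∈ induced F {heckeTilde F m 1 φ})
    (hN : N ≠ 0) (hA : IsAdapted F N φ ψ) (v : Fin 2 → Af F) {w : Fin 2 → Af F}
    (hw : w ∈ box (natLattice N hN)) : sBarPsi N φ ψ (v + w) = sBarPsi N φ ψ v := by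
  by_cases h : ∃ x, InSupport hN x v
  · obtain ⟨x, hx⟩ := h
    rw [sBarPsi_eq hφ hψ hN hA hx, sBarPsi_eq hφ hψ hN hA (hx.add hw)]
  · push Not at h
    rw [sBarPsi_of_forall_not hN h, sBarPsi_of_forall_not hN fun x hx => h x ?_]
    simpa using hx.add (neg_mem hw)

theorem sBarPsi_smul (hφ : φ ∈ heckeChars F m) (hψ : ψ ∈ induced F {heckeTilde F m 1 φ})
    (hN : N ≠ 0) (hA : IsAdapted F N φ ψ) (v : Fin 2 → Af F) {z : (Af F)ˣ}
    (hz : z ∈ integralUnits F) : sBarPsi N φ ψ ((z : Af F) • v) =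
      ((chiHom m φ (finIdele F z))⁻¹ : ℂˣ) * sBarPsi N φ ψ v := by
  by_cases h : ∃ x, InSupport hN x v
  · obtain ⟨x, hx⟩ := h
    rw [sBarPsi_eq hφ hψ hN hA hx, sBarPsi_eq hφ hψ hN hA (hx.smul hz), barPsi_mul_borel hφ hψ,
      finNorm_eq_one hz]
    simp [mul_comm]
  · push Not at h
    rw [sBarPsi_of_forall_not hN h, mul_zero, sBarPsi_of_forall_not hN fun x hx => h (x * borel z⁻¹ 1 0) ?_]
    have := hx.smul (inv_mem hz)
    rwa [smul_smul, Units.inv_mul, one_smul] at this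

theorem isSchwartzBruhat_sBarPsi (hφ : φ ∈ heckeChars F m)
    (hψ : ψ ∈ induced F {heckeTilde F m 1 φ}) (hN : N ≠ 0) (hA : IsAdapted F N φ ψ) :
    IsSchwartzBruhat (sBarPsi N φ ψ) where
  isLocallyConstant := isLocallyConstant_of_add (box (natLattice N hN))
    (isOpen_box (isOpen_lattice _)) fun v w hw => sBarPsi_add hφ hψ hN hA v hw
  hasCompactSupport := by
    refine HasCompactSupport.intro (K := (box (lattice 1) : AddSubgroup (Fin 2 → Af F)))
      (isCompact_box (isCompact_lattice 1)) fun v hv => sBarPsi_of_forall_not hN fun x hx => hv ?_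
    refine mem_box.2 fun i => ?_
    have := hx.mem_integralAdeles i
    rwa [← SetLike.mem_coe, ← lattice_one] at this

end

end

section

variable {F : Type*} [Field F] [NumberField F] [IsTotallyReal F]

/-! ### The image of the explicit sections -/

/-- Multiplication by an `s` with `ρ(s) ≠ 1` permutes the classes represented by `R`, so the sum
equals `ρ(s)` times itself. -/
theorem sum_repSystem {N : ℕ} (hN : N ≠ 0) {R : Finset (Ideles F)} (hR : IsRepSystem N R)
    (ρ : Ideles F →* ℂˣ) (hρ : rayClSubgroup F N ≤ ρ.ker) (h1 : ρ ≠ 1) :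
    ∑ u ∈ R, (ρ u : ℂ) = 0 := by
  obtain ⟨s, hs⟩ : ∃ s, ρ s ≠ 1 := by
    by_contra h
    push Not at h
    exact h1 (MonoidHom.ext h)
  choose r hr hr' using hR
  have key : ∑ u ∈ R, (ρ u : ℂ) = ∑ u ∈ R, (ρ (s * u) : ℂ) := by
    refine (Finset.sum_bij (fun u _ => r (s * u)) (fun u _ => (hr _).1) ?_ ?_ ?_).symm
    · intro u hu u' hu' h
      have h2 : u'⁻¹ * u ∈ rayClSubgroup F N := by
        have := mul_mem (inv_mem (hr (s * u')).2) (hr (s * u)).2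
        rw [← h] at this
        have e : ((r (s * u))⁻¹ * (s * u'))⁻¹ * ((r (s * u))⁻¹ * (s * u)) = u'⁻¹ * u := by group
        rwa [e] at this
      rw [hr' u u ⟨hu, by rw [inv_mul_cancel]; exact one_mem _⟩, ← hr' u u' ⟨hu', h2⟩]
    · intro u hu
      refine ⟨r (s⁻¹ * u), (hr _).1, ?_⟩
      refine (hr' _ u ⟨hu, ?_⟩).symm
      have := inv_mem (hr (s⁻¹ * u)).2
      have e : ((r (s⁻¹ * u))⁻¹ * (s⁻¹ * u))⁻¹ = u⁻¹ * (s * r (s⁻¹ * u)) := by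
        simp only [mul_inv_rev, inv_inv, mul_assoc]
      rwa [e] at this
    · intro u hu
      have := hρ (hr (s * u)).2
      rw [MonoidHom.mem_ker, map_mul, map_inv, inv_mul_eq_one] at this
      rw [this]
  have h2 : (ρ s : ℂ) * ∑ u ∈ R, (ρ u : ℂ) = ∑ u ∈ R, (ρ u : ℂ) := by
    conv_rhs => rw [key]
    rw [Finset.mul_sum]
    exact Finset.sum_congr rfl fun u _ => by rw [map_mul, Units.val_mul]
  have h3 : ((ρ s : ℂ) - 1) * ∑ u ∈ R, (ρ u : ℂ) = 0 := by rw [sub_mul, h2, one_mul, sub_self]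
  refine (mul_eq_zero.1 h3).resolve_left fun h => hs (Units.ext (sub_eq_zero.1 h))

theorem card_repSystem {N : ℕ} {R : Finset (Ideles F)} (hR : IsRepSystem N R) :
    R.card = (rayClSubgroup F N).index := by
  rw [Subgroup.index_eq_card, ← Nat.card_eq_finsetCard R]
  refine Nat.card_congr (Equiv.ofBijective (fun u : R => (QuotientGroup.mk (u : Ideles F) :
    Ideles F ⧸ rayClSubgroup F N)) ⟨fun u u' h => ?_, fun q => ?_⟩)
  · have h2 := QuotientGroup.eq.1 h
    exact Subtype.ext ((hR u').unique ⟨u.2, h2⟩ ⟨u'.2, by rw [inv_mul_cancel]; exact one_mem _⟩)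
  · obtain ⟨t, rfl⟩ := QuotientGroup.mk_surjective q
    obtain ⟨u, ⟨hu, h⟩, -⟩ := hR t
    exact ⟨⟨u, hu⟩, QuotientGroup.eq.2 h⟩

section

variable {m N : ℕ} {φ : Ideles F × Ideles F →* ℂˣ} {ψ : Gpi F → ℂ}

/-- The function `η(det g) s\bar ψ(w v)` of `v` and `g`. -/
def scaledSection (N : ℕ) (φ : Ideles F × Ideles F →* ℂˣ) (ψ : Gpi F → ℂ) (w : (Af F)ˣ)
    (v : Fin 2 → Af F) (g : Gpi F) : ℂ :=
  heckeEta φ (detIdele g) * sBarPsi N φ ψ ((w : Af F) • v)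

theorem scaledSection_mem_schwartz (hφ : φ ∈ heckeChars F m)
    (hψ : ψ ∈ induced F {heckeTilde F m 1 φ}) (hN : N ≠ 0) (hA : IsAdapted F N φ ψ)
    (w : (Af F)ˣ) : scaledSection N φ ψ w ∈ schwartz F := by
  have hS := isSchwartzBruhat_sBarPsi hφ hψ hN hA
  refine ⟨fun g => ⟨?_, ?_⟩, ⟨levelGroup F N, isOpen_levelGroup hN, isCompact_levelGroup hN,
    fun k hk g => funext fun v => ?_⟩, fun v g γ => ?_⟩
  · exact (hS.isLocallyConstant.comp_continuous (continuous_const_smul (w : Af F))).comp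
      (heckeEta φ (detIdele g) * ·)
  · exact (hS.hasCompactSupport.comp_homeomorph
      (Homeomorph.smul w : (Fin 2 → Af F) ≃ₜ (Fin 2 → Af F))).mul_left
  · change heckeEta φ (detIdele ((k, 1) * g)) * _ = heckeEta φ (detIdele g) * _
    rw [detIdele_mul, detIdele_mk_one, heckeEta_eq, heckeEta_eq,
      map_mul, etaHom_finIdele hA (det_mem_unitLevel hN hk), one_mul]
  · have h := clSubgroup_le_ker_etaHom hφ hN hA.1
      (detIdele_rational_mem (U := detGroup F (levelGroup F N)) γ)
    rw [scaledSection, scaledSection, detIdele_mul, heckeEta_eq, heckeEta_eq, map_mul,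
      MonoidHom.mem_ker.1 h, mul_one]

/-- The integrand of the horospherical map for a section with Fourier transform
`scaledSection N φ ψ w`. -/
def sectionIntegrand (m N : ℕ) (φ : Ideles F × Ideles F →* ℂˣ) (ψ : Gpi F → ℂ)
    (χ : Ideles F →* ℂˣ) (w : (Af F)ˣ) (g : Gpi F) (t : (Af F)ˣ) : ℂ :=
  scaledSection N φ ψ w
      ((t : Af F) • (g.1 : Matrix (Fin 2) (Fin 2) (Af F)).mulVec ![1, 0]) g *
    (χ (finIdele F (Matrix.GeneralLinearGroup.det g.1 * t)) : ℂˣ) *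
    (finNorm F (Matrix.GeneralLinearGroup.det g.1 * t) : ℂ) ^ (m + 2)

/-- By Fourier inversion this is the integrand of the horospherical map for the transform of the
section. -/
theorem integrable_sectionIntegrand (hφ : φ ∈ heckeChars F m)
    (hψ : ψ ∈ induced F {heckeTilde F m 1 φ}) (hN : N ≠ 0) (hA : IsAdapted F N φ ψ)
    {K : Subgroup (GL (Fin 2) (Af F))} (hK : IsOpen (K : Set (GL (Fin 2) (Af F))))
    {χ : Ideles F →* ℂˣ} (hχ : clSubgroup F K ≤ χ.ker) (w : (Af F)ˣ) (g : Gpi F) :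
    Integrable (sectionIntegrand m N φ ψ χ w g) (mulMeasure F) := by
  have hS := scaledSection_mem_schwartz hφ hψ hN hA w
  have h := integrable_rhoIntegrand m (fourier_mem_schwartz hS) hK hχ g
  refine h.congr (ae_of_all _ fun t => ?_)
  change fourier (fourier (scaledSection N φ ψ w)) _ g * _ * _ = _
  rw [fourier_fourier hS]
  rfl

theorem sectionIntegrand_inv_mul (χ : Ideles F →* ℂˣ) (w : (Af F)ˣ) (g : Gpi F) (t : (Af F)ˣ) :
    sectionIntegrand m N φ ψ χ w g (w⁻¹ * t) =
      (((χ (finIdele F w))⁻¹ : ℂˣ) * ((finNorm F w : ℂ) ^ (m + 2))⁻¹) *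
        sectionIntegrand m N φ ψ χ 1 g t := by
  rw [sectionIntegrand, sectionIntegrand, scaledSection, scaledSection, smul_smul,
    ← Units.val_mul, mul_inv_cancel_left, Units.val_one, one_smul, mul_left_comm, map_mul,
    finNorm_mul, finNorm_inv, map_mul, map_inv, map_inv]
  push_cast
  rw [mul_pow, inv_pow]
  ring

theorem integral_sectionIntegrand (χ : Ideles F →* ℂˣ) (w : (Af F)ˣ) (g : Gpi F) :
    ∫ t, sectionIntegrand m N φ ψ χ w g t ∂mulMeasure F =
      (((χ (finIdele F w))⁻¹ : ℂˣ) * ((finNorm F w : ℂ) ^ (m + 2))⁻¹) *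
        ∫ t, sectionIntegrand m N φ ψ χ 1 g t ∂mulMeasure F := by
  rw [← integral_mul_left_mulMeasure _ w⁻¹, ← integral_const_mul]
  exact integral_congr_ae (ae_of_all _ fun t => sectionIntegrand_inv_mul χ w g t)

/-- Scaling by `z` multiplies `s\bar ψ` by `χ'(z)⁻¹`, hence the integral by `χ(z) χ'(z)⁻¹`. -/
theorem integral_sectionIntegrand_eq_zero (hφ : φ ∈ heckeChars F m)
    (hψ : ψ ∈ induced F {heckeTilde F m 1 φ}) (hN : N ≠ 0) (hA : IsAdapted F N φ ψ)
    (χ : Ideles F →* ℂˣ) (g : Gpi F) {z : (Af F)ˣ} (hz : z ∈ integralUnits F)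
    (h : χ (finIdele F z) ≠ chiHom m φ (finIdele F z)) :
    ∫ t, sectionIntegrand m N φ ψ χ 1 g t ∂mulMeasure F = 0 := by
  have h1 : ∀ t, sectionIntegrand m N φ ψ χ 1 g (z * t) =
      (((chiHom m φ (finIdele F z))⁻¹ : ℂˣ) * (χ (finIdele F z) : ℂˣ) : ℂ) *
        sectionIntegrand m N φ ψ χ 1 g t := by
    intro t
    rw [sectionIntegrand, sectionIntegrand, scaledSection, scaledSection, Units.val_one, one_smul,
      one_smul, Units.val_mul, mul_smul, sBarPsi_smul hφ hψ hN hA _ hz, mul_left_comm _ z, map_mul,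
      finNorm_mul, map_mul, finNorm_eq_one hz]
    push_cast
    ring
  have h2 := integral_mul_left_mulMeasure (sectionIntegrand m N φ ψ χ 1 g) z
  simp_rw [h1] at h2
  rw [integral_const_mul] at h2
  by_contra h0
  have h3 := mul_right_cancel₀ h0 (h2.trans (one_mul _).symm)
  rw [← Units.val_mul, Units.val_eq_one, inv_mul_eq_one] at h3
  exact h h3.symm

theorem preimageFourier_eq (R : Finset (Ideles F)) :
    preimageFourier m N φ ψ R = ∑ u ∈ R, ((chiHom m φ (finIdele F (finPart F u)) : ℂ) *
      (finNorm F (finPart F u) : ℂ) ^ (m + 2)) • scaledSection N φ ψ (finPart F u) := by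
  funext v g
  rw [Finset.sum_apply, Finset.sum_apply, preimageFourier]
  refine Finset.sum_congr rfl fun u _ => ?_
  rw [Pi.smul_apply, Pi.smul_apply, smul_eq_mul, scaledSection, heckeChi_eq, mul_assoc _ (heckeEta _ _)]

theorem preimageFourier_mem_schwartz (hφ : φ ∈ heckeChars F m)
    (hψ : ψ ∈ induced F {heckeTilde F m 1 φ}) (hN : N ≠ 0) (hA : IsAdapted F N φ ψ)
    (R : Finset (Ideles F)) : preimageFourier m N φ ψ R ∈ schwartz F := by
  rw [preimageFourier_eq]
  exact sum_mem fun u _ => Submodule.smul_mem _ _ (scaledSection_mem_schwartz hφ hψ hN hA _)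

/-- Removing the scaling by `u` costs `χ(u)⁻¹ ‖u‖^{-(m+2)}`. The weights `χ'(u) ‖u‖^{m+2}` are
chosen so that only a character sum is left. -/
theorem integral_rhoIntegrand_preimage (hφ : φ ∈ heckeChars F m)
    (hψ : ψ ∈ induced F {heckeTilde F m 1 φ}) (hN : N ≠ 0) (hA : IsAdapted F N φ ψ)
    (R : Finset (Ideles F)) {K : Subgroup (GL (Fin 2) (Af F))}
    (hK : IsOpen (K : Set (GL (Fin 2) (Af F)))) {χ : Ideles F →* ℂˣ} (hχ : clSubgroup F K ≤ χ.ker)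
    (g : Gpi F) :
    ∫ t, rhoIntegrand F m (fourier (preimageFourier m N φ ψ R)) χ g t ∂mulMeasure F =
      (∑ u ∈ R, ((chiHom m φ * χ⁻¹) (finIdele F (finPart F u)) : ℂ)) *
        ∫ t, sectionIntegrand m N φ ψ χ 1 g t ∂mulMeasure F := by
  have h1 : ∀ t, rhoIntegrand F m (fourier (preimageFourier m N φ ψ R)) χ g t =
      ∑ u ∈ R, ((chiHom m φ (finIdele F (finPart F u)) : ℂ) *
        (finNorm F (finPart F u) : ℂ) ^ (m + 2)) *
          sectionIntegrand m N φ ψ χ (finPart F u) g t := by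
    intro t
    change fourier (fourier (preimageFourier m N φ ψ R)) _ g * _ * _ = _
    rw [fourier_fourier (preimageFourier_mem_schwartz hφ hψ hN hA R), preimageFourier_eq,
      Finset.sum_apply, Finset.sum_apply, Finset.sum_mul, Finset.sum_mul]
    refine Finset.sum_congr rfl fun u _ => ?_
    rw [Pi.smul_apply, Pi.smul_apply, smul_eq_mul, sectionIntegrand]
    ring
  simp_rw [h1]
  rw [integral_finsetSum _ fun u _ =>
    (integrable_sectionIntegrand hφ hψ hN hA hK hχ _ g).const_mul _, Finset.sum_mul]
  refine Finset.sum_congr rfl fun u _ => ?_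
  rw [integral_const_mul, integral_sectionIntegrand, MonoidHom.mul_apply, MonoidHom.inv_apply]
  have h0 : (finNorm F (finPart F u) : ℂ) ^ (m + 2) ≠ 0 :=
    pow_ne_zero _ (Complex.ofReal_ne_zero.2 (finNorm_pos _).ne')
  push_cast
  field_simp

/-- If `χ` and `χ'` differ on `Ô^×`, the integral vanishes. Otherwise `χ' χ⁻¹` is a non-trivial
character of `Cl_F^{(N)}`, and the sum over `R` vanishes. -/
theorem integral_rhoIntegrand_preimage_of_ne (hφ : φ ∈ heckeChars F m)
    (hψ : ψ ∈ induced F {heckeTilde F m 1 φ}) (hN : N ≠ 0) (hA : IsAdapted F N φ ψ)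
    {R : Finset (Ideles F)} (hR : IsRepSystem N R) {K : Subgroup (GL (Fin 2) (Af F))}
    (hK : IsOpen (K : Set (GL (Fin 2) (Af F)))) {χ : Ideles F →* ℂˣ} (hχ : χ ∈ classChars F K m)
    (hne : χ ≠ chiHom m φ) (g : Gpi F) :
    ∫ t, rhoIntegrand F m (fourier (preimageFourier m N φ ψ R)) χ g t ∂mulMeasure F = 0 := by
  rw [integral_rhoIntegrand_preimage hφ hψ hN hA R hK hχ.1]
  by_cases h : ∃ z ∈ integralUnits F, χ (finIdele F z) ≠ chiHom m φ (finIdele F z)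
  · obtain ⟨z, hz, h⟩ := h
    rw [integral_sectionIntegrand_eq_zero hφ hψ hN hA χ g hz h, mul_zero]
  push Not at h
  have hθ := chiHom_mem_classChars hφ hN hA.1
  have hreal : ∀ x, (chiHom m φ * χ⁻¹) (realIdele F x) = 1 := fun x => by
    rw [MonoidHom.mul_apply, MonoidHom.inv_apply, mul_inv_eq_one]
    exact Units.ext ((hθ.2 x).trans (hχ.2 x).symm)
  -- Both characters equal `sgn(N)^m` at infinity, so their quotient sees only the finite part of
  -- `u`.
  have hfin : ∀ u, (chiHom m φ * χ⁻¹) (finIdele F (finPart F u)) = (chiHom m φ * χ⁻¹) u := by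
    intro u
    conv_rhs => rw [idele_eq u, map_mul, hreal, mul_one]
  simp_rw [hfin]
  rw [sum_repSystem hN hR, zero_mul]
  · refine sup_le (sup_le ?_ ?_) ?_
    · rintro _ ⟨u, hu, rfl⟩
      rw [MonoidHom.mem_ker, MonoidHom.mul_apply, MonoidHom.inv_apply, mul_inv_eq_one]
      exact (h u (unitLevel_le_integralUnits hN hu)).symm
    · rintro _ ⟨x, -, rfl⟩
      exact hreal x
    · rintro _ ⟨a, rfl⟩
      have h1 := hθ.1 ((le_sup_right : _ ≤ clSubgroup F _) ⟨a, rfl⟩)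
      have h2 := hχ.1 ((le_sup_right : _ ≤ clSubgroup F _) ⟨a, rfl⟩)
      rw [MonoidHom.mem_ker] at h1 h2
      rw [MonoidHom.mem_ker, MonoidHom.mul_apply, MonoidHom.inv_apply, h1, h2, inv_one, one_mul]
  · refine fun e => hne (MonoidHom.ext fun x => ?_)
    have := DFunLike.congr_fun e x
    rwa [MonoidHom.mul_apply, MonoidHom.inv_apply, MonoidHom.one_apply, mul_inv_eq_one, eq_comm]
      at this

theorem rho_preimage (hφ : φ ∈ heckeChars F m)
    (hψ : ψ ∈ induced F {heckeTilde F m 1 φ}) (hN : N ≠ 0) (hA : IsAdapted F N φ ψ)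
    {R : Finset (Ideles F)} (hR : IsRepSystem N R) (g : Gpi F) :
    rho F m (fourier (preimageFourier m N φ ψ R)) g = (rayClSubgroup F N).index *
      gammaFactor F m * ∫ t, sectionIntegrand m N φ ψ (chiHom m φ) 1 g t ∂mulMeasure F := by
  classical
  have hf := fourier_mem_schwartz (preimageFourier_mem_schwartz hφ hψ hN hA R)
  -- The sum is evaluated at level `M N`: a multiple of `M`, and fine enough for `χ'` to be among
  -- its characters.
  obtain ⟨M, hM, hlev⟩ := exists_isLevel hf
  have hMN : M * N ≠ 0 := mul_ne_zero hM hN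
  have hopen := isOpen_levelGroup (F := F) hMN
  have hA' : ∀ a ∈ unitLevel F (M * N), ∀ b ∈ unitLevel F (M * N),
      φ (finIdele F a, finIdele F b) = 1 := fun a ha b hb =>
    hA.1 a (unitLevel_mono hN hMN (Dvd.intro_left _ rfl) ha) b
      (unitLevel_mono hN hMN (Dvd.intro_left _ rfl) hb)
  have hθ := chiHom_mem_classChars hφ hMN hA'
  rw [rho_eq_rhoAt_levelGroup m hf hM hMN (Dvd.intro _ rfl) hlev, rhoAt,
    finsum_eq_single _ (chiHom m φ), finsum_eq_if, if_pos hθ,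
    integral_rhoIntegrand_preimage hφ hψ hN hA R hopen hθ.1]
  · have h1 : chiHom m φ * (chiHom m φ)⁻¹ = 1 := MonoidHom.ext fun x => mul_inv_cancel _
    rw [h1]
    simp only [MonoidHom.one_apply, Units.val_one, Finset.sum_const, nsmul_eq_mul, mul_one,
      card_repSystem hR]
    ring
  · intro χ hne
    rw [finsum_eq_if]
    split_ifs with hχ
    · rw [integral_rhoIntegrand_preimage_of_ne hφ hψ hN hA hR hopen hχ hne, mul_zero]
    · rfl

end

end

section

variable {F : Type*} [Field F] [NumberField F] [IsTotallyReal F]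

section

variable {m N : ℕ} {φ : Ideles F × Ideles F →* ℂˣ} {ψ : Gpi F → ℂ}

/-! ### The local computation -/

theorem sectionIntegrand_mul_toGpi (hφ : φ ∈ heckeChars F m) (g : Gpi F) (b : BorelPi F)
    (t : (Af F)ˣ) : sectionIntegrand m N φ ψ (chiHom m φ) 1 (g * b.toGpi) (b.t₁⁻¹ * t) =
      sectionIntegrand m N φ ψ (chiHom m φ) 1 g t * heckeTilde F m 1 φ b := by
  have h1 : ((g * b.toGpi).1 : Matrix (Fin 2) (Fin 2) (Af F)).mulVec ![1, 0] =
      (b.t₁ : Af F) • (g.1 : Matrix (Fin 2) (Fin 2) (Af F)).mulVec ![1, 0] := by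
    rw [toGpi_eq]
    exact mulVec_mul_borel g.1 b.t₁ b.t₂ b.u
  have h2 : Matrix.GeneralLinearGroup.det (g * b.toGpi).1 * (b.t₁⁻¹ * t) =
      b.t₂ * (Matrix.GeneralLinearGroup.det g.1 * t) := by
    rw [toGpi_eq, Prod.fst_mul, map_mul, det_borel]
    have : ∀ a b c d : (Af F)ˣ, a * (b * c) * (b⁻¹ * d) = c * (a * d) := fun a b c d => by
      rw [mul_comm b c, mul_assoc a, mul_assoc c, mul_inv_cancel_left, mul_left_comm]
    exact this _ _ _ _
  rw [sectionIntegrand, sectionIntegrand, h1, h2, smul_smul, ← Units.val_mul,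
    mul_comm _ b.t₁, mul_inv_cancel_left, heckeTilde_eq hφ, map_mul, map_mul, finNorm_mul]
  change heckeEta φ (detIdele (g * b.toGpi)) * _ * _ * _ =
    heckeEta φ (detIdele g) * _ * _ * _ * _
  rw [detIdele_mul, heckeEta_eq, heckeEta_eq, map_mul]
  push_cast
  rw [mul_pow]
  ring

theorem integral_sectionIntegrand_mul_toGpi (hφ : φ ∈ heckeChars F m) (g : Gpi F) (b : BorelPi F) :
    ∫ t, sectionIntegrand m N φ ψ (chiHom m φ) 1 (g * b.toGpi) t ∂mulMeasure F =
      (∫ t, sectionIntegrand m N φ ψ (chiHom m φ) 1 g t ∂mulMeasure F) *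
        heckeTilde F m 1 φ b := by
  rw [← integral_mul_left_mulMeasure _ b.t₁⁻¹, ← integral_mul_const]
  exact integral_congr_ae (ae_of_all _ fun t => sectionIntegrand_mul_toGpi hφ g b t)

theorem exists_norm_eq_one {x : GL (Fin 2) (Af F)} (hx : x ∈ levelOne F)
    (v : HeightOneSpectrum (𝓞 F)) :
    ∃ i, ‖(x : Matrix (Fin 2) (Fin 2) (Af F)) i 0 v‖ = 1 := by
  by_contra! h
  have hi : ∀ i j, ‖(x : Matrix (Fin 2) (Fin 2) (Af F)) i j v‖ ≤ 1 := fun i j =>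
    mem_integralAdeles.1 ((mem_levelOne.1 hx).1 i j) v
  have h1 : ∀ i, ‖(x : Matrix (Fin 2) (Fin 2) (Af F)) i 0 v‖ < 1 := fun i =>
    lt_of_le_of_ne (hi i 0) (h i)
  have hd := mem_integralUnits.1 (det_mem_integralUnits hx) v
  rw [det_apply_fin_two, sub_eq_add_neg] at hd
  have h2 := norm_add_le_max v (x.1 0 0 v * x.1 1 1 v) (-(x.1 0 1 v * x.1 1 0 v))
  rw [hd, norm_neg, norm_mul, norm_mul] at h2
  refine absurd h2 (not_le.2 (max_lt ?_ ?_))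
  · exact mul_lt_one_of_nonneg_of_lt_one_left (norm_nonneg _) (h1 0) (hi 1 1)
  · exact mul_lt_one_of_nonneg_of_lt_one_right (hi 0 1) (norm_nonneg _) (h1 1)

/-- Where the scaled first column of an element of `GL₂(Ô)` meets the support of `s\bar ψ`. -/
theorem mem_integralIdelesAway_of_inSupport {hN : N ≠ 0} {x y : GL (Fin 2) (Af F)}
    (hx : x ∈ levelOne F) {t : (Af F)ˣ} (h : InSupport hN y
      ((t : Af F) • (x : Matrix (Fin 2) (Fin 2) (Af F)).mulVec ![1, 0])) :
    t ∈ integralIdelesAway {v : HeightOneSpectrum (𝓞 F) | (N : 𝓞 F) ∈ v.asIdeal} := by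
  have ht : ∀ i, ((t : Af F) • (x : Matrix (Fin 2) (Fin 2) (Af F)).mulVec ![1, 0]) i =
      t * (x : Matrix (Fin 2) (Fin 2) (Af F)) i 0 := fun i => by
    rw [Pi.smul_apply, mulVec_e_apply, smul_eq_mul]
  -- The first column of an element of `GL₂(Ô)` has a unit entry at every place. Used for `x` this
  -- shows that `t` is integral; used for `y`, together with the congruence modulo `N`, that `t` is
  -- a unit at the places dividing `N`.
  have h1 : ∀ v, ‖(t : Af F) v‖ ≤ 1 := by
    intro v
    obtain ⟨i, hi⟩ := exists_norm_eq_one hx v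
    have := mem_integralAdeles.1 (h.mem_integralAdeles i) v
    rwa [ht, Af.mul_apply, norm_mul, hi, mul_one] at this
  refine ⟨mem_integralAdeles.2 h1, fun v hv => le_antisymm (h1 v) ?_⟩
  obtain ⟨i, hi⟩ := exists_norm_eq_one h.1 v
  have h2 := mem_natLattice.1 (h.2 i) v
  have h3 := (norm_natCast_lt_one_iff v N).2 hv
  rw [ht] at h2
  set a := (t : Af F) v * (x : Matrix (Fin 2) (Fin 2) (Af F)) i 0 v with ha
  have h4 : ‖a - (y : Matrix (Fin 2) (Fin 2) (Af F)) i 0 v‖ < 1 := h2.trans_lt h3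
  have h5 := norm_add_le_max v a (-(a - (y : Matrix (Fin 2) (Fin 2) (Af F)) i 0 v))
  rw [← sub_eq_add_neg, sub_sub_cancel, hi, norm_neg] at h5
  have h6 : 1 ≤ ‖a‖ := by
    rcases le_max_iff.1 h5 with h | h
    · exact h
    · exact absurd h4 (not_lt.2 h)
  rw [ha, norm_mul] at h6
  exact h6.trans (mul_le_of_le_one_right (norm_nonneg _)
    (mem_integralAdeles.1 ((mem_levelOne.1 hx).1 i 0) v))

/-- The part `a` of `t` at the places dividing `N` is an integral unit congruent to `t` modulo `N`,
so `t x e¹` lies in the coset attached to `x diag(a, 1)`. -/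
theorem sBarPsi_smul_column (hφ : φ ∈ heckeChars F m) (hψ : ψ ∈ induced F {heckeTilde F m 1 φ})
    (hN : N ≠ 0) (hA : IsAdapted F N φ ψ) {x : GL (Fin 2) (Af F)} (hx : x ∈ levelOne F)
    {t : (Af F)ˣ}
    (ht : t ∈ integralIdelesAway {v : HeightOneSpectrum (𝓞 F) | (N : 𝓞 F) ∈ v.asIdeal}) :
    sBarPsi N φ ψ ((t : Af F) • (x : Matrix (Fin 2) (Fin 2) (Af F)).mulVec ![1, 0]) =
      barPsi φ ψ x * (((chiHom m φ (finIdele F t))⁻¹ * chiHom m φ (finIdele F (awayPart N t)) :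
        ℂˣ) : ℂ) := by
  set a := t * (awayPart N t)⁻¹ with ha
  have ha1 : ∀ v : HeightOneSpectrum (𝓞 F), (N : 𝓞 F) ∈ v.asIdeal → (a : Af F) v = (t : Af F) v :=
    fun v hv => by
      rw [ha, Units.val_mul, Af.mul_apply, Af.inv_apply, awayPart_apply_of_mem N hv, inv_one, mul_one]
  have ha2 : ∀ v : HeightOneSpectrum (𝓞 F), (N : 𝓞 F) ∉ v.asIdeal → (a : Af F) v = 1 :=
    fun v hv => by
      rw [ha, Units.val_mul, Af.mul_apply, Af.inv_apply, awayPart_apply_of_notMem N hv,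
        mul_inv_cancel₀ (Af.unit_ne_zero t v)]
  have hau : a ∈ integralUnits F := mem_integralUnits.2 fun v => by
    by_cases hv : (N : 𝓞 F) ∈ v.asIdeal
    · rw [ha1 v hv]; exact ht.2 v hv
    · rw [ha2 v hv, norm_one]
  have hta : (t : Af F) - a ∈ natLattice N hN := mem_natLattice.2 fun v => by
    change ‖(t : Af F) v - (a : Af F) v‖ ≤ _
    by_cases hv : (N : 𝓞 F) ∈ v.asIdeal
    · rw [ha1 v hv, sub_self, norm_zero]; exact norm_nonneg _
    · rw [(norm_natCast_eq_one_iff v N).2 hv]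
      exact mem_integralAdeles.1 (sub_mem (show (t : Af F) ∈ integralAdeles F from ht.1)
        (show (a : Af F) ∈ integralAdeles F from hau.1)) v
  have hx0 : InSupport hN x ((x : Matrix (Fin 2) (Fin 2) (Af F)).mulVec ![1, 0]) :=
    ⟨hx, fun i => by rw [mulVec_e_apply, sub_self]; exact zero_mem _⟩
  have hs := (hx0.smul hau).add (w := ((t : Af F) - a) •
    (x : Matrix (Fin 2) (Fin 2) (Af F)).mulVec ![1, 0]) (mem_box.2 fun i => by
      rw [Pi.smul_apply, mulVec_e_apply, smul_eq_mul, mul_comm]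
      exact mul_mem_lattice ((mem_levelOne.1 hx).1 i 0) hta)
  rw [← add_smul, add_sub_cancel] at hs
  rw [sBarPsi_eq hφ hψ hN hA hs, barPsi_mul_borel hφ hψ, finNorm_eq_one hau, ha, map_mul, map_mul,
    map_inv, map_inv, mul_inv_rev, inv_inv, mul_comm (chiHom m φ _)]
  simp

/-- Undoes the scalar twist in `\bar ψ` by equivariance of `ψ`. As `det x` is an integral unit, no
power of its norm appears. -/
theorem barPsi_eq (hφ : φ ∈ heckeChars F m) (hψ : ψ ∈ induced F {heckeTilde F m 1 φ})
    {x : GL (Fin 2) (Af F)} (hx : x ∈ levelOne F) :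
    barPsi φ ψ x * (etaHom φ (finIdele F (Matrix.GeneralLinearGroup.det x)) : ℂ) *
      (chiHom m φ (finIdele F (Matrix.GeneralLinearGroup.det x)) : ℂ) = ψ (x, 1) := by
  set d := Matrix.GeneralLinearGroup.det x with hd
  have hdu : d ∈ integralUnits F := det_mem_integralUnits hx
  have h1 := apply_mul_toGpi hφ hψ (x, 1) (BorelPi.mk d⁻¹ d⁻¹ 0 1 1)
  have h2 : borel d⁻¹ d⁻¹ 0 = (Matrix.GeneralLinearGroup.scalar (Fin 2) d)⁻¹ := by
    have h3 : borel (1 : (Af F)ˣ) 1 0 = 1 := Units.ext (by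
      rw [coe_borel]; simp [Matrix.one_fin_two])
    have h4 := scalar_mul_borel d⁻¹ 1 1 0
    rw [h3, mul_one, mul_one] at h4
    rw [← h4]
    exact map_inv (Matrix.GeneralLinearGroup.scalar (Fin 2)) d
  rw [heckeTilde_eq hφ, detIdele_toGpi_one, toGpi_eq, Prod.mk_mul_mk, mul_one, mul_one, h2,
    ← scalar_comm, finNorm_eq_one (inv_mem hdu)] at h1
  rw [barPsi, ← hd, h1, heckeEta_eq]
  simp only [map_mul, map_inv]
  push_cast
  have h4 := (etaHom φ (finIdele F d)).ne_zero
  have h5 := (chiHom m φ (finIdele F d)).ne_zero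
  field_simp
  simp

theorem sectionIntegrand_levelOne (hφ : φ ∈ heckeChars F m)
    (hψ : ψ ∈ induced F {heckeTilde F m 1 φ}) (hN : N ≠ 0) (hA : IsAdapted F N φ ψ)
    {x : GL (Fin 2) (Af F)} (hx : x ∈ levelOne F) (t : (Af F)ˣ) :
    sectionIntegrand m N φ ψ (chiHom m φ) 1 (x, 1) t =
      (integralIdelesAway {v : HeightOneSpectrum (𝓞 F) | (N : 𝓞 F) ∈ v.asIdeal}).indicator
        (fun t => ψ (x, 1) * ((chiHom m φ (finIdele F (awayPart N t)) : ℂ) *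
          (finNorm F t : ℂ) ^ (m + 2))) t := by
  rw [sectionIntegrand]
  change heckeEta φ (detIdele (x, 1)) * _ * _ * _ = _
  rw [detIdele_mk_one, heckeEta_eq, Units.val_one, one_smul, finNorm_mul,
    finNorm_eq_one (det_mem_integralUnits hx), one_mul]
  by_cases ht : t ∈ integralIdelesAway {v : HeightOneSpectrum (𝓞 F) | (N : 𝓞 F) ∈ v.asIdeal}
  · rw [Set.indicator_of_mem ht, sBarPsi_smul_column hφ hψ hN hA hx ht, ← barPsi_eq hφ hψ hx,
      map_mul, map_mul]
    push_cast
    have h5 := (chiHom m φ (finIdele F t)).ne_zero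
    field_simp
  · rw [Set.indicator_of_notMem ht,
      sBarPsi_of_forall_not hN fun y hy => ht (mem_integralIdelesAway_of_inSupport hx hy)]
    simp

theorem exists_eq_mul_toGpi (g : Gpi F) : ∃ x ∈ levelOne F, ∃ b : BorelPi F,
    g = (x, 1) * b.toGpi := by
  obtain ⟨x, hx, t₁, t₂, u, h⟩ := exists_iwasawa g.1
  -- Only the product of the two sign families matters in `G`, so all signs go to the first diagonal
  -- entry.
  refine ⟨x, hx, ⟨t₁, t₂, u, g.2, 1⟩, ?_⟩
  rw [toGpi_eq, Prod.mk_mul_mk, one_mul, mul_one, ← h]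

/-- The image of the explicit sections under the horospherical map. -/
theorem exists_integral_sectionIntegrand (hφ : φ ∈ heckeChars F m)
    (hψ : ψ ∈ induced F {heckeTilde F m 1 φ}) (hN : N ≠ 0) (hA : IsAdapted F N φ ψ) :
    ∃ L : ℂ, L ≠ 0 ∧ HasProd (fun v : {v : HeightOneSpectrum (𝓞 F) // (N : 𝓞 F) ∉ v.asIdeal} =>
        eulerFactor m φ v) L ∧
      ∀ g, ∫ t, sectionIntegrand m N φ ψ (chiHom m φ) 1 g t ∂mulMeasure F =
        (1 / √|(discr F : ℝ)| : ℝ) * L * ψ g := by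
  have hθ := chiHom_mem_classChars hφ hN hA.1
  obtain ⟨L, hL0, hL, hint⟩ := exists_eulerProduct hN (Nat.le_add_left 2 m)
    ((chiHom m φ).comp (finIdele F))
    (fun u hu => hθ.1 (by
      rw [clSubgroup_eq, detGroup_levelGroup hN]
      exact Subgroup.mem_sup_left (Subgroup.mem_sup_left ⟨u, hu, rfl⟩)))
    fun t => norm_classChar (isOpen_levelGroup hN) hθ.1 _
  refine ⟨L, hL0, ?_, fun g => ?_⟩
  · convert hL using 2 with v
    rw [eulerFactor, heckeChi_eq]
    rfl
  · obtain ⟨x, hx, b, rfl⟩ := exists_eq_mul_toGpi g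
    rw [integral_sectionIntegrand_mul_toGpi hφ, apply_mul_toGpi hφ hψ]
    simp_rw [sectionIntegrand_levelOne hφ hψ hN hA hx]
    rw [integral_indicator (measurableSet_integralIdelesAway _), integral_const_mul]
    have := hint
    simp only [MonoidHom.comp_apply] at this
    rw [this]
    ring

/-- The explicit preimage. -/
theorem exists_rho_eq (hφ : φ ∈ heckeChars F m)
    (hψ : ψ ∈ induced F {heckeTilde F m 1 φ}) (hN : N ≠ 0) (hA : IsAdapted F N φ ψ) :
    ∃ L : ℂ, L ≠ 0 ∧ HasProd (fun v : {v : HeightOneSpectrum (𝓞 F) // (N : 𝓞 F) ∉ v.asIdeal} =>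
        eulerFactor m φ v) L ∧ ∀ R : Finset (Ideles F), IsRepSystem N R →
      ∃ f ∈ schwartz F,
        (∀ v g, finFourier F (fun w => f w g) v = preimageFourier m N φ ψ R v g) ∧
        ∀ g, rho F m f g = (rayClSubgroup F N).index * gammaFactor F m *
          (1 / √|(discr F : ℝ)| : ℝ) * L * ψ g := by
  obtain ⟨L, hL0, hL, h⟩ := exists_integral_sectionIntegrand hφ hψ hN hA
  refine ⟨L, hL0, hL, fun R hR => ?_⟩
  have hP := preimageFourier_mem_schwartz hφ hψ hN hA R
  refine ⟨_, fourier_mem_schwartz hP, fun v g => ?_, fun g => ?_⟩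
  · exact congrFun (congrFun (fourier_fourier hP) v) g
  · rw [rho_preimage hφ hψ hN hA hR, h]
    ring

end

end

/-! ### Isotypic components of the induced module and surjectivity. -/

section

variable {F : Type*} [Field F] [NumberField F]

/-! ### Decomposition of the induced module -/

/-- The torus of `B(𝔸_f) × π₀(B(ℝ))`. -/
abbrev Torus (F : Type*) [Field F] [NumberField F] :=
  (Af F)ˣ × (Af F)ˣ × Signs F × Signs F

/-- The diagonal part of an element of `B(𝔸_f) × π₀(B(ℝ))`. -/
def BorelPi.torus (b : BorelPi F) : Torus F := (b.t₁, b.t₂, b.ε₁, b.ε₂)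

theorem torus_surjective : Function.Surjective (BorelPi.torus (F := F)) := fun p =>
  ⟨⟨p.1, p.2.1, 0, p.2.2.1, p.2.2.2⟩, rfl⟩

theorem borel_mul_borel (s₁ s₂ t₁ t₂ : (Af F)ˣ) (u w : Af F) :
    borel s₁ s₂ u * borel t₁ t₂ w =
      borel (s₁ * t₁) (s₂ * t₂) (w + u * t₂ * (t₁⁻¹ : (Af F)ˣ)) := by
  refine Units.ext ?_
  rw [Units.val_mul, coe_borel, coe_borel, coe_borel, Matrix.mul_fin_two]
  have h : (s₁ : Af F) * (t₁ * w) + s₁ * u * t₂ =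
      ((s₁ * t₁ : (Af F)ˣ) : Af F) * (w + u * t₂ * (t₁⁻¹ : (Af F)ˣ)) := by
    have := t₁.mul_inv
    rw [Units.val_mul]
    linear_combination (-(s₁ : Af F) * u * t₂) * this
  rw [h]
  simp

theorem exists_toGpi_mul (b b' : BorelPi F) :
    ∃ c : BorelPi F, c.toGpi = b.toGpi * b'.toGpi ∧ c.torus = b.torus * b'.torus :=
  ⟨⟨b.t₁ * b'.t₁, b.t₂ * b'.t₂, _, b.ε₁ * b'.ε₁, b.ε₂ * b'.ε₂⟩, by
    rw [toGpi_eq, toGpi_eq, toGpi_eq, Prod.mk_mul_mk, borel_mul_borel, mul_mul_mul_comm], rfl⟩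

/-- Linear independence of characters of the torus, pulled back along the surjection
`BorelPi.torus`. -/
theorem linearIndependent_characters (C : Set (BorelPi F → ℂ))
    (hC : ∀ c ∈ C, ∃ f : Torus F →* ℂ, ∀ b : BorelPi F, c b = f b.torus) :
    LinearIndependent ℂ (fun c : C => (c : BorelPi F → ℂ)) := by
  choose f hf using fun c : C => hC c c.2
  have h1 : Function.Injective f := fun c c' h =>
    Subtype.ext (funext fun b => by rw [hf, hf, h])
  have h2 := ((linearIndependent_monoidHom (Torus F) ℂ).comp f h1).map'
    (LinearMap.funLeft ℂ ℂ (BorelPi.torus (F := F)))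
    (LinearMap.ker_eq_bot.2 (LinearMap.funLeft_injective_of_surjective _ _ _ torus_surjective))
  have h3 : (fun c : C => (c : BorelPi F → ℂ)) =
      LinearMap.funLeft ℂ ℂ (BorelPi.torus (F := F)) ∘ (fun f : Torus F →* ℂ => (f : Torus F → ℂ)) ∘ f :=
    funext fun c => funext fun b => hf c b
  rw [h3]
  exact h2

variable [IsTotallyReal F]

theorem IsSmooth.exists_levelGroup {X : Type*} {ψ : Gpi F → X} (h : IsSmooth F ψ) :
    ∃ N : ℕ, N ≠ 0 ∧ ∀ k ∈ levelGroup F N, ∀ x, ψ ((k, 1) * x) = ψ x := by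
  obtain ⟨K, hK, -, h⟩ := h
  obtain ⟨N, hN, hN'⟩ := exists_levelGroup_subset hK (one_mem K)
  exact ⟨N, hN, fun k hk => h k (hN' hk)⟩

/-- There are finitely many double cosets `K_N \ G(𝔸_f) × π₀(G(ℝ)) / B(𝔸_f) × π₀(B(ℝ))`. -/
theorem exists_finset_forall_eq {N : ℕ} (hN : N ≠ 0) : ∃ S : Finset (GL (Fin 2) (Af F)),
    ∀ g : Gpi F, ∃ x ∈ S, ∃ k ∈ levelGroup F N, ∃ b : BorelPi F,
      g = (k, 1) * ((x, 1) * b.toGpi) := by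
  obtain ⟨S, hS⟩ := (isCompact_levelOne F).elim_finite_subcover
    (fun x : GL (Fin 2) (Af F) => (fun y => y * x⁻¹) ⁻¹' (levelGroup F N : Set _))
    (fun x => (isOpen_levelGroup hN).preimage (continuous_mul_const x⁻¹))
    fun x _ => Set.mem_iUnion.2 ⟨x, by
      rw [Set.mem_preimage, mul_inv_cancel]; exact one_mem _⟩
  refine ⟨S, fun g => ?_⟩
  obtain ⟨y, hy, b, rfl⟩ := exists_eq_mul_toGpi g
  obtain ⟨x, hx, hxy⟩ := Set.mem_iUnion₂.1 (hS hy)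
  refine ⟨x, hx, _, hxy, b, ?_⟩
  rw [← mul_assoc]
  congr 1
  exact Prod.ext (inv_mul_cancel_right _ _).symm (mul_one 1).symm

/-- The component at `c` sends `x` to the coefficient of `c` in `b ↦ ψ(x b)`. Uniqueness of
coefficients makes it equivariant and smooth. Finitely many `c` occur in all because the set of
non-zero coefficients is constant on each of the finitely many double cosets. -/
theorem exists_decomposition {C : Set (BorelPi F → ℂ)}
    (hC : ∀ c ∈ C, ∃ f : Torus F →* ℂ, ∀ b : BorelPi F, c b = f b.torus) {ψ : Gpi F → ℂ}
    (hψ : ψ ∈ induced F C) : ∃ (S : Finset C) (Ψ : C → Gpi F → ℂ),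
      (∀ c : C, Ψ c ∈ induced F {(c : BorelPi F → ℂ)}) ∧ ψ = ∑ c ∈ S, Ψ c := by
  classical
  have hli := linearIndependent_characters C hC
  have hmem : ∀ x, ∃ l : C →₀ ℂ, Finsupp.linearCombination ℂ (fun c : C => (c : BorelPi F → ℂ)) l =
      fun b : BorelPi F => ψ (x * b.toGpi) := fun x => by
    have := hψ.2 x
    rwa [← Subtype.range_coe (s := C), Finsupp.mem_span_range_iff_exists_finsupp] at this
  choose l hl using hmem
  have huniq : ∀ x (l' : C →₀ ℂ), Finsupp.linearCombination ℂ (fun c : C => (c : BorelPi F → ℂ)) l' =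
      (fun b : BorelPi F => ψ (x * b.toGpi)) → l x = l' := fun x l' h => hli ((hl x).trans h.symm)
  have hmulC : ∀ c : C, ∀ b b' b'' : BorelPi F, b''.torus = b.torus * b'.torus →
      (c : BorelPi F → ℂ) b'' = (c : BorelPi F → ℂ) b * (c : BorelPi F → ℂ) b' := by
    intro c b b' b'' h
    obtain ⟨f, hf⟩ := hC c c.2
    rw [hf, hf, hf, h, map_mul]
  have heval : ∀ x b, ψ (x * b.toGpi) = (l x).sum fun c a => a * (c : BorelPi F → ℂ) b := by
    intro x b
    rw [← congrFun (hl x) b, Finsupp.linearCombination_apply, Finsupp.sum, Finsupp.sum,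
      Finset.sum_apply]
    rfl
  -- Expand `ψ(x b b')` as a function of `b'` in two ways, using that each `c` is multiplicative.
  have hright : ∀ x (b : BorelPi F) c, l (x * b.toGpi) c = l x c * (c : BorelPi F → ℂ) b := by
    intro x b c
    have hsupp : ∀ c : C, l x c * (c : BorelPi F → ℂ) b ≠ 0 → c ∈ (l x).support := fun c h =>
      Finsupp.mem_support_iff.2 (left_ne_zero_of_mul h)
    rw [huniq (x * b.toGpi) (Finsupp.onFinset (l x).support
      (fun c => l x c * (c : BorelPi F → ℂ) b) hsupp) ?_, Finsupp.onFinset_apply]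
    funext b'
    obtain ⟨b'', h1, h2⟩ := exists_toGpi_mul b b'
    rw [mul_assoc, ← h1, heval, Finsupp.linearCombination_apply, Finsupp.onFinset_sum hsupp
      (fun c => zero_smul ℂ (c : BorelPi F → ℂ)), Finset.sum_apply, Finsupp.sum]
    refine Finset.sum_congr rfl fun c _ => ?_
    rw [hmulC c b b' b'' h2, ← mul_assoc]
    rfl
  obtain ⟨N, hN, hψN⟩ := hψ.1.exists_levelGroup
  have hleft : ∀ k ∈ levelGroup F N, ∀ x, l ((k, 1) * x) = l x := fun k hk x =>
    huniq _ _ ((hl x).trans (funext fun b => by rw [mul_assoc, hψN k hk]))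
  obtain ⟨D, hD⟩ := exists_finset_forall_eq (F := F) hN
  refine ⟨D.biUnion fun x => (l (x, 1)).support, fun c x => l x c, fun c => ⟨?_, fun x => ?_⟩, ?_⟩
  · exact ⟨levelGroup F N, isOpen_levelGroup hN, isCompact_levelGroup hN, fun k hk x =>
      DFunLike.congr_fun (hleft k hk x) c⟩
  · refine Submodule.mem_span_singleton.2 ⟨l x c, funext fun b => (hright x b c).symm⟩
  · funext g
    have h1 := heval g (BorelPi.mk 1 1 0 1 1)
    rw [toGpi_one, mul_one] at h1
    rw [h1, Finset.sum_apply]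
    have hone : ∀ c : C, (c : BorelPi F → ℂ) (BorelPi.mk 1 1 0 1 1) = 1 := fun c => by
      obtain ⟨f, hf⟩ := hC c c.2
      rw [hf]
      exact map_one f
    simp_rw [hone, mul_one]
    refine Finsupp.sum_of_support_subset _ (fun c hc => ?_) _ fun _ _ => rfl
    obtain ⟨x, hx, k, hk, b, rfl⟩ := hD g
    refine Finset.mem_biUnion.2 ⟨x, hx, Finsupp.mem_support_iff.2 fun h => ?_⟩
    rw [hleft k hk, Finsupp.mem_support_iff, hright, h, zero_mul] at hc
    exact hc rfl

theorem exists_torusChar (m : ℕ) (φ : Ideles F × Ideles F →* ℂˣ) :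
    ∃ f : Torus F →* ℂ, ∀ b : BorelPi F, heckeTilde F m 1 φ b = f b.torus := by
  refine ⟨(Units.coeHom ℂ).comp
    { toFun := fun p => φ (finIdele F p.1, finIdele F p.2.1) * heckeSign F m 1 φ p.2.2.1 p.2.2.2
      map_one' := ?_
      map_mul' := fun p q => ?_ }, fun b => rfl⟩
  · have h1 : φ (1, 1) = 1 := map_one φ
    simp [heckeSign, gammaChar_one, h1, realNorm]
  · have h1 : ∀ a b c d : Ideles F, φ (a * b, c * d) = φ (a, c) * φ (b, d) := fun a b c d => by
      rw [← map_mul, Prod.mk_mul_mk]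
    have h2 : ∀ x y : InfinitePlace F → ℝˣ, realNorm F (x * y) = realNorm F x * realNorm F y :=
      fun x y => by simp [realNorm, Finset.prod_mul_distrib]
    simp only [heckeSign, gammaChar_one, Prod.fst_mul, Prod.snd_mul, map_mul, h1, h2, mul_pow,
      mul_inv]
    have h3 : ∀ a b c d e f : ℂˣ, a * b * (c * d * (e * f)) = a * (c * e) * (b * (d * f)) :=
      fun a b c d e f => by rw [mul_mul_mul_comm c d, mul_mul_mul_comm a b]
    exact h3 _ _ _ _ _ _

/-! ### Surjectivity -/

theorem finiteIndex_rayClSubgroup {N : ℕ} (hN : N ≠ 0) : (rayClSubgroup F N).FiniteIndex := by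
  rw [rayClSubgroup_eq]
  exact finiteIndex_idealClassSubgroup (isOpen_unitLevel hN)

theorem exists_isRepSystem {N : ℕ} (hN : N ≠ 0) : ∃ R : Finset (Ideles F), IsRepSystem N R := by
  classical
  have := finiteIndex_rayClSubgroup (F := F) hN
  have := Fintype.ofFinite (Ideles F ⧸ rayClSubgroup F N)
  refine ⟨Finset.univ.image (Quotient.out : Ideles F ⧸ rayClSubgroup F N → Ideles F), fun t =>
    ⟨(QuotientGroup.mk t : Ideles F ⧸ rayClSubgroup F N).out,
      ⟨Finset.mem_image_of_mem _ (Finset.mem_univ _), ?_⟩, ?_⟩⟩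
  · exact QuotientGroup.eq.1 (Quotient.out_eq _)
  · rintro u ⟨hu, h⟩
    obtain ⟨q, -, rfl⟩ := Finset.mem_image.1 hu
    have h1 : (QuotientGroup.mk q.out : Ideles F ⧸ rayClSubgroup F N) = q := Quotient.out_eq _
    rw [← QuotientGroup.eq.2 h, h1]

theorem gammaFactor_ne_zero (m : ℕ) : gammaFactor F m ≠ 0 := by
  refine div_ne_zero (pow_ne_zero _ (Complex.Gamma_ne_zero_of_re_pos ?_)) (pow_ne_zero _ ?_)
  · simp only [Complex.add_re, Complex.natCast_re, Complex.re_ofNat]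
    positivity
  · simp [Real.pi_ne_zero, Complex.I_ne_zero]

theorem exists_rho_eq_of_mem_induced {m : ℕ} {φ : Ideles F × Ideles F →* ℂˣ}
    (hφ : φ ∈ heckeChars F m) {ψ : Gpi F → ℂ} (hψ : ψ ∈ induced F {heckeTilde F m 1 φ}) :
    ∃ f ∈ schwartz F, rho F m f = ψ := by
  obtain ⟨N, hN, hA⟩ := exists_isAdapted hφ hψ.1
  have hN := hN.ne'
  obtain ⟨L, hL, -, h⟩ := exists_rho_eq hφ hψ hN hA
  obtain ⟨R, hR⟩ := exists_isRepSystem (F := F) hN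
  obtain ⟨f, hf, -, hρ⟩ := h R hR
  set a : ℂ := (rayClSubgroup F N).index * gammaFactor F m * (1 / √|(discr F : ℝ)| : ℝ) * L with ha
  have ha0 : a ≠ 0 := by
    have := finiteIndex_rayClSubgroup (F := F) hN
    have h1 : (1 / √|(discr F : ℝ)| : ℝ) ≠ 0 :=
      one_div_ne_zero (Real.sqrt_ne_zero'.2 abs_discr_pos)
    exact mul_ne_zero (mul_ne_zero (mul_ne_zero (Nat.cast_ne_zero.2 Subgroup.FiniteIndex.index_ne_zero)
      (gammaFactor_ne_zero m)) (Complex.ofReal_ne_zero.2 h1)) hL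
  refine ⟨a⁻¹ • f, Submodule.smul_mem _ _ hf, ?_⟩
  rw [rho_smul m hf]
  funext g
  rw [Pi.smul_apply, hρ, smul_eq_mul, inv_mul_cancel_left₀ ha0]

theorem sum_mem_image_rho (m : ℕ) {ι : Type*} (S : Finset ι) (Ψ : ι → Gpi F → ℂ)
    (h : ∀ c, ∃ f ∈ schwartz F, rho F m f = Ψ c) :
    ∃ f ∈ schwartz F, rho F m f = ∑ c ∈ S, Ψ c := by
  classical
  induction S using Finset.induction_on with
  | empty =>
    -- The value of the map at `0` comes from homogeneity with the scalar `0`.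
    have h0 := rho_smul m (schwartz F).zero_mem 0
    rw [zero_smul, zero_smul] at h0
    exact ⟨0, (schwartz F).zero_mem, h0⟩
  | insert c S hc ih =>
    obtain ⟨f, hf, hρ⟩ := h c
    obtain ⟨f', hf', hρ'⟩ := ih
    exact ⟨f + f', (schwartz F).add_mem hf hf', by
      rw [Finset.sum_insert hc, rho_add m hf hf', hρ, hρ']⟩

theorem surjOn_rho (m : ℕ) : Set.SurjOn (rho F m) (schwartz F)
    (induced F (heckeTilde F m 1 '' heckeChars F m)) := by
  intro ψ hψ
  have hC : ∀ c ∈ heckeTilde F m 1 '' heckeChars F m,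
      ∃ f : Torus F →* ℂ, ∀ b : BorelPi F, c b = f b.torus := by
    rintro _ ⟨φ, -, rfl⟩
    exact exists_torusChar m φ
  obtain ⟨S, Ψ, hΨ, e⟩ := exists_decomposition hC hψ
  rw [e]
  refine sum_mem_image_rho m S Ψ fun c => ?_
  obtain ⟨φ, hφ, hc⟩ := c.2
  have h := hΨ c
  rw [← hc] at h
  exact exists_rho_eq_of_mem_induced hφ h

end

end Horospherical

end

theorem mainTheorem3 (F : Type*) [Field F] [NumberField F] [IsTotallyReal F] (m : ℕ) :
    -- the horospherical map is well defined: levels exist, the sums are finite, the integrals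
    -- converge, and the value does not depend on the level
    (∀ f ∈ schwartz F, ∃ K, IsLevel f K) ∧
    (∀ f ∈ schwartz F, ∀ K, IsLevel f K →
      (classChars F K m).Finite ∧
      (∀ χ ∈ classChars F K m, ∀ g, MeasureTheory.Integrable (rhoIntegrand F m f χ g)
        (mulMeasure F)) ∧
      rho F m f = rhoAt F m K f) ∧
    -- it takes values in the induced module, and it is surjective
    Set.MapsTo (rho F m) (schwartz F) (induced F (heckeTilde F m 1 '' heckeChars F m)) ∧
    Set.SurjOn (rho F m) (schwartz F) (induced F (heckeTilde F m 1 '' heckeChars F m)) ∧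
    -- the explicit preimage
    (∀ φ ∈ heckeChars F m, ∀ ψ ∈ induced F {heckeTilde F m 1 φ},
      (∃ N : ℕ, 0 < N ∧ IsAdapted F N φ ψ) ∧
      ∀ N : ℕ, 0 < N → IsAdapted F N φ ψ →
        (rayClSubgroup F N).FiniteIndex ∧
        ∃ L : ℂ, L ≠ 0 ∧
          HasProd (fun v : {v : IsDedekindDomain.HeightOneSpectrum (𝓞 F) //
            (N : 𝓞 F) ∉ v.asIdeal} => eulerFactor m φ v) L ∧
          ∀ R : Finset (Ideles F), IsRepSystem N R →
            ∃ f ∈ schwartz F,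
              (∀ v g, finFourier F (fun w => f w g) v = preimageFourier m N φ ψ R v g) ∧
              ∀ g, rho F m f g =
                (rayClSubgroup F N).index * gammaFactor F m *
                  (1 / √|(discr F : ℝ)| : ℝ) * L * ψ g) := by
  refine ⟨fun f hf => ?_, fun f hf K hK => ⟨finite_classChars hK.isOpen m,
    fun χ hχ g => integrable_rhoIntegrand m hf hK.isOpen hχ.1 g, rho_eq_rhoAt m hf hK⟩,
    fun f hf => rho_mem_induced m hf, surjOn_rho m, fun φ hφ ψ hψ =>
      ⟨exists_isAdapted hφ hψ.1, fun N hN hA =>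
        ⟨finiteIndex_rayClSubgroup hN.ne', exists_rho_eq hφ hψ hN.ne' hA⟩⟩⟩
  obtain ⟨N, -, h⟩ := exists_isLevel hf
  exact ⟨_, h⟩
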